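/- **Theorem (Moment universality).** There is a universal constant $C$ such that the following holds. Let $d\ge 2$, $n\ge 0$, let $Z_0$ be a deterministic self-adjoint complex $d\times d$ matrix, let $Z_1,\dots,Z_n$ be independent self-adjoint complex $d\times d$ random matrices with square-integrable entries and $\mathbf{E}[Z_i]=0$, and let $X=Z_0+\sum_{i=1}^n Z_i$. Let $G$ be a self-adjoint $d\times d$ random matrix (possibly on another probability space) such that the real and imaginary parts of its entries are jointly Gaussian, $\mathbf{E}[G]=\mathbf{E}[X]$, and $\mathrm{Cov}(G)=\mathrm{Cov}(X)$, where $\mathrm{Cov}(X)_{ij,kl}=\mathbf{E}\big[(X-\mathbf{E}X)_{ij}\overline{(X-\mathbf{E}X)_{kl}}\big]$. Write $\operatorname{tr}M=\frac1d\operatorname{Tr}M$ for the normalized trace and $\|M\|$ for the spectral norm. For $2\le q<\infty$ put $$\sigma_q(X)=\Big(\operatorname{tr}\,\big(\mathbf{E}[(X-\mathbf{E}X)^2]\big)^{q/2}\Big)^{1/q},\qquad R_q(X)=\Big(\sum_{i=1}^n\mathbf{E}[\operatorname{tr}|Z_i|^q]\Big)^{1/q}\in[0,\infty],$$ and put $\sigma_\infty(X)=\big\|\mathbf{E}[(X-\mathbf{E}X)^2]\big\|^{1/2}$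 and $R_\infty(X)=\operatorname{ess\,sup}\max_{1\le i\le n}\|Z_i\|\in[0,\infty]$. Then for every integer $p\ge 1$ and every $q\in[2p,\infty]$ (real or infinite), $$\Big|\mathbf{E}[\operatorname{tr}X^{2p}]^{\frac1{2p}}-\mathbf{E}[\operatorname{tr}G^{2p}]^{\frac1{2p}}\Big|\le C\Big(R_q(X)^{\frac13}\sigma_q(X)^{\frac23}p^{\frac23}+R_q(X)\,p\Big),$$ where $\big(\mathbf{E}[\operatorname{tr}X^{2p}]\big)^{1/(2p)}$ takes values in $[0,\infty]$; the bound is trivial when $R_q(X)=\infty$, and when $R_q(X)<\infty$ both moments are finite. -/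

import Mathlib

open MeasureTheory ProbabilityTheory
open scoped ENNReal NNReal

namespace MomentUniversality

noncomputable section

/-- Complex `d × d` matrices. -/
abbrev Mat (d : ℕ) : Type := Matrix (Fin d) (Fin d) ℂ

/-- The normalized trace `tr M = (1/d) Tr M`. -/
def ntr {d : ℕ} (M : Mat d) : ℂ := M.trace / (d : ℂ)

/-- The spectral norm of a matrix: its operator norm on `ℂ^d` with the Euclidean norm. -/
def specNorm {d : ℕ} (M : Mat d) : ℝ := ‖Matrix.toEuclideanCLM (𝕜 := ℂ) M‖

/-- `|M| ^ s` for a self-adjoint matrix `M`, by functional calculus: the matrix with the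
eigenvectors of `M` and the eigenvalues `|l| ^ s`, where `l` runs over the eigenvalues of `M`.
For positive semidefinite `M` this is `M ^ s`. -/
def absRpow {d : ℕ} (M : Mat d) (s : ℝ) : Mat d := cfc (fun x : ℝ => |x| ^ s) M

section Random

variable {Ω : Type*} [MeasurableSpace Ω] {d n : ℕ}

/-- The (entrywise) expectation of a random matrix. -/
def expect (μ : Measure Ω) (X : Ω → Mat d) : Mat d :=
  Matrix.of fun i j => ∫ ω, X ω i j ∂μ

/-- The entry `Cov(X)_{ij,kl} = E[(X - E X)_{ij} conj((X - E X)_{kl})]` of the `d² × d²`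
covariance matrix of the entries of `X`. -/
def cov (μ : Measure Ω) (X : Ω → Mat d) : Matrix (Fin d × Fin d) (Fin d × Fin d) ℂ :=
  Matrix.of fun a b =>
    ∫ ω, (X ω - expect μ X) a.1 a.2 * star ((X ω - expect μ X) b.1 b.2) ∂μ

/-- The deterministic matrix `E[(X - E X)²]`. -/
def matVar (μ : Measure Ω) (X : Ω → Mat d) : Mat d :=
  expect μ fun ω => (X ω - expect μ X) ^ 2

/-- The random matrix `X = Z₀ + ∑ Z_i`. -/
def model (Z₀ : Mat d) (Z : Fin n → Ω → Mat d) (ω : Ω) : Mat d := Z₀ + ∑ i, Z i ω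

/-- The parameter `σ_q(X)`: it is `(tr E[(X - E X)²]^(q/2))^(1/q)` for `q < ∞`
(the power `q/2` is a power of the deterministic matrix `E[(X - E X)²]`), and
`‖E[(X - E X)²]‖^(1/2)` for `q = ∞`. -/
def sigmaQ (μ : Measure Ω) (X : Ω → Mat d) (q : ℝ≥0∞) : ℝ≥0∞ :=
  if q = ∞ then ENNReal.ofReal (specNorm (matVar μ X)) ^ ((1 : ℝ) / 2)
  else ENNReal.ofReal (ntr (absRpow (matVar μ X) (q.toReal / 2))).re ^ (1 / q.toReal)

/-- The parameter `R_q(X)` of the sum `X = Z₀ + ∑ Z_i`: it is `(∑ E[tr |Z_i|^q])^(1/q)` for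
`q < ∞`, and the essential supremum of `max_i ‖Z_i‖` for `q = ∞`. It may be infinite. -/
def RQ (μ : Measure Ω) (Z : Fin n → Ω → Mat d) (q : ℝ≥0∞) : ℝ≥0∞ :=
  if q = ∞ then essSup (fun ω => ⨆ i, ENNReal.ofReal (specNorm (Z i ω))) μ
  else (∑ i, ∫⁻ ω, ENNReal.ofReal (ntr (absRpow (Z i ω) q.toReal)).re ∂μ) ^ (1 / q.toReal)

/-- `E[tr X^{2p}]^{1/(2p)}` for a self-adjoint random matrix `X`. As `tr X^{2p}` is then a
nonnegative real number, its expectation is well defined in `[0, ∞]`. -/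
def evenMoment (μ : Measure Ω) (X : Ω → Mat d) (p : ℕ) : ℝ≥0∞ :=
  (∫⁻ ω, ENNReal.ofReal (ntr (X ω ^ (2 * p))).re ∂μ) ^ (1 / (2 * (p : ℝ)))

/-- The summands `Z₁, …, Z_n`: independent self-adjoint random matrices with zero mean (and
square-integrable entries, so that `Cov(X)` exists). -/
structure IsSummands (μ : Measure Ω) (Z : Fin n → Ω → Mat d) : Prop where
  isHermitian : ∀ i ω, (Z i ω).IsHermitian
  measurable : ∀ i a b, Measurable fun ω => Z i ω a b
  memLp : ∀ i a b, MemLp (fun ω => Z i ω a b) 2 μ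
  centered : ∀ i, expect μ (Z i) = 0
  indep : iIndepFun (fun i ω (a : Fin d × Fin d) => Z i ω a.1 a.2) μ

/-- `G` is a Gaussian model of `X`: a self-adjoint random matrix whose real and imaginary parts
of entries are jointly Gaussian, with `E[G] = E[X]` and `Cov(G) = Cov(X)`. It may live on another
probability space. -/
structure IsGaussianModel {Ω' : Type*} [MeasurableSpace Ω'] (μ : Measure Ω) (X : Ω → Mat d)
    (ν : Measure Ω') (G : Ω' → Mat d) : Prop where
  isHermitian : ∀ ω, (G ω).IsHermitian
  measurable : ∀ a b, Measurable fun ω => G ω a b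
  gaussian : HasGaussianLaw
    (fun ω => (Sum.elim (fun a => (G ω a.1 a.2).re) (fun a => (G ω a.1 a.2).im) :
      (Fin d × Fin d) ⊕ (Fin d × Fin d) → ℝ)) ν
  mean_eq : expect ν G = expect μ X
  cov_eq : cov ν G = cov μ X

end Random

end

end MomentUniversality

open MomentUniversality

/-! The moments of `X` and `G` are compared along the interpolation
`X(θ) = Z₀ + sin θ ∑ Z_i + cos θ (G - Z₀)` on the product space, which is `G` at `θ = 0` and `X`
at `θ = π / 2`. With `φ(θ) = E Tr X(θ)^{2p}`, the derivative `φ'(θ)` is `2p` times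
`cos θ E Tr (∑ Z_i) X(θ)^{2p-1} - sin θ E Tr (G - Z₀) X(θ)^{2p-1}`.

*Second order.* Gaussian integration by parts (`integral_gaussian_mul_pow`, from the rotation
invariance of the law of two independent copies) and the equality of covariances turn the second
term into `sin θ cos θ ∑_a ∑_i E Tr Z_i' X^a Z_i' X^{2p-2-a}`, where `Z_i'` is a copy of `Z_i` that
is independent of `X = X(θ)` (`IsGaussianModel.integral_mul_interp_pow`). An expansion of the first
term, in which `Z_i` is exchanged with independent copies of itself, gives the same expression up to
words in which three letters are copies of `Z_i`
(`IsExchangeableTriple.abs_integral_sub_le`, `abs_sum_integral_sub_le`).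

*Third order.* Words with three letters `z` and `2p - 3` letters `Y` are controlled by the
extremal words `Y^{2p-2} z²` and `z^{2p}`. For a single letter `Y` this is a chessboard estimate
(`chessboard`, `abs_integral_word_le`): the expected trace of a word satisfies the Cauchy-Schwarz
inequality with respect to reflections. Three different letters `Y_0, Y_1, Y_2` are
made into the single letter `diag(Y_0, Y_1, Y_2)` by means of `3 × 3` block matrices
(`abs_integral_three_word_le`). The word `Y^{2p-2} z²` with dependent `Y` and `z` is in turn bounded
by the same word for independent copies, since the difference consists of words with three letters
`z` (`IsExchangeableTriple.integral_dependent_le`). For independent copies, and summed over `i`, it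
becomes `E Tr X^{2p-2} V` with the matrix `V = E[(X - E X)²]`, and Young's inequality for traces
(`reTr_pow_mul_le`) applies.

*Conclusion.* Let `r` be slightly larger than `R_q`, let `s²` be of the order `σ_q² + r²`, and let
`N^{2p} = φ / d + (16 p r)^{2p}`. The two steps give `|φ'| ≤ C p³ d s² r N^{2p-3}`, that is,
`|(N³)'| ≤ C p² s² r`. Hence `N` varies by at most a multiple of `(p² s² r)^{1/3}`, while it differs
from `(φ / d)^{1/(2p)}` by at most `16 p r` (`abs_moment_sub_le`). -/

namespace MomentUniversality

/-! ### The chessboard estimate for cyclic words -/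

/-- A set of words that is closed under rotation and under reflecting the first half of a word
of length `2p`, provided both halves contain a letter `some z`, contains one of the two
extremal words `Y^{2p-2} z z` and `z^{2p}` as soon as it contains a word with two letters
`some z`. The letter `none` plays the role of `Y`. The word is written as `u z^l`, and the
induction is on the length `k = 2p - l` of `u`: reflections lengthen the final run of letters `z`,
until one of the extremal words appears. -/
lemma exists_extremal_word_aux {α : Type*} {p : ℕ} (hp : 2 ≤ p) (S : Set (List (Option α)))
    (hrot : ∀ A B, A ++ B ∈ S → B ++ A ∈ S)
    (hrefl : ∀ A B : List (Option α), A.length = p → B.length = p → (∃ a, some a ∈ A) →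
      (∃ b, some b ∈ B) → A ++ B ∈ S → A ++ A.reverse ∈ S) :
    ∀ k l : ℕ, l + k = 2 * p → ∀ (u : List (Option α)) (z : α), 1 ≤ l →
      (u ++ List.replicate l (some z)).length = 2 * p →
      (2 ≤ l ∨ ∃ a, some a ∈ u) → u ++ List.replicate l (some z) ∈ S →
      ∃ z, List.replicate (2 * p - 2) none ++ [some z, some z] ∈ S ∨
        List.replicate (2 * p) (some z) ∈ S := by
  -- a word whose first half is `Y^{p-1} z` and whose second half contains a `Z` suffices
  have key : ∀ (z : α) (B : List (Option α)), B.length = p → (∃ b, some b ∈ B) →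
      (List.replicate (p - 1) none ++ [some z]) ++ B ∈ S →
      List.replicate (2 * p - 2) none ++ [some z, some z] ∈ S := by
    intro z B hB hb hmem
    have h := hrefl _ B (by simp; omega) hB ⟨z, by simp⟩ hb hmem
    have h2 : (List.replicate (p - 1) none ++ [some z, some z]) ++
        List.replicate (p - 1) (none : Option α) ∈ S := by
      simpa using h
    have h3 := hrot _ _ h2
    rw [← List.append_assoc, List.replicate_append_replicate] at h3
    convert h3 using 4
    omega
  intro k
  induction k using Nat.strong_induction_on with
  | _ k ih =>
  intro l hl u z h1 hlen hZ hmem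
  have hu : u.length = k := by simp at hlen; omega
  by_cases hlp : l < p
  · -- the last `p` letters are `v ++ z^l`
    set A := u.take p with hA
    set v := u.drop p with hv
    have huv : u = A ++ v := (List.take_append_drop p u).symm
    have hAl : A.length = p := by simp [hA]; omega
    have hvl : v.length = p - l := by simp [hv]; omega
    have hB : (v ++ List.replicate l (some z)).length = p := by simp; omega
    rw [huv, List.append_assoc] at hmem
    by_cases hAZ : ∃ a, some a ∈ A
    · have h := hrefl (v ++ List.replicate l (some z)).reverse.reverse A (by simpa using hB) hAl
        ⟨z, by simp; omega⟩ hAZ (by simpa using hrot _ _ hmem)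
      have h2 : v ++ (List.replicate (2 * l) (some z) ++ v.reverse) ∈ S := by
        rw [two_mul, ← List.replicate_append_replicate]
        simpa [-List.replicate_append_replicate] using h
      have h3 := hrot _ _ ((List.append_assoc _ _ _).symm ▸ h2)
      rw [← List.append_assoc] at h3
      exact ih (k - l) (by omega) (2 * l) (by omega) (v.reverse ++ v) z (by omega)
        (by simp; omega) (Or.inl (by omega))
        (by
          have h4 := hrot _ _ h2
          simpa using hrot (List.replicate (2 * l) (some z)) (v.reverse ++ v) (by simpa using h4))
    · have hAr : A = List.replicate p none := by
        rw [List.eq_replicate_iff]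
        refine ⟨hAl, fun b hb => ?_⟩
        cases b with
        | none => rfl
        | some a => exact absurd ⟨a, hb⟩ hAZ
      -- the second half contains two letters `Z`; split it at the first one
      have hsplit : ∃ (j : ℕ) (z' : α) (B' : List (Option α)),
          v ++ List.replicate l (some z) = List.replicate j none ++ some z' :: B' ∧
          ∃ b, some b ∈ B' := by
        have gen : ∀ (w : List (Option α)), (2 ≤ l ∨ ∃ a, some a ∈ w) →
            ∃ (j : ℕ) (z' : α) (B' : List (Option α)),
            w ++ List.replicate l (some z) = List.replicate j none ++ some z' :: B' ∧
            ∃ b, some b ∈ B' := by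
          intro w
          induction w with
          | nil =>
            intro hw
            have hl2 : 2 ≤ l := by simpa using hw
            refine ⟨0, z, List.replicate (l - 1) (some z), ?_, z, by simp; omega⟩
            obtain ⟨l', rfl⟩ : ∃ l', l = l' + 1 := ⟨l - 1, by omega⟩
            simp [List.replicate_succ]
          | cons b w ihw =>
            intro hw
            cases b with
            | none =>
              obtain ⟨j, z', B', h, hb⟩ := ihw (by simpa using hw)
              exact ⟨j + 1, z', B', by simp [List.replicate_succ, h], hb⟩
            | some a =>
              exact ⟨0, a, w ++ List.replicate l (some z), by simp, z, by simp; omega⟩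
        refine gen v (hZ.imp_right ?_)
        rintro ⟨a, ha⟩
        rw [huv, List.mem_append] at ha
        exact ⟨a, ha.resolve_left fun h => hAZ ⟨a, h⟩⟩
      obtain ⟨j, z', B', hw, hb⟩ := hsplit
      have hBl : j + (B'.length + 1) = p := by rw [hw] at hB; simpa using hB
      rw [hw, hAr] at hmem
      have hB'l : 1 ≤ B'.length := by
        obtain ⟨b, hb⟩ := hb
        exact List.length_pos_of_mem hb
      have e1 : List.replicate p (none : Option α) =
          List.replicate (j + 1) none ++ List.replicate (p - 1 - j) none := by
        rw [List.replicate_append_replicate]; congr 1; omega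
      rw [e1, List.append_assoc] at hmem
      have h2 := hrot _ _ hmem
      refine ⟨z', Or.inl (key z' (B' ++ List.replicate (j + 1) none) (by simp; omega) ?_ ?_)⟩
      · obtain ⟨b, hb⟩ := hb
        exact ⟨b, by simp [hb]⟩
      · have e2 : List.replicate (p - 1) (none : Option α) =
          List.replicate (p - 1 - j) none ++ List.replicate j none := by
          rw [List.replicate_append_replicate]; congr 1; omega
        rw [e2]
        simpa [-List.replicate_append_replicate] using h2
  · -- the last `p` letters are `z^p`
    push Not at hlp
    have e1 : List.replicate l (some z) =
        List.replicate (l - p) (some z) ++ List.replicate p (some z) := by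
      rw [List.replicate_append_replicate]; congr 1; omega
    by_cases hAZ : ∃ a, some a ∈ u ++ List.replicate (l - p) (some z)
    · rw [e1, ← List.append_assoc] at hmem
      have h := hrefl _ _ (by simp) (by simp; omega) ⟨z, by simp; omega⟩ hAZ (hrot _ _ hmem)
      refine ⟨z, Or.inr ?_⟩
      rw [two_mul, ← List.replicate_append_replicate]
      simpa using h
    · have hlp' : l = p := by
        by_contra hne
        exact hAZ ⟨z, by simp; omega⟩
      subst hlp'
      have hAr : u = List.replicate l none := by
        rw [List.eq_replicate_iff]
        refine ⟨by omega, fun b hb => ?_⟩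
        cases b with
        | none => rfl
        | some a => exact absurd ⟨a, by simp [hb]⟩ hAZ
      rw [hAr] at hmem
      have e2 : List.replicate l (none : Option α) = [none] ++ List.replicate (l - 1) none := by
        rw [← List.replicate_one, List.replicate_append_replicate]; congr 1; omega
      have e3 : List.replicate l (some z) = [some z] ++ List.replicate (l - 1) (some z) := by
        rw [← List.replicate_one, List.replicate_append_replicate]; congr 1; omega
      rw [e2, e3, List.append_assoc] at hmem
      have h2 := hrot _ _ hmem
      exact ⟨z, Or.inl (key z (List.replicate (l - 1) (some z) ++ [none]) (by simp; omega)
        ⟨z, by simp; omega⟩ (by simpa using h2))⟩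

/-- The number of letters `some z` of a word. -/
def zCount {α : Type*} (w : List (Option α)) : ℕ := w.countP Option.isSome

lemma zCount_append {α : Type*} (v w : List (Option α)) :
    zCount (v ++ w) = zCount v + zCount w := List.countP_append

lemma zCount_pos {α : Type*} {w : List (Option α)} : 0 < zCount w ↔ ∃ a, some a ∈ w := by
  rw [zCount, List.countP_pos_iff]
  constructor
  · rintro ⟨b, hb, h⟩
    obtain ⟨a, rfl⟩ := Option.isSome_iff_exists.mp h
    exact ⟨a, hb⟩
  · rintro ⟨a, ha⟩
    exact ⟨_, ha, rfl⟩

/-- Chessboard estimate: if a real function of cyclic words satisfies the Cauchy-Schwarz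
inequality with respect to reflections of half-words, then on the words of length `2p` with at
least two letters `some z` it is bounded by its values at `Y^{2p-2} z z` and at `z^{2p}`. -/
lemma chessboard {α : Type*} [Finite α] {p : ℕ} (hp : 2 ≤ p) (F : List (Option α) → ℝ) {B : ℝ}
    (hB : 0 ≤ B)
    (hrot : ∀ A B, (A ++ B).length = 2 * p → F (A ++ B) = F (B ++ A))
    (hcs : ∀ A B : List (Option α), A.length = p → B.length = p →
      F (A ++ B) ^ 2 ≤ F (A ++ A.reverse) * F (B.reverse ++ B))
    (h2 : ∀ z, |F (List.replicate (2 * p - 2) none ++ [some z, some z])| ≤ B)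
    (h2p : ∀ z, |F (List.replicate (2 * p) (some z))| ≤ B)
    (w : List (Option α)) (hw : w.length = 2 * p) (hwz : 2 ≤ zCount w) : |F w| ≤ B := by
  set W : Set (List (Option α)) := {w | w.length = 2 * p ∧ 2 ≤ zCount w} with hWdef
  have hfin : W.Finite := by
    refine (List.finite_length_eq (Option α) (2 * p)).subset ?_
    rintro w ⟨h, -⟩
    exact h
  obtain ⟨m, hm, hmax⟩ := hfin.exists_maximalFor (fun w => |F w|) W ⟨w, hw, hwz⟩
  have hmax' : ∀ v ∈ W, |F v| ≤ |F m| := fun v hv => by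
    rcases le_total |F v| |F m| with h | h
    · exact h
    · exact hmax hv h
  refine (hmax' w ⟨hw, hwz⟩).trans ?_
  by_contra hlt
  push Not at hlt
  have hQ : 0 < |F m| := hB.trans_lt hlt
  set S : Set (List (Option α)) := {w | w ∈ W ∧ |F w| = |F m|} with hS
  have hSrot : ∀ A B, A ++ B ∈ S → B ++ A ∈ S := by
    rintro A B ⟨⟨hl, hz⟩, hF⟩
    refine ⟨⟨by simp at hl ⊢; omega, by rw [zCount_append] at hz ⊢; omega⟩, ?_⟩
    rw [← hrot A B hl, hF]
  have hSrefl : ∀ A B : List (Option α), A.length = p → B.length = p → (∃ a, some a ∈ A) →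
      (∃ b, some b ∈ B) → A ++ B ∈ S → A ++ A.reverse ∈ S := by
    rintro A B hA hB hAz hBz ⟨-, hF⟩
    rw [← zCount_pos] at hAz hBz
    have hr : ∀ v : List (Option α), zCount v.reverse = zCount v := fun v => by simp [zCount]
    have hAA : A ++ A.reverse ∈ W :=
      ⟨by simp; omega, by rw [zCount_append, hr]; omega⟩
    have hBB : B.reverse ++ B ∈ W :=
      ⟨by simp; omega, by rw [zCount_append, hr]; omega⟩
    refine ⟨hAA, le_antisymm (hmax' _ hAA) ?_⟩
    have h1 := hcs A B hA hB
    have h3 := hmax' _ hBB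
    have h4 : F (A ++ A.reverse) * F (B.reverse ++ B) ≤ |F (A ++ A.reverse)| * |F m| := by
      refine (le_abs_self _).trans ?_
      rw [abs_mul]
      exact mul_le_mul_of_nonneg_left h3 (abs_nonneg _)
    rw [← sq_abs, hF, sq] at h1
    exact le_of_mul_le_mul_right (h1.trans h4) hQ
  obtain ⟨z, hz⟩ := zCount_pos.mp (lt_of_lt_of_le two_pos hm.2)
  obtain ⟨s, t, hst⟩ := List.append_of_mem hz
  have hmS : m ∈ S := ⟨hm, rfl⟩
  have hm' : (t ++ s) ++ List.replicate 1 (some z) ∈ S := by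
    have : (s ++ [some z]) ++ t ∈ S := by simpa [← hst] using hmS
    simpa using hSrot _ _ this
  have hcount : ∃ a, some a ∈ t ++ s := by
    rw [← zCount_pos]
    have := hm'.1.2
    rw [zCount_append] at this
    have h1 : zCount (List.replicate 1 (some z)) = 1 := by simp [zCount]
    omega
  obtain ⟨z', h | h⟩ := exists_extremal_word_aux hp S hSrot hSrefl (2 * p - 1) 1 (by omega)
    (t ++ s) z le_rfl hm'.1.1 (Or.inr hcount) hm'
  · exact (h.2.symm.trans_le (h2 z')).not_gt hlt
  · exact (h.2.symm.trans_le (h2p z')).not_gt hlt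

open scoped Matrix.Norms.Frobenius

set_option linter.unusedSectionVars false

/-! ### Random matrices dominated by a scalar random variable -/

section Dominated

variable {Ω : Type*} [MeasurableSpace Ω] {ι : Type*} [Fintype ι] [DecidableEq ι]

/-- The real part of the (unnormalized) trace. -/
noncomputable def reTr (M : Matrix ι ι ℂ) : ℝ := M.trace.re

lemma norm_entry_le_norm (M : Matrix ι ι ℂ) (i j : ι) : ‖M i j‖ ≤ ‖M‖ := by
  rw [Matrix.frobenius_norm_def, ← Real.sqrt_eq_rpow]
  refine Real.le_sqrt_of_sq_le ?_
  have h : ‖M i j‖ ^ 2 ≤ ∑ j, ‖M i j‖ ^ 2 :=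
    Finset.single_le_sum (f := fun j => ‖M i j‖ ^ 2) (fun _ _ => by positivity)
      (Finset.mem_univ j)
  have h2 : ∑ j, ‖M i j‖ ^ 2 ≤ ∑ i, ∑ j, ‖M i j‖ ^ 2 :=
    Finset.single_le_sum (f := fun i => ∑ j, ‖M i j‖ ^ 2) (fun _ _ => by positivity)
      (Finset.mem_univ i)
  simpa using h.trans h2

lemma norm_le_sum_norm_entry (M : Matrix ι ι ℂ) : ‖M‖ ≤ ∑ i, ∑ j, ‖M i j‖ := by
  rw [Matrix.frobenius_norm_def, ← Real.sqrt_eq_rpow]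
  refine Real.sqrt_le_iff.mpr ⟨by positivity, ?_⟩
  have h1 : ∀ i, ∑ j, ‖M i j‖ ^ 2 ≤ (∑ j, ‖M i j‖) ^ 2 := fun i =>
    Finset.sum_sq_le_sq_sum_of_nonneg fun _ _ => norm_nonneg _
  have h2 : ∑ i, (∑ j, ‖M i j‖) ^ 2 ≤ (∑ i, ∑ j, ‖M i j‖) ^ 2 :=
    Finset.sum_sq_le_sq_sum_of_nonneg fun _ _ => Finset.sum_nonneg fun _ _ => norm_nonneg _
  simpa using (Finset.sum_le_sum fun i _ => h1 i).trans h2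

lemma abs_reTr_le (M : Matrix ι ι ℂ) : |reTr M| ≤ Fintype.card ι * ‖M‖ := by
  calc |reTr M| ≤ ‖M.trace‖ := Complex.abs_re_le_norm _
    _ ≤ ∑ i, ‖M i i‖ := norm_sum_le _ _
    _ ≤ ∑ _i : ι, ‖M‖ := Finset.sum_le_sum fun i _ => norm_entry_le_norm M i i
    _ = _ := by simp

lemma reTr_add (A B : Matrix ι ι ℂ) : reTr (A + B) = reTr A + reTr B := by simp [reTr]

lemma reTr_sub (A B : Matrix ι ι ℂ) : reTr (A - B) = reTr A - reTr B := by simp [reTr]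

lemma reTr_smul (c : ℝ) (A : Matrix ι ι ℂ) : reTr (c • A) = c * reTr A := by simp [reTr]

lemma reTr_sum {κ : Type*} (s : Finset κ) (A : κ → Matrix ι ι ℂ) :
    reTr (∑ k ∈ s, A k) = ∑ k ∈ s, reTr (A k) := by simp [reTr, Matrix.trace_sum]

lemma reTr_mul_comm (A B : Matrix ι ι ℂ) : reTr (A * B) = reTr (B * A) := by
  rw [reTr, Matrix.trace_mul_comm, reTr]

lemma reTr_conjTranspose (A : Matrix ι ι ℂ) : reTr A.conjTranspose = reTr A := by
  simp [reTr, Matrix.trace_conjTranspose]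

lemma reTr_mul_conjTranspose_self_nonneg (A : Matrix ι ι ℂ) :
    0 ≤ reTr (A * A.conjTranspose) := by
  rw [reTr, Matrix.trace, Complex.re_sum]
  refine Finset.sum_nonneg fun i _ => ?_
  rw [Matrix.diag_apply, Matrix.mul_apply, Complex.re_sum]
  refine Finset.sum_nonneg fun j _ => ?_
  rw [Matrix.conjTranspose_apply, Complex.star_def, Complex.mul_conj]
  exact_mod_cast Complex.normSq_nonneg _

lemma measurable_reTr_of_entries {f : Ω → Matrix ι ι ℂ} (hf : ∀ i j, Measurable fun x => f x i j) :
    Measurable fun x => reTr (f x) := by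
  simp only [reTr, Matrix.trace, Complex.re_sum, Matrix.diag_apply]
  exact Finset.measurable_fun_sum _ fun i _ => Complex.measurable_re.comp (hf i i)

lemma measurable_mul_entries {f f' : Ω → Matrix ι ι ℂ} (hf : ∀ i j, Measurable fun x => f x i j)
    (hf' : ∀ i j, Measurable fun x => f' x i j) (i j : ι) :
    Measurable fun x => (f x * f' x) i j := by
  simp only [Matrix.mul_apply]
  exact Finset.measurable_fun_sum _ fun a _ => (hf i a).mul (hf' a j)

lemma measurable_pow_entries {f : Ω → Matrix ι ι ℂ} (hf : ∀ i j, Measurable fun x => f x i j)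
    (m : ℕ) (i j : ι) : Measurable fun x => (f x ^ m) i j := by
  induction m generalizing i j with
  | zero => simp
  | succ m ih =>
    simp only [pow_succ]
    exact measurable_mul_entries ih hf i j

/-- A random matrix with measurable entries whose norm is at most a constant multiple
of `g ^ k`. Products add up the exponents `k`, so that the expected trace of a word exists
as soon as a sufficiently high power of `g` is integrable. -/
def IsDom (g : Ω → ℝ) (k : ℕ) (f : Ω → Matrix ι ι ℂ) : Prop :=
  (∀ i j, Measurable fun x => f x i j) ∧ ∃ C, 0 ≤ C ∧ ∀ x, ‖f x‖ ≤ C * g x ^ k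

variable {g : Ω → ℝ} {k l K : ℕ} {f f' : Ω → Matrix ι ι ℂ}

namespace IsDom

lemma congr (hf : IsDom g k f) (h : ∀ x, f x = f' x) : IsDom g k f' := by
  rwa [← show f = f' from funext h]

lemma mono (hg : ∀ x, 1 ≤ g x) (hf : IsDom g k f) (h : k ≤ l) : IsDom g l f := by
  obtain ⟨hm, C, hC, hb⟩ := hf
  refine ⟨hm, C, hC, fun x => (hb x).trans ?_⟩
  gcongr
  exact hg x

lemma mul (hf : IsDom g k f) (hf' : IsDom g l f') :
    IsDom g (k + l) (fun x => f x * f' x) := by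
  obtain ⟨hm, C, hC, hb⟩ := hf
  obtain ⟨hm', C', hC', hb'⟩ := hf'
  refine ⟨measurable_mul_entries hm hm', C * C', by positivity, fun x => ?_⟩
  calc ‖f x * f' x‖ ≤ ‖f x‖ * ‖f' x‖ := Matrix.frobenius_norm_mul _ _
    _ ≤ (C * g x ^ k) * (C' * g x ^ l) :=
      mul_le_mul (hb x) (hb' x) (norm_nonneg _) ((norm_nonneg _).trans (hb x))
    _ = _ := by ring

lemma add (hf : IsDom g k f) (hf' : IsDom g k f') : IsDom g k (fun x => f x + f' x) := by
  obtain ⟨hm, C, hC, hb⟩ := hf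
  obtain ⟨hm', C', hC', hb'⟩ := hf'
  refine ⟨fun i j => (hm i j).add (hm' i j), C + C', by positivity, fun x => ?_⟩
  calc ‖f x + f' x‖ ≤ ‖f x‖ + ‖f' x‖ := norm_add_le _ _
    _ ≤ _ := by linarith [hb x, hb' x]

lemma const_smul (hf : IsDom g k f) (c : ℝ) : IsDom g k (fun x => c • f x) := by
  obtain ⟨hm, C, hC, hb⟩ := hf
  refine ⟨fun i j => (hm i j).const_smul c, |c| * C, by positivity, fun x => ?_⟩
  rw [norm_smul, Real.norm_eq_abs, mul_assoc]
  exact mul_le_mul_of_nonneg_left (hb x) (abs_nonneg c)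

lemma sub (hf : IsDom g k f) (hf' : IsDom g k f') : IsDom g k (fun x => f x - f' x) :=
  (hf.add (hf'.const_smul (-1))).congr fun x => by simp [sub_eq_add_neg]

lemma const (hg : ∀ x, 1 ≤ g x) (A : Matrix ι ι ℂ) : IsDom g k (fun _ => A) :=
  ⟨fun _ _ => measurable_const, ‖A‖, norm_nonneg _, fun x =>
    le_mul_of_one_le_right (norm_nonneg _) (one_le_pow₀ (hg x))⟩

lemma sum (hg : ∀ x, 1 ≤ g x) {α : Type*} (s : Finset α) {F : α → Ω → Matrix ι ι ℂ}
    (h : ∀ a ∈ s, IsDom g k (F a)) : IsDom g k (fun x => ∑ a ∈ s, F a x) := by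
  classical
  induction s using Finset.induction_on with
  | empty => simpa using const hg 0
  | insert a s ha ih =>
    simp only [Finset.sum_insert ha]
    exact (h a (Finset.mem_insert_self _ _)).add
      (ih fun b hb => h b (Finset.mem_insert_of_mem hb))

lemma pow (hg : ∀ x, 1 ≤ g x) (hf : IsDom g 1 f) (m : ℕ) : IsDom g m (fun x => f x ^ m) := by
  induction m with
  | zero => simpa using const hg 1
  | succ m ih => simpa only [pow_succ] using ih.mul hf

lemma list_prod (hg : ∀ x, 1 ≤ g x) {α : Type*} {L : α → Ω → Matrix ι ι ℂ}
    (hL : ∀ a, IsDom g 1 (L a)) (w : List α) :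
    IsDom g w.length (fun x => (w.map fun a => L a x).prod) := by
  induction w with
  | nil => simpa using const hg 1
  | cons a w ih =>
    have := (hL a).mul ih
    simpa [add_comm] using this

lemma conjTranspose (hf : IsDom g k f) : IsDom g k (fun x => (f x).conjTranspose) := by
  obtain ⟨hm, C, hC, hb⟩ := hf
  refine ⟨fun i j => ?_, C, hC, fun x => ?_⟩
  · simp only [Matrix.conjTranspose_apply]
    exact Complex.continuous_conj.measurable.comp (hm j i)
  · rw [Matrix.frobenius_norm_conjTranspose]
    exact hb x

lemma measurable_reTr (hf : IsDom g k f) : Measurable fun x => reTr (f x) := by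
  simp only [reTr, Matrix.trace, Complex.re_sum, Matrix.diag_apply]
  exact Finset.measurable_fun_sum _ fun i _ => Complex.measurable_re.comp (hf.1 i i)

lemma integrable {μ : Measure Ω} (hg : ∀ x, 1 ≤ g x) (hK : Integrable (fun x => g x ^ K) μ)
    (hf : IsDom g k f) (hk : k ≤ K) : Integrable (fun x => reTr (f x)) μ := by
  obtain ⟨hm, C, hC, hb⟩ := hf.mono hg hk
  refine (hK.const_mul (Fintype.card ι * C)).mono' hf.measurable_reTr.aestronglyMeasurable
    (Filter.Eventually.of_forall fun x => ?_)
  rw [Real.norm_eq_abs]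
  refine (abs_reTr_le _).trans ?_
  rw [mul_assoc]
  exact mul_le_mul_of_nonneg_left (hb x) (by positivity)

end IsDom

/-- The Cauchy-Schwarz inequality for the expected trace. -/
lemma integral_reTr_mul_sq_le {μ : Measure Ω} (hg : ∀ x, 1 ≤ g x)
    (hK : Integrable (fun x => g x ^ K) μ) (hf : IsDom g k f) (hf' : IsDom g k f')
    (hk : k + k ≤ K) :
    (∫ x, reTr (f x * (f' x).conjTranspose) ∂μ) ^ 2 ≤
      (∫ x, reTr (f x * (f x).conjTranspose) ∂μ) *
        ∫ x, reTr (f' x * (f' x).conjTranspose) ∂μ := by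
  have i1 := (hf.mul hf.conjTranspose).integrable hg hK hk
  have i2 := (hf.mul hf'.conjTranspose).integrable hg hK hk
  have i3 := (hf'.mul hf'.conjTranspose).integrable hg hK hk
  have key : ∀ t : ℝ, 0 ≤ (∫ x, reTr (f' x * (f' x).conjTranspose) ∂μ) * (t * t) +
      (-2 * ∫ x, reTr (f x * (f' x).conjTranspose) ∂μ) * t +
      ∫ x, reTr (f x * (f x).conjTranspose) ∂μ := by
    intro t
    have h0 : 0 ≤ ∫ x, reTr ((f x - t • f' x) * (f x - t • f' x).conjTranspose) ∂μ :=
      integral_nonneg fun x => reTr_mul_conjTranspose_self_nonneg _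
    have h1 : ∀ x, reTr ((f x - t • f' x) * (f x - t • f' x).conjTranspose) =
        reTr (f x * (f x).conjTranspose) - 2 * t * reTr (f x * (f' x).conjTranspose) +
        t * t * reTr (f' x * (f' x).conjTranspose) := by
      intro x
      have e : reTr (f' x * (f x).conjTranspose) = reTr (f x * (f' x).conjTranspose) := by
        rw [← reTr_conjTranspose]; simp [Matrix.conjTranspose_mul]
      have e2 : (f x - t • f' x) * (f x - t • f' x).conjTranspose =
          f x * (f x).conjTranspose - t • (f x * (f' x).conjTranspose) -
          t • (f' x * (f x).conjTranspose) + (t * t) • (f' x * (f' x).conjTranspose) := by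
        rw [Matrix.conjTranspose_sub, Matrix.conjTranspose_smul, star_trivial]
        simp only [sub_mul, mul_sub, smul_mul_assoc, mul_smul_comm, smul_sub, smul_smul]
        abel
      rw [e2, reTr_add, reTr_sub, reTr_sub, reTr_smul, reTr_smul, reTr_smul, e]
      ring
    simp only [h1] at h0
    have i4 : Integrable (fun x => reTr (f x * (f x).conjTranspose) -
        2 * t * reTr (f x * (f' x).conjTranspose)) μ := i1.sub (i2.const_mul _)
    rw [integral_add i4 (i3.const_mul _), integral_sub i1 (i2.const_mul _),
      integral_const_mul, integral_const_mul] at h0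
    linarith
  have hd := discrim_le_zero key
  rw [discrim] at hd
  nlinarith

/-- Chessboard estimate for words in random Hermitian matrices: a word of length `2p` in `Y` and
the letters `z`, with at least two letters `z`, is bounded by the words `Y^{2p-2} z z`
and `z^{2p}`. -/
lemma abs_integral_word_le {μ : Measure Ω} {p : ℕ} (hp : 2 ≤ p) (hg : ∀ x, 1 ≤ g x)
    (hK : Integrable (fun x => g x ^ (2 * p)) μ) {α : Type*} [Finite α]
    {L : Option α → Ω → Matrix ι ι ℂ} (hL : ∀ a, IsDom g 1 (L a))
    (hH : ∀ a x, (L a x).IsHermitian) {B : ℝ} (hB : 0 ≤ B)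
    (h2 : ∀ z, ∫ x, reTr (L none x ^ (2 * p - 2) * L (some z) x ^ 2) ∂μ ≤ B)
    (h2p : ∀ z, ∫ x, reTr (L (some z) x ^ (2 * p)) ∂μ ≤ B)
    (w : List (Option α)) (hw : w.length = 2 * p) (hwz : 2 ≤ zCount w) :
    |∫ x, reTr (w.map fun a => L a x).prod ∂μ| ≤ B := by
  have hrev : ∀ (w : List (Option α)) x,
      (w.reverse.map fun a => L a x).prod = (w.map fun a => L a x).prod.conjTranspose := by
    intro w x
    rw [Matrix.conjTranspose_list_prod, List.map_map, List.map_reverse]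
    congr 2
    refine List.map_congr_left fun a _ => (hH a x).symm
  have hself : ∀ w : List (Option α), 0 ≤ ∫ x, reTr ((w ++ w.reverse).map fun a => L a x).prod ∂μ :=
    fun w => integral_nonneg fun x => by
      rw [List.map_append, List.prod_append, hrev]
      exact reTr_mul_conjTranspose_self_nonneg _
  refine chessboard hp (fun w => ∫ x, reTr (w.map fun a => L a x).prod ∂μ) hB ?_ ?_ ?_ ?_ w hw hwz
  · intro A B _
    simp only [List.map_append, List.prod_append]
    simp_rw [reTr_mul_comm (List.map _ A).prod]
  · intro A B hA hB
    have h := integral_reTr_mul_sq_le (k := p) hg hK (hA ▸ IsDom.list_prod hg hL A)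
      (f' := fun x => (B.reverse.map fun a => L a x).prod)
      (by rw [← hB, ← List.length_reverse]; exact IsDom.list_prod hg hL B.reverse) (by omega)
    simp only [List.map_append, List.prod_append]
    simpa only [hrev, Matrix.conjTranspose_conjTranspose] using h
  · intro z
    have e : ∀ x, reTr ((List.replicate (2 * p - 2) none ++ [some z, some z]).map
        fun a => L a x).prod = reTr (L none x ^ (2 * p - 2) * L (some z) x ^ 2) := by
      intro x
      simp [sq]
    have e2 : ∀ x, reTr (L none x ^ (2 * p - 2) * L (some z) x ^ 2) =
        reTr (((List.replicate (p - 1) none ++ [some z]) ++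
          (List.replicate (p - 1) none ++ [some z]).reverse).map fun a => L a x).prod := by
      intro x
      simp only [List.map_append, List.prod_append, List.reverse_append,
        List.map_replicate, List.prod_replicate, List.reverse_replicate, List.map_cons,
        List.map_nil, List.prod_cons, List.prod_nil, List.reverse_cons, List.reverse_nil, mul_one,
        List.nil_append]
      have e3 : 2 * p - 2 = (p - 1) + (p - 1) := by omega
      rw [e3, pow_add, sq, mul_assoc, reTr_mul_comm]
      congr 1
      simp only [mul_assoc]
    simp only [e]
    rw [abs_of_nonneg]
    · exact h2 z
    · simp only [e2]
      exact hself _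
  · intro z
    have e : List.replicate (2 * p) (some z) =
        List.replicate p (some z) ++ (List.replicate p (some z)).reverse := by
      rw [List.reverse_replicate, List.replicate_append_replicate, two_mul]
    rw [abs_of_nonneg (by simp only [e]; exact hself _)]
    simpa using h2p z

end Dominated

/-! ### Words with three letters of different kinds -/

section ThreeWords

variable {R : Type*} [Ring R]

/-- The symmetric `3 × 3` block matrix with the block `D` at the positions `(i, j)`
and `(j, i)`. -/
def symBlock (i j : Fin 3) (D : R) : Matrix (Fin 3) (Fin 3) R :=
  Matrix.single i j D + Matrix.single j i D

lemma symBlock_sq {i j : Fin 3} (hij : i ≠ j) (D : R) :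
    symBlock i j D ^ 2 = Matrix.diagonal fun l => if l = i ∨ l = j then D ^ 2 else 0 := by
  rw [symBlock, sq, mul_add, add_mul, add_mul, Matrix.single_mul_single_of_ne _ _ _ _ hij.symm,
    Matrix.single_mul_single_of_ne _ _ _ _ hij, Matrix.single_mul_single_same,
    Matrix.single_mul_single_same, zero_add, add_zero]
  ext a b
  fin_cases i <;> fin_cases j <;> first | exact absurd rfl hij | skip
  all_goals fin_cases a <;> fin_cases b <;> simp [Matrix.single, sq]

lemma symBlock_pow_two_mul {i j : Fin 3} (hij : i ≠ j) (D : R) {p : ℕ} (hp : p ≠ 0) :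
    symBlock i j D ^ (2 * p) =
      Matrix.diagonal fun l => if l = i ∨ l = j then D ^ (2 * p) else 0 := by
  rw [pow_mul, symBlock_sq hij, Matrix.diagonal_pow]
  congr 1
  funext l
  simp only [Pi.pow_apply]
  split_ifs
  · rw [pow_mul]
  · exact zero_pow hp

lemma trace_symBlock_word (D Y Y' Y'' : Fin 3 → R) :
    (symBlock 2 0 (D 0) * Matrix.diagonal Y * symBlock 0 1 (D 1) * Matrix.diagonal Y' *
      symBlock 1 2 (D 2) * Matrix.diagonal Y'').trace =
    D 0 * Y 0 * D 1 * Y' 1 * D 2 * Y'' 2 := by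
  simp [Matrix.trace, Fin.sum_univ_three, Matrix.mul_apply, symBlock, Matrix.single,
    Matrix.diagonal_apply]

variable {ι : Type*} [Fintype ι] [DecidableEq ι]

/-- A `3 × 3` matrix of matrices, as one matrix. -/
def flatten (M : Matrix (Fin 3) (Fin 3) (Matrix ι ι ℂ)) : Matrix (Fin 3 × ι) (Fin 3 × ι) ℂ :=
  Matrix.compRingEquiv (Fin 3) ι ℂ M

lemma flatten_mul (M N : Matrix (Fin 3) (Fin 3) (Matrix ι ι ℂ)) :
    flatten (M * N) = flatten M * flatten N := map_mul _ _ _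

lemma flatten_pow (M : Matrix (Fin 3) (Fin 3) (Matrix ι ι ℂ)) (k : ℕ) :
    flatten (M ^ k) = flatten M ^ k := map_pow _ _ _

lemma flatten_apply (M : Matrix (Fin 3) (Fin 3) (Matrix ι ι ℂ)) (a b : Fin 3 × ι) :
    flatten M a b = M a.1 b.1 a.2 b.2 := rfl

lemma reTr_flatten (M : Matrix (Fin 3) (Fin 3) (Matrix ι ι ℂ)) :
    reTr (flatten M) = reTr M.trace := by
  simp only [reTr, Matrix.trace, Matrix.diag_apply, flatten_apply, Fintype.sum_prod_type,
    Matrix.sum_apply]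
  rw [Finset.sum_comm]

lemma isHermitian_flatten {M : Matrix (Fin 3) (Fin 3) (Matrix ι ι ℂ)}
    (h : ∀ i j, (M i j).conjTranspose = M j i) : (flatten M).IsHermitian := by
  ext a b
  rw [Matrix.conjTranspose_apply, flatten_apply, flatten_apply, ← h b.1 a.1,
    Matrix.conjTranspose_apply]

lemma IsDom.flatten {Ω : Type*} [MeasurableSpace Ω] {g : Ω → ℝ} {k : ℕ}
    {M : Ω → Matrix (Fin 3) (Fin 3) (Matrix ι ι ℂ)} (h : ∀ i j, IsDom g k fun x => M x i j) :
    IsDom g k fun x => flatten (M x) := by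
  choose C hC hb using fun i j => (h i j).2
  refine ⟨fun a b => (h a.1 b.1).1 a.2 b.2, ∑ a : Fin 3 × ι, ∑ b : Fin 3 × ι, C a.1 b.1,
    Finset.sum_nonneg fun a _ => Finset.sum_nonneg fun b _ => hC _ _, fun x => ?_⟩
  refine (norm_le_sum_norm_entry _).trans ?_
  simp only [Finset.sum_mul, flatten_apply]
  exact Finset.sum_le_sum fun a _ => Finset.sum_le_sum fun b _ =>
    (norm_entry_le_norm _ _ _).trans (hb a.1 b.1 x)

variable {Ω : Type*} [MeasurableSpace Ω] {μ : Measure Ω} {g : Ω → ℝ} {p : ℕ}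

/-- The unscaled form of the bound for three letters. With the blocks `D 0, D 1, D 2` at the
positions `(2, 0), (0, 1), (1, 2)` of symmetric `3 × 3` block matrices, the only closed path in the
trace of the block word visits the diagonal blocks `Y 0, Y 1, Y 2` in this order. -/
lemma abs_integral_three_word_le_aux (hp : 2 ≤ p) (hg : ∀ x, 1 ≤ g x)
    (hK : Integrable (fun x => g x ^ (2 * p)) μ) {D Y : Fin 3 → Ω → Matrix ι ι ℂ}
    (hD : ∀ j, IsDom g 1 (D j)) (hY : ∀ j, IsDom g 1 (Y j))
    (hDH : ∀ j x, (D j x).IsHermitian) (hYH : ∀ j x, (Y j x).IsHermitian) {B : ℝ} (hB : 0 ≤ B)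
    (h2 : ∀ i j, ∫ x, reTr (Y j x ^ (2 * p - 2) * D i x ^ 2) ∂μ ≤ B)
    (h2p : ∀ i, ∫ x, reTr (D i x ^ (2 * p)) ∂μ ≤ B) {a b c : ℕ} (habc : a + b + c + 3 = 2 * p) :
    |∫ x, reTr (D 0 x * Y 0 x ^ a * D 1 x * Y 1 x ^ b * D 2 x * Y 2 x ^ c) ∂μ| ≤ 2 * B := by
  set e : Fin 3 → Fin 3 × Fin 3 := ![(2, 0), (0, 1), (1, 2)] with he
  have hne : ∀ k, (e k).1 ≠ (e k).2 := by decide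
  set L : Option (Fin 3) → Ω → Matrix (Fin 3 × ι) (Fin 3 × ι) ℂ := fun o x =>
    o.elim (flatten (Matrix.diagonal fun j => Y j x))
      fun k => flatten (symBlock (e k).1 (e k).2 (D k x)) with hL
  have hdiag : ∀ (v : Fin 3 → Matrix ι ι ℂ), Matrix.trace (Matrix.diagonal v) = ∑ j, v j :=
    fun v => Matrix.trace_diagonal v
  have key := abs_integral_word_le (ι := Fin 3 × ι) (L := L) (B := 2 * B) hp hg hK ?_ ?_
    (by positivity) ?_ ?_
    ([some 0] ++ List.replicate a none ++ [some 1] ++ List.replicate b none ++ [some 2] ++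
      List.replicate c none) (by simp; omega)
    (by simp only [zCount, List.countP_append, List.countP_cons, List.countP_nil,
      Option.isSome_some]; simp; omega)
  · have hword : ∀ x, reTr (D 0 x * Y 0 x ^ a * D 1 x * Y 1 x ^ b * D 2 x * Y 2 x ^ c) =
        reTr ((([some 0] : List (Option (Fin 3))) ++ List.replicate a none ++ [some 1] ++
          List.replicate b none ++ [some 2] ++ List.replicate c none).map fun o => L o x).prod := by
      intro x
      have h := trace_symBlock_word (fun k => D k x) (fun j => Y j x ^ a) (fun j => Y j x ^ b)
        (fun j => Y j x ^ c)
      rw [← h, ← reTr_flatten]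
      have hd : ∀ m : ℕ, flatten (Matrix.diagonal fun j => Y j x ^ m) = L none x ^ m := by
        intro m
        change _ = flatten (Matrix.diagonal fun j => Y j x) ^ m
        rw [← flatten_pow, Matrix.diagonal_pow]
        rfl
      simp only [flatten_mul, hd, List.map_append, List.prod_append, List.map_replicate,
        List.prod_replicate, List.map_cons, List.map_nil, List.prod_cons, List.prod_nil, mul_one]
      rfl
    simp only [hword]
    exact key
  · intro o
    cases o with
    | none =>
      refine IsDom.flatten fun i j => ?_
      by_cases hij : i = j
      · subst hij; simpa using hY i
      · simpa [Matrix.diagonal_apply_ne _ hij] using IsDom.const hg 0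
    | some k =>
      refine IsDom.flatten fun i j => ?_
      have hs : ∀ i' j' : Fin 3, IsDom g 1 fun x => Matrix.single i' j' (D k x) i j := by
        intro i' j'
        by_cases h : i' = i ∧ j' = j
        · obtain ⟨rfl, rfl⟩ := h; simpa using hD k
        · simpa [Matrix.single, h] using IsDom.const hg 0
      exact (hs _ _).add (hs _ _)
  · intro o x
    cases o with
    | none =>
      refine isHermitian_flatten fun i j => ?_
      by_cases hij : i = j
      · subst hij; simpa using (hYH i x).eq
      · rw [Matrix.diagonal_apply_ne _ hij, Matrix.diagonal_apply_ne _ (Ne.symm hij),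
          Matrix.conjTranspose_zero]
    | some k =>
      refine isHermitian_flatten fun i j => ?_
      have hDk : (D k x).conjTranspose = D k x := hDH k x
      simp only [symBlock, Matrix.add_apply, Matrix.conjTranspose_add, Matrix.single,
        Matrix.of_apply, apply_ite Matrix.conjTranspose, Matrix.conjTranspose_zero, hDk]
      rw [add_comm]
      congr 1 <;> simp only [and_comm]
  · intro k
    have e1 : ∀ x, reTr (L none x ^ (2 * p - 2) * L (some k) x ^ 2) =
        reTr (Y (e k).1 x ^ (2 * p - 2) * D k x ^ 2) +
        reTr (Y (e k).2 x ^ (2 * p - 2) * D k x ^ 2) := by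
      intro x
      simp only [hL, Option.elim_none, Option.elim_some, ← flatten_pow, ← flatten_mul,
        Matrix.diagonal_pow, symBlock_sq (hne k), Matrix.diagonal_mul_diagonal, reTr_flatten,
        hdiag]
      rw [← reTr_add]
      congr 1
      fin_cases k <;> simp [he, Fin.sum_univ_three, add_comm]
    simp only [e1]
    have hi : ∀ j, Integrable (fun x => reTr (Y j x ^ (2 * p - 2) * D k x ^ 2)) μ := fun j =>
      (((hY j).pow hg _).mul ((hD k).pow hg 2)).integrable hg hK (by omega)
    rw [integral_add (hi _) (hi _)]
    linarith [h2 k (e k).1, h2 k (e k).2]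
  · intro k
    have e1 : ∀ x, reTr (L (some k) x ^ (2 * p)) = 2 * reTr (D k x ^ (2 * p)) := by
      intro x
      simp only [hL, Option.elim_some, ← flatten_pow, symBlock_pow_two_mul (hne k) _
        (show p ≠ 0 by omega), reTr_flatten, hdiag]
      rw [two_mul (reTr _), ← reTr_add]
      congr 1
      fin_cases k <;> simp [he, Fin.sum_univ_three]
    simp only [e1]
    rw [integral_const_mul]
    linarith [h2p k]

/-- A word with three letters `D` and `2p - 3` letters `Y` is controlled by the words
`Y^{2p-2} D^2` and `D^{2p}`. -/
lemma abs_integral_three_word_le (hp : 2 ≤ p) (hg : ∀ x, 1 ≤ g x)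
    (hK : Integrable (fun x => g x ^ (2 * p)) μ) {D Y : Fin 3 → Ω → Matrix ι ι ℂ}
    (hD : ∀ j, IsDom g 1 (D j)) (hY : ∀ j, IsDom g 1 (Y j))
    (hDH : ∀ j x, (D j x).IsHermitian) (hYH : ∀ j x, (Y j x).IsHermitian) {B N r : ℝ}
    (hB : 0 ≤ B) (hN : 0 < N) (hr : 0 < r)
    (h2 : ∀ i j, ∫ x, reTr (Y j x ^ (2 * p - 2) * D i x ^ 2) ∂μ ≤ B * N ^ (2 * p - 2))
    (h2p : ∀ i, ∫ x, reTr (D i x ^ (2 * p)) ∂μ ≤ B * r ^ (2 * p - 2))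
    {a b c : ℕ} (habc : a + b + c + 3 = 2 * p) :
    |∫ x, reTr (D 0 x * Y 0 x ^ a * D 1 x * Y 1 x ^ b * D 2 x * Y 2 x ^ c) ∂μ| ≤
      2 * B * r * N ^ (2 * p - 3) := by
  have hsm : ∀ (t : ℝ) (A : Matrix ι ι ℂ), A.IsHermitian → (t • A).IsHermitian := by
    intro t A hA
    rw [Matrix.IsHermitian, Matrix.conjTranspose_smul, star_trivial, hA]
  have h := abs_integral_three_word_le_aux (D := fun j x => r⁻¹ • D j x)
    (Y := fun j x => N⁻¹ • Y j x) (B := B * (r⁻¹) ^ 2) (a := a) (b := b) (c := c) hp hg hK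
    (fun j => (hD j).const_smul _) (fun j => (hY j).const_smul _)
    (fun j x => hsm _ _ (hDH j x)) (fun j x => hsm _ _ (hYH j x)) (by positivity) ?_ ?_ habc
  · simp only [smul_pow, smul_mul_assoc, mul_smul_comm, reTr_smul, integral_const_mul] at h
    have e : 2 * p - 3 = a + b + c := by omega
    have hpos : 0 < N ^ c * (r * (N ^ b * (r * (N ^ a * r)))) := by positivity
    rw [e, ← mul_le_mul_iff_right₀ (inv_pos.mpr hpos)]
    calc _ = |N⁻¹ ^ c * (r⁻¹ * (N⁻¹ ^ b * (r⁻¹ * (N⁻¹ ^ a * (r⁻¹ *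
        ∫ x, reTr (D 0 x * Y 0 x ^ a * D 1 x * Y 1 x ^ b * D 2 x * Y 2 x ^ c) ∂μ)))))| := by
          rw [← abs_of_pos (inv_pos.mpr hpos), ← abs_mul]
          congr 1
          simp only [mul_inv, inv_pow]
          ring
      _ ≤ _ := h
      _ = _ := by
        field_simp
        ring
  · intro i j
    simp only [smul_pow, smul_mul_assoc, mul_smul_comm, reTr_smul, integral_const_mul]
    calc _ ≤ r⁻¹ ^ 2 * (N⁻¹ ^ (2 * p - 2) * (B * N ^ (2 * p - 2))) := by
          have := h2 i j
          gcongr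
      _ = _ := by
        rw [inv_pow N]
        field_simp
  · intro i
    simp only [smul_pow, reTr_smul, integral_const_mul]
    calc _ ≤ r⁻¹ ^ (2 * p) * (B * r ^ (2 * p - 2)) := by
          have := h2p i
          gcongr
      _ = _ := by
        obtain ⟨m, hm⟩ : ∃ m, 2 * p = m + 2 := ⟨2 * p - 2, by omega⟩
        rw [hm, Nat.add_sub_cancel, inv_pow r]
        field_simp
        ring

end ThreeWords

/-! ### The third-order exchange identity -/

section Exchange

variable {Ω : Type*} [MeasurableSpace Ω] {ι : Type*} [Fintype ι] [DecidableEq ι]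

lemma pow_sub_pow_eq_sum {R : Type*} [Ring R] (x y : R) (n : ℕ) :
    x ^ n - y ^ n = ∑ k ∈ Finset.range n, x ^ k * (x - y) * y ^ (n - 1 - k) := by
  induction n with
  | zero => simp
  | succ n ih =>
    have e : x ^ (n + 1) - y ^ (n + 1) = (x ^ n - y ^ n) * y + x ^ n * (x - y) := by
      simp only [pow_succ]; noncomm_ring
    rw [e, ih, Finset.sum_range_succ, Finset.sum_mul]
    congr 1
    · refine Finset.sum_congr rfl fun k hk => ?_
      have hk' := Finset.mem_range.mp hk
      rw [mul_assoc, ← pow_succ]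
      congr 2
      omega
    · simp

/-- Random Hermitian matrices `S` and `z 0, z 1, z 2` on a measure space such that the joint law
of `(S, z 0, z 1, z 2)` is invariant under permutations of the three matrices `z j`, and whose
`2p`-th moments are finite. The matrices `S + u • z j` are three copies of one random matrix. -/
structure IsExchangeableTriple (κ : Measure Ω) (g : Ω → ℝ) (p : ℕ) (S : Ω → Matrix ι ι ℂ)
    (z : Fin 3 → Ω → Matrix ι ι ℂ) : Prop where
  one_le : ∀ x, 1 ≤ g x
  integrable : Integrable (fun x => g x ^ (2 * p)) κ
  isDom_base : IsDom g 1 S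
  isDom : ∀ j, IsDom g 1 (z j)
  isHermitian_base : ∀ x, (S x).IsHermitian
  isHermitian : ∀ j x, (z j x).IsHermitian
  exchange : ∀ σ : Equiv.Perm (Fin 3), ∃ e : Ω ≃ᵐ Ω, MeasurePreserving e κ κ ∧
    (∀ x, S (e x) = S x) ∧ ∀ j x, z j (e x) = z (σ j) x

namespace IsExchangeableTriple

variable {κ : Measure Ω} {g : Ω → ℝ} {p : ℕ} {S : Ω → Matrix ι ι ℂ}
  {z : Fin 3 → Ω → Matrix ι ι ℂ} (u : ℝ)

lemma integral_perm (h : IsExchangeableTriple κ g p S z) (σ : Equiv.Perm (Fin 3))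
    (Φ : Matrix ι ι ℂ → (Fin 3 → Matrix ι ι ℂ) → ℝ) :
    ∫ x, Φ (S x) (fun j => z (σ j) x) ∂κ = ∫ x, Φ (S x) (fun j => z j x) ∂κ := by
  obtain ⟨e, he, hS, hz⟩ := h.exchange σ
  rw [← he.integral_comp' (fun x => Φ (S x) (fun j => z j x))]
  simp only [hS, hz]

lemma isDom_copy (h : IsExchangeableTriple κ g p S z) (j : Fin 3) :
    IsDom g 1 (fun x => S x + u • z j x) :=
  h.isDom_base.add ((h.isDom j).const_smul u)

lemma isHermitian_copy (h : IsExchangeableTriple κ g p S z) (j : Fin 3) (x : Ω) :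
    (S x + u • z j x).IsHermitian := by
  refine (h.isHermitian_base x).add ?_
  rw [Matrix.IsHermitian, Matrix.conjTranspose_smul, star_trivial, h.isHermitian j x]

/-- Replacing powers of one copy by powers of another one, by telescoping. -/
lemma integral_pow_sub_pow (h : IsExchangeableTriple κ g p S z) {A B : Ω → Matrix ι ι ℂ}
    {k l n : ℕ} (hA : IsDom g k A) (hB : IsDom g l B) (hkl : k + n + l ≤ 2 * p) (i j : Fin 3) :
    ∫ x, reTr (A x * ((S x + u • z i x) ^ n - (S x + u • z j x) ^ n) * B x) ∂κ =
      ∑ a ∈ Finset.range n, u * ∫ x, reTr (A x * (S x + u • z i x) ^ a * (z i x - z j x) *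
        (S x + u • z j x) ^ (n - 1 - a) * B x) ∂κ := by
  have hi : ∀ a ∈ Finset.range n, Integrable (fun x => reTr (A x * (S x + u • z i x) ^ a *
      (z i x - z j x) * (S x + u • z j x) ^ (n - 1 - a) * B x)) κ := by
    intro a ha
    have := Finset.mem_range.mp ha
    exact ((((hA.mul ((h.isDom_copy u i).pow h.one_le a)).mul ((h.isDom i).sub (h.isDom j))).mul
      ((h.isDom_copy u j).pow h.one_le (n - 1 - a))).mul hB).integrable h.one_le h.integrable
      (by omega)
  simp only [← integral_const_mul]
  rw [← integral_finsetSum _ fun a ha => (hi a ha).const_mul u]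
  refine integral_congr_ae (Filter.Eventually.of_forall fun x => ?_)
  simp only [← reTr_smul, ← reTr_sum]
  congr 1
  rw [pow_sub_pow_eq_sum, Finset.mul_sum, Finset.sum_mul]
  refine Finset.sum_congr rfl fun a _ => ?_
  rw [add_sub_add_left_eq_sub, ← smul_sub]
  simp only [mul_smul_comm, smul_mul_assoc, mul_assoc]

/-- Words in three of the matrices `z j` and in the copies `S + u • z j`. -/
lemma abs_integral_word_le (h : IsExchangeableTriple κ g p S z) (hp : 2 ≤ p) {B N r : ℝ}
    (hB : 0 ≤ B) (hN : 0 < N) (hr : 0 < r)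
    (h0 : ∫ x, reTr ((S x + u • z 0 x) ^ (2 * p - 2) * z 0 x ^ 2) ∂κ ≤ B * N ^ (2 * p - 2))
    (h1 : ∫ x, reTr ((S x + u • z 0 x) ^ (2 * p - 2) * z 1 x ^ 2) ∂κ ≤ B * N ^ (2 * p - 2))
    (h2 : ∫ x, reTr (z 0 x ^ (2 * p)) ∂κ ≤ B * r ^ (2 * p - 2))
    {a b c : ℕ} (habc : a + b + c + 3 = 2 * p) (i j : Fin 3 → Fin 3) :
    |∫ x, reTr (z (i 0) x * (S x + u • z (j 0) x) ^ a * z (i 1) x * (S x + u • z (j 1) x) ^ b *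
      z (i 2) x * (S x + u • z (j 2) x) ^ c) ∂κ| ≤ 2 * B * r * N ^ (2 * p - 3) := by
  refine abs_integral_three_word_le hp h.one_le h.integrable (D := fun k => z (i k))
    (Y := fun k x => S x + u • z (j k) x) (fun k => h.isDom _) (fun k => h.isDom_copy u _)
    (fun k x => h.isHermitian _ x) (fun k x => h.isHermitian_copy u _ x) hB hN hr ?_ ?_ habc
  · intro k l
    by_cases hkl : i k = j l
    · rw [hkl]
      refine le_trans (le_of_eq ?_) h0
      simpa using h.integral_perm (Equiv.swap 0 (j l))
        (fun s w => reTr ((s + u • w 0) ^ (2 * p - 2) * w 0 ^ 2))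
    · refine le_trans (le_of_eq ?_) h1
      have hσ : ∃ σ : Equiv.Perm (Fin 3), σ 0 = j l ∧ σ 1 = i k := by
        revert hkl
        generalize i k = s
        generalize j l = t
        revert s t
        decide
      obtain ⟨σ, hσ0, hσ1⟩ := hσ
      simpa [hσ0, hσ1] using h.integral_perm σ
        (fun s w => reTr ((s + u • w 0) ^ (2 * p - 2) * w 1 ^ 2))
  · intro k
    refine le_trans (le_of_eq ?_) h2
    simpa using h.integral_perm (Equiv.swap 0 (i k)) (fun s w => reTr (w 0 ^ (2 * p)))

/-- A word with one difference of two matrices `z j` in it. -/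
lemma abs_integral_sub_word_le (h : IsExchangeableTriple κ g p S z) (hp : 2 ≤ p) {B N r : ℝ}
    (hB : 0 ≤ B) (hN : 0 < N) (hr : 0 < r)
    (h0 : ∫ x, reTr ((S x + u • z 0 x) ^ (2 * p - 2) * z 0 x ^ 2) ∂κ ≤ B * N ^ (2 * p - 2))
    (h1 : ∫ x, reTr ((S x + u • z 0 x) ^ (2 * p - 2) * z 1 x ^ 2) ∂κ ≤ B * N ^ (2 * p - 2))
    (h2 : ∫ x, reTr (z 0 x ^ (2 * p)) ∂κ ≤ B * r ^ (2 * p - 2))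
    {a b c : ℕ} (habc : a + b + c + 3 = 2 * p) (i i' k j₀ j₁ j₂ l : Fin 3) :
    |∫ x, reTr (z l x * (S x + u • z j₀ x) ^ a * (z i x - z i' x) * (S x + u • z j₁ x) ^ b *
      z k x * (S x + u • z j₂ x) ^ c) ∂κ| ≤ 4 * B * r * N ^ (2 * p - 3) := by
  have hi : ∀ i, Integrable (fun x => reTr (z l x * (S x + u • z j₀ x) ^ a * z i x *
      (S x + u • z j₁ x) ^ b * z k x * (S x + u • z j₂ x) ^ c)) κ := by
    intro i
    exact (((((((h.isDom l).mul ((h.isDom_copy u j₀).pow h.one_le a)).mul (h.isDom i)).mul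
      ((h.isDom_copy u j₁).pow h.one_le b)).mul (h.isDom k)).mul
      ((h.isDom_copy u j₂).pow h.one_le c))).integrable h.one_le h.integrable (by omega)
  have hw : ∀ i, |∫ x, reTr (z l x * (S x + u • z j₀ x) ^ a * z i x *
      (S x + u • z j₁ x) ^ b * z k x * (S x + u • z j₂ x) ^ c) ∂κ| ≤
      2 * B * r * N ^ (2 * p - 3) := fun i =>
    h.abs_integral_word_le u hp hB hN hr h0 h1 h2 habc ![l, i, k] ![j₀, j₁, j₂]
  simp only [mul_sub, sub_mul, reTr_sub]
  rw [integral_sub (hi i) (hi i')]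
  refine (abs_sub _ _).trans ?_
  linarith [hw i, hw i']

/-- A word with two differences of matrices `z j` in it. -/
lemma abs_integral_sub_sub_word_le (h : IsExchangeableTriple κ g p S z) (hp : 2 ≤ p) {B N r : ℝ}
    (hB : 0 ≤ B) (hN : 0 < N) (hr : 0 < r)
    (h0 : ∫ x, reTr ((S x + u • z 0 x) ^ (2 * p - 2) * z 0 x ^ 2) ∂κ ≤ B * N ^ (2 * p - 2))
    (h1 : ∫ x, reTr ((S x + u • z 0 x) ^ (2 * p - 2) * z 1 x ^ 2) ∂κ ≤ B * N ^ (2 * p - 2))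
    (h2 : ∫ x, reTr (z 0 x ^ (2 * p)) ∂κ ≤ B * r ^ (2 * p - 2))
    {a b c : ℕ} (habc : a + b + c + 3 = 2 * p) (i i' k k' j₀ j₁ j₂ l : Fin 3) :
    |∫ x, reTr (z l x * (S x + u • z j₀ x) ^ a * (z i x - z i' x) * (S x + u • z j₁ x) ^ b *
      (z k x - z k' x) * (S x + u • z j₂ x) ^ c) ∂κ| ≤ 8 * B * r * N ^ (2 * p - 3) := by
  have hi : ∀ k, Integrable (fun x => reTr (z l x * (S x + u • z j₀ x) ^ a * (z i x - z i' x) *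
      (S x + u • z j₁ x) ^ b * z k x * (S x + u • z j₂ x) ^ c)) κ := by
    intro k
    exact (((((((h.isDom l).mul ((h.isDom_copy u j₀).pow h.one_le a)).mul
      ((h.isDom i).sub (h.isDom i'))).mul
      ((h.isDom_copy u j₁).pow h.one_le b)).mul (h.isDom k)).mul
      ((h.isDom_copy u j₂).pow h.one_le c))).integrable h.one_le h.integrable (by omega)
  have hw := fun k => h.abs_integral_sub_word_le u hp hB hN hr h0 h1 h2 habc i i' k j₀ j₁ j₂ l
  have e : ∀ x, reTr (z l x * (S x + u • z j₀ x) ^ a * (z i x - z i' x) *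
      (S x + u • z j₁ x) ^ b * (z k x - z k' x) * (S x + u • z j₂ x) ^ c) =
      reTr (z l x * (S x + u • z j₀ x) ^ a * (z i x - z i' x) *
      (S x + u • z j₁ x) ^ b * z k x * (S x + u • z j₂ x) ^ c) -
      reTr (z l x * (S x + u • z j₀ x) ^ a * (z i x - z i' x) *
      (S x + u • z j₁ x) ^ b * z k' x * (S x + u • z j₂ x) ^ c) := by
    intro x
    rw [← reTr_sub, ← sub_mul, ← mul_sub]
  simp only [e]
  rw [integral_sub (hi k) (hi k')]
  refine (abs_sub _ _).trans ?_
  linarith [hw k, hw k']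

/-- The moment `E Tr X^{2p-2} z^2`, in which `X` and `z` are dependent, is at most twice the bound
for independent copies: passing to an independent copy produces words with three letters `z`, and
these are controlled by the same moment with a small factor. -/
lemma integral_dependent_le (h : IsExchangeableTriple κ g p S z) (hp : 2 ≤ p) {B N r : ℝ}
    (hB : 0 ≤ B) (hN : 0 < N) (hr : 0 < r) (hu : |u| ≤ 1) (hNr : 16 * p * r ≤ N)
    (h1 : ∫ x, reTr ((S x + u • z 0 x) ^ (2 * p - 2) * z 1 x ^ 2) ∂κ ≤ B * N ^ (2 * p - 2))
    (h2 : ∫ x, reTr (z 0 x ^ (2 * p)) ∂κ ≤ B * r ^ (2 * p - 2)) :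
    ∫ x, reTr ((S x + u • z 0 x) ^ (2 * p - 2) * z 0 x ^ 2) ∂κ ≤ 2 * B * N ^ (2 * p - 2) := by
  set T := ∫ x, reTr ((S x + u • z 0 x) ^ (2 * p - 2) * z 0 x ^ 2) ∂κ with hT
  by_contra hlt
  push Not at hlt
  set t := T / N ^ (2 * p - 2) with ht
  have hTt : T = t * N ^ (2 * p - 2) := by rw [ht]; field_simp
  have htB : 2 * B < t := by rw [ht, lt_div_iff₀ (by positivity)]; exact hlt
  have ht0 : 0 < t := lt_of_le_of_lt (by positivity) htB
  have hi : ∀ j, Integrable (fun x => reTr ((S x + u • z j x) ^ (2 * p - 2) * z 0 x ^ 2)) κ :=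
    fun j => (((h.isDom_copy u j).pow h.one_le _).mul ((h.isDom 0).pow h.one_le 2)).integrable
      h.one_le h.integrable (by omega)
  have hperm : ∫ x, reTr ((S x + u • z 1 x) ^ (2 * p - 2) * z 0 x ^ 2) ∂κ =
      ∫ x, reTr ((S x + u • z 0 x) ^ (2 * p - 2) * z 1 x ^ 2) ∂κ := by
    simpa using h.integral_perm (Equiv.swap 0 1)
      (fun s w => reTr ((s + u • w 0) ^ (2 * p - 2) * w 1 ^ 2))
  have htel := h.integral_pow_sub_pow u (A := fun _ => 1) (B := fun x => z 0 x ^ 2) (k := 0)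
    (n := 2 * p - 2) (IsDom.const h.one_le 1) ((h.isDom 0).pow h.one_le 2) (by omega) 0 1
  have hlhs : ∫ x, reTr (1 * ((S x + u • z 0 x) ^ (2 * p - 2) - (S x + u • z 1 x) ^ (2 * p - 2)) *
      z 0 x ^ 2) ∂κ = T - ∫ x, reTr ((S x + u • z 1 x) ^ (2 * p - 2) * z 0 x ^ 2) ∂κ := by
    simp only [one_mul, sub_mul, reTr_sub]
    exact integral_sub (hi 0) (hi 1)
  have hterm : ∀ a ∈ Finset.range (2 * p - 2), u * ∫ x, reTr (1 * (S x + u • z 0 x) ^ a *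
      (z 0 x - z 1 x) * (S x + u • z 1 x) ^ (2 * p - 2 - 1 - a) * z 0 x ^ 2) ∂κ ≤
      4 * t * r * N ^ (2 * p - 3) := by
    intro a ha
    have ha' := Finset.mem_range.mp ha
    have hb := h.abs_integral_sub_word_le u hp ht0.le hN hr hTt.le
      (h1.trans (by gcongr; linarith)) (h2.trans (by gcongr; linarith))
      (a := a) (b := 2 * p - 2 - 1 - a) (c := 0) (by omega) 0 1 0 0 1 0 0
    have e : ∀ x, reTr (1 * (S x + u • z 0 x) ^ a *
        (z 0 x - z 1 x) * (S x + u • z 1 x) ^ (2 * p - 2 - 1 - a) * z 0 x ^ 2) =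
        reTr (z 0 x * (S x + u • z 0 x) ^ a * (z 0 x - z 1 x) *
        (S x + u • z 1 x) ^ (2 * p - 2 - 1 - a) * z 0 x * (S x + u • z 0 x) ^ 0) := by
      intro x
      rw [one_mul, pow_zero, mul_one, sq, ← mul_assoc, reTr_mul_comm]
      simp only [mul_assoc]
    simp only [e]
    refine (le_abs_self _).trans ?_
    rw [abs_mul]
    exact (mul_le_of_le_one_left (abs_nonneg _) hu).trans hb
  have hsum := Finset.sum_le_sum hterm
  rw [← htel, hlhs, hperm, Finset.sum_const, Finset.card_range, nsmul_eq_mul] at hsum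
  have hc : ((2 * p - 2 : ℕ) : ℝ) ≤ 2 * p := by
    exact_mod_cast Nat.sub_le _ _
  have hpow : N ^ (2 * p - 2) = N * N ^ (2 * p - 3) := by
    rw [← pow_succ']; congr 1; omega
  have hQ : 0 < N ^ (2 * p - 3) := by positivity
  have h3 : ((2 * p - 2 : ℕ) : ℝ) * (4 * t * r * N ^ (2 * p - 3)) ≤
      t / 2 * N ^ (2 * p - 2) := by
    calc _ ≤ (2 * p : ℝ) * (4 * t * r * N ^ (2 * p - 3)) := by gcongr
      _ = t / 2 * ((16 * p * r) * N ^ (2 * p - 3)) := by ring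
      _ ≤ t / 2 * (N * N ^ (2 * p - 3)) := by gcongr
      _ = _ := by rw [hpow]
  have h4 : t * N ^ (2 * p - 2) ≤ (B + t / 2) * N ^ (2 * p - 2) := by
    rw [← hTt]; linarith
  have h5 := le_of_mul_le_mul_right h4 (by positivity)
  linarith

/-- The integration-by-parts formula for `E Tr z X^{2p-1}`, where `X = S + u z`: up to words with
three letters `z` it is the Gaussian formula, in which `z` is replaced by a copy that is
independent of `X`. -/
lemma abs_integral_sub_le (h : IsExchangeableTriple κ g p S z) (hp : 1 ≤ p) {B N r : ℝ}
    (hB : 0 ≤ B) (hN : 0 < N) (hr : 0 < r) (hu : |u| ≤ 1) (hNr : 16 * p * r ≤ N)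
    (h1 : ∫ x, reTr ((S x + u • z 0 x) ^ (2 * p - 2) * z 1 x ^ 2) ∂κ ≤ B * N ^ (2 * p - 2))
    (h2 : ∫ x, reTr (z 0 x ^ (2 * p)) ∂κ ≤ B * r ^ (2 * p - 2))
    (hm1 : ∫ x, reTr (z 0 x * (S x + u • z 1 x) ^ (2 * p - 1)) ∂κ = 0)
    (hm2 : ∀ a b, a + b = 2 * p - 2 →
      ∫ x, reTr (z 0 x * (S x + u • z 2 x) ^ a * z 1 x * (S x + u • z 2 x) ^ b) ∂κ = 0) :
    |∫ x, reTr (z 0 x * (S x + u • z 0 x) ^ (2 * p - 1)) ∂κ -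
      u * ∑ a ∈ Finset.range (2 * p - 1), ∫ x, reTr (z 0 x * (S x + u • z 2 x) ^ a * z 0 x *
        (S x + u • z 2 x) ^ (2 * p - 2 - a)) ∂κ| ≤ 64 * p ^ 2 * B * r * (N ^ (2 * p - 2) / N) := by
  have hD : ∀ (l j₀ i i' j₁ : Fin 3) (a b : ℕ), IsDom g (1 + a + 1 + b) (fun x =>
      z l x * (S x + u • z j₀ x) ^ a * (z i x - z i' x) * (S x + u • z j₁ x) ^ b) :=
    fun l j₀ i i' j₁ a b => (((h.isDom l).mul ((h.isDom_copy u j₀).pow h.one_le a)).mul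
      ((h.isDom i).sub (h.isDom i'))).mul ((h.isDom_copy u j₁).pow h.one_le b)
  -- subtracting zero, the derivative becomes a sum of words with a difference
  have hfirst : ∫ x, reTr (z 0 x * (S x + u • z 0 x) ^ (2 * p - 1)) ∂κ =
      ∑ a ∈ Finset.range (2 * p - 1), u * ∫ x, reTr (z 0 x * (S x + u • z 0 x) ^ a *
        (z 0 x - z 1 x) * (S x + u • z 1 x) ^ (2 * p - 2 - a)) ∂κ := by
    have htel := h.integral_pow_sub_pow u (A := fun x => z 0 x) (B := fun _ => 1) (l := 0)
      (n := 2 * p - 1) (h.isDom 0) (IsDom.const h.one_le 1) (by omega) 0 1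
    have hi : ∀ j, Integrable (fun x => reTr (z 0 x * (S x + u • z j x) ^ (2 * p - 1))) κ :=
      fun j => ((h.isDom 0).mul ((h.isDom_copy u j).pow h.one_le _)).integrable
        h.one_le h.integrable (by omega)
    simp only [mul_one, show 2 * p - 1 - 1 = 2 * p - 2 by omega] at htel
    rw [← htel]
    simp only [mul_sub, reTr_sub]
    rw [integral_sub (hi 0) (hi 1), hm1, sub_zero]
  have hsecond : ∀ a ∈ Finset.range (2 * p - 1),
      ∫ x, reTr (z 0 x * (S x + u • z 2 x) ^ a * z 0 x *
        (S x + u • z 2 x) ^ (2 * p - 2 - a)) ∂κ =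
      ∫ x, reTr (z 0 x * (S x + u • z 2 x) ^ a * (z 0 x - z 1 x) *
        (S x + u • z 2 x) ^ (2 * p - 2 - a)) ∂κ := by
    intro a ha
    have ha' := Finset.mem_range.mp ha
    have hi : ∀ j, Integrable (fun x => reTr (z 0 x * (S x + u • z 2 x) ^ a * z j x *
        (S x + u • z 2 x) ^ (2 * p - 2 - a))) κ := fun j =>
      ((((h.isDom 0).mul ((h.isDom_copy u 2).pow h.one_le a)).mul (h.isDom j)).mul
      ((h.isDom_copy u 2).pow h.one_le _)).integrable h.one_le h.integrable (by omega)
    simp only [mul_sub, sub_mul, reTr_sub]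
    rw [integral_sub (hi 0) (hi 1), hm2 a _ (by omega), sub_zero]
  rcases hp.eq_or_lt with rfl | hp2
  · -- for `p = 1` there are no words with three letters
    rw [hfirst]
    simp only [mul_one, show 2 - 1 = 1 from rfl, Finset.sum_range_one, show 2 - 2 - 0 = 0 from rfl,
      pow_zero] at hsecond ⊢
    have := hsecond 0 (by simp)
    simp only [Nat.sub_self, pow_zero, mul_one] at this
    rw [this, sub_self, abs_zero]
    positivity
  have h0 := h.integral_dependent_le u hp2 hB hN hr hu hNr h1 h2
  have h1' : ∫ x, reTr ((S x + u • z 0 x) ^ (2 * p - 2) * z 1 x ^ 2) ∂κ ≤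
      2 * B * N ^ (2 * p - 2) := h1.trans (by gcongr; linarith)
  have h2' : ∫ x, reTr (z 0 x ^ (2 * p)) ∂κ ≤ 2 * B * r ^ (2 * p - 2) :=
    h2.trans (by gcongr; linarith)
  have hword := fun {a b c : ℕ} (habc : a + b + c + 3 = 2 * p) =>
    h.abs_integral_sub_sub_word_le u hp2 (by positivity : 0 ≤ 2 * B) hN hr h0 h1' h2' habc
  set Q := 8 * (2 * B) * r * N ^ (2 * p - 3) with hQ
  have hQ0 : 0 ≤ Q := by positivity
  -- the replacement of the two powers, one after the other
  have hdiff : ∀ a ∈ Finset.range (2 * p - 1),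
      |∫ x, reTr (z 0 x * (S x + u • z 0 x) ^ a * (z 0 x - z 1 x) *
        (S x + u • z 1 x) ^ (2 * p - 2 - a)) ∂κ -
      ∫ x, reTr (z 0 x * (S x + u • z 2 x) ^ a * (z 0 x - z 1 x) *
        (S x + u • z 2 x) ^ (2 * p - 2 - a)) ∂κ| ≤ (2 * p - 2 : ℕ) * Q := by
    intro a ha
    have ha' := Finset.mem_range.mp ha
    set b := 2 * p - 2 - a with hb
    have hi : ∀ j₀ j₁, Integrable (fun x => reTr (z 0 x * (S x + u • z j₀ x) ^ a *
        (z 0 x - z 1 x) * (S x + u • z j₁ x) ^ b)) κ := fun j₀ j₁ =>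
      (hD 0 j₀ 0 1 j₁ a b).integrable h.one_le h.integrable (by omega)
    have t1 := h.integral_pow_sub_pow u (A := fun x => z 0 x)
      (B := fun x => (z 0 x - z 1 x) * (S x + u • z 1 x) ^ b) (n := a) (h.isDom 0)
      (((h.isDom 0).sub (h.isDom 1)).mul ((h.isDom_copy u 1).pow h.one_le b)) (by omega) 0 2
    have t2 := h.integral_pow_sub_pow u
      (A := fun x => z 0 x * (S x + u • z 2 x) ^ a * (z 0 x - z 1 x))
      (B := fun x => 1) (l := 0) (n := b)
      (((h.isDom 0).mul ((h.isDom_copy u 2).pow h.one_le a)).mul ((h.isDom 0).sub (h.isDom 1)))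
      (IsDom.const h.one_le 1) (by omega) 1 2
    have e1 : ∫ x, reTr (z 0 x * ((S x + u • z 0 x) ^ a - (S x + u • z 2 x) ^ a) *
        ((z 0 x - z 1 x) * (S x + u • z 1 x) ^ b)) ∂κ =
        ∫ x, reTr (z 0 x * (S x + u • z 0 x) ^ a * (z 0 x - z 1 x) *
          (S x + u • z 1 x) ^ b) ∂κ -
        ∫ x, reTr (z 0 x * (S x + u • z 2 x) ^ a * (z 0 x - z 1 x) *
          (S x + u • z 1 x) ^ b) ∂κ := by
      rw [← integral_sub (hi 0 1) (hi 2 1)]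
      congr 1
      funext x
      rw [← reTr_sub, mul_sub, sub_mul]
      simp only [mul_assoc]
    have e2 : ∫ x, reTr (z 0 x * (S x + u • z 2 x) ^ a * (z 0 x - z 1 x) *
          ((S x + u • z 1 x) ^ b - (S x + u • z 2 x) ^ b) * 1) ∂κ =
        ∫ x, reTr (z 0 x * (S x + u • z 2 x) ^ a * (z 0 x - z 1 x) *
          (S x + u • z 1 x) ^ b) ∂κ -
        ∫ x, reTr (z 0 x * (S x + u • z 2 x) ^ a * (z 0 x - z 1 x) *
          (S x + u • z 2 x) ^ b) ∂κ := by
      rw [← integral_sub (hi 2 1) (hi 2 2)]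
      congr 1
      funext x
      rw [← reTr_sub, mul_one]
      rw [mul_sub]
    have b1 : |∑ k ∈ Finset.range a, u * ∫ x, reTr (z 0 x * (S x + u • z 0 x) ^ k *
        (z 0 x - z 2 x) * (S x + u • z 2 x) ^ (a - 1 - k) *
        ((z 0 x - z 1 x) * (S x + u • z 1 x) ^ b)) ∂κ| ≤ a * Q := by
      refine (Finset.abs_sum_le_sum_abs _ _).trans ?_
      refine (Finset.sum_le_card_nsmul _ _ Q fun k hk => ?_).trans (by simp)
      have hk' := Finset.mem_range.mp hk
      rw [abs_mul]
      refine (mul_le_of_le_one_left (abs_nonneg _) hu).trans ?_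
      have := hword (a := k) (b := a - 1 - k) (c := b) (by omega) 0 2 0 1 0 2 1 0
      simpa only [mul_assoc] using this
    have b2 : |∑ k ∈ Finset.range b, u * ∫ x, reTr (z 0 x * (S x + u • z 2 x) ^ a *
        (z 0 x - z 1 x) * (S x + u • z 1 x) ^ k *
        (z 1 x - z 2 x) * (S x + u • z 2 x) ^ (b - 1 - k) * 1) ∂κ| ≤ b * Q := by
      refine (Finset.abs_sum_le_sum_abs _ _).trans ?_
      refine (Finset.sum_le_card_nsmul _ _ Q fun k hk => ?_).trans (by simp)
      have hk' := Finset.mem_range.mp hk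
      rw [abs_mul]
      refine (mul_le_of_le_one_left (abs_nonneg _) hu).trans ?_
      have := hword (a := a) (b := k) (c := b - 1 - k) (by omega) 0 1 1 2 2 1 2 0
      simpa only [mul_one] using this
    rw [← t1, e1] at b1
    rw [← t2, e2] at b2
    have hab : ((2 * p - 2 : ℕ) : ℝ) = a + b := by
      rw [← Nat.cast_add]; congr 1; omega
    rw [hab, add_mul]
    refine le_trans ?_ (add_le_add b1 b2)
    refine le_trans (le_of_eq ?_) (abs_add_le _ _)
    congr 1
    ring
  rw [hfirst, Finset.mul_sum, ← Finset.sum_sub_distrib]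
  refine (Finset.abs_sum_le_sum_abs _ _).trans ?_
  refine (Finset.sum_le_card_nsmul _ _ ((2 * p - 2 : ℕ) * Q) fun a ha => ?_).trans ?_
  · rw [hsecond a ha, ← mul_sub, abs_mul]
    exact (mul_le_of_le_one_left (abs_nonneg _) hu).trans (hdiff a ha)
  · rw [Finset.card_range, nsmul_eq_mul]
    have c1 : ((2 * p - 1 : ℕ) : ℝ) ≤ 2 * p := by exact_mod_cast Nat.sub_le _ _
    have c2 : ((2 * p - 2 : ℕ) : ℝ) ≤ 2 * p := by exact_mod_cast Nat.sub_le _ _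
    calc _ ≤ (2 * p : ℝ) * (2 * p * Q) := by gcongr
      _ = _ := by
        have e : N ^ (2 * p - 2) / N = N ^ (2 * p - 3) := by
          rw [show 2 * p - 2 = (2 * p - 3) + 1 by omega, pow_succ, mul_div_cancel_right₀ _ hN.ne']
        rw [hQ, e]
        ring

end IsExchangeableTriple

end Exchange

/-! ### Traces of functions of Hermitian matrices -/

section Spectral

variable {ι : Type*} [Fintype ι] [DecidableEq ι] {A V : Matrix ι ι ℂ}

lemma reTr_cfc (hA : A.IsHermitian) (f : ℝ → ℝ) :
    reTr (cfc f A) = ∑ i, f (hA.eigenvalues i) := by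
  rw [hA.cfc_eq, Matrix.IsHermitian.cfc, Unitary.conjStarAlgAut_apply, reTr, Matrix.trace_mul_comm,
    ← mul_assoc, Unitary.coe_star_mul_self, one_mul, Matrix.trace_diagonal, Complex.re_sum]
  simp

/-- The traces of `A ^ a * V ^ b` in terms of the eigenvalues, with weights `|⟨e_j, f_k⟩|²` for
the eigenvectors `e_j` of `A` and `f_k` of `V`. -/
lemma exists_reTr_pow_mul_pow_eq (hA : A.IsHermitian) (hV : V.IsHermitian) :
    ∃ c : ι → ι → ℝ, (∀ j k, 0 ≤ c j k) ∧ ∀ a b : ℕ, reTr (A ^ a * V ^ b) =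
      ∑ j, ∑ k, c j k * (hA.eigenvalues j ^ a * hV.eigenvalues k ^ b) := by
  set M : Matrix ι ι ℂ := star (hA.eigenvectorUnitary : Matrix ι ι ℂ) *
    (hV.eigenvectorUnitary : Matrix ι ι ℂ) with hM
  refine ⟨fun j k => Complex.normSq (M j k), fun j k => Complex.normSq_nonneg _, fun a b => ?_⟩
  have hpow : ∀ {B : Matrix ι ι ℂ} (hB : B.IsHermitian) (m : ℕ), B ^ m =
      (hB.eigenvectorUnitary : Matrix ι ι ℂ) *
        Matrix.diagonal (fun i => ((hB.eigenvalues i ^ m : ℝ) : ℂ)) *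
        star (hB.eigenvectorUnitary : Matrix ι ι ℂ) := by
    intro B hB m
    conv_lhs => rw [hB.spectral_theorem, ← map_pow, Matrix.diagonal_pow,
      Unitary.conjStarAlgAut_apply]
    congr 3
    funext i
    simp
  have hMs : star (hV.eigenvectorUnitary : Matrix ι ι ℂ) *
      (hA.eigenvectorUnitary : Matrix ι ι ℂ) = star M := by
    rw [hM, star_mul, star_star]
  have h1 : reTr (A ^ a * V ^ b) = reTr
      (Matrix.diagonal (fun i => ((hA.eigenvalues i ^ a : ℝ) : ℂ)) * M *
        (Matrix.diagonal (fun i => ((hV.eigenvalues i ^ b : ℝ) : ℂ)) * star M)) := by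
    rw [hpow hA, hpow hV, ← hMs, hM, mul_assoc, mul_assoc, reTr_mul_comm]
    simp only [mul_assoc]
  rw [h1, reTr, Matrix.trace, Complex.re_sum]
  refine Finset.sum_congr rfl fun j _ => ?_
  rw [Matrix.diag_apply, Matrix.mul_apply, Complex.re_sum]
  refine Finset.sum_congr rfl fun k _ => ?_
  rw [Matrix.diagonal_mul, Matrix.diagonal_mul, Matrix.star_apply]
  have : ((hA.eigenvalues j ^ a : ℝ) : ℂ) * M j k *
      (((hV.eigenvalues k ^ b : ℝ) : ℂ) * star (M j k)) =
      ((Complex.normSq (M j k) * (hA.eigenvalues j ^ a * hV.eigenvalues k ^ b) : ℝ) : ℂ) := by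
    push_cast
    rw [← Complex.mul_conj, Complex.star_def]
    ring
  rw [this, Complex.ofReal_re]

lemma reTr_pow_eq_sum (hA : A.IsHermitian) (m : ℕ) :
    reTr (A ^ m) = ∑ i, hA.eigenvalues i ^ m := by
  rw [← reTr_cfc hA (fun x => x ^ m), cfc_pow_id A m hA.isSelfAdjoint]

lemma reTr_pow_two_mul_nonneg (hA : A.IsHermitian) (p : ℕ) : 0 ≤ reTr (A ^ (2 * p)) := by
  rw [reTr_pow_eq_sum hA]
  exact Finset.sum_nonneg fun i _ => by rw [pow_mul]; positivity

/-- Young's inequality for traces: `Tr X^{2p-2} V` against `Tr V^p` and `Tr X^{2p}`. -/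
lemma reTr_pow_mul_le (hA : A.IsHermitian) (hV : V.IsHermitian)
    (hV0 : ∀ k, 0 ≤ hV.eigenvalues k) {p : ℕ} (hp : 1 ≤ p) {N s : ℝ}
    (hN : 0 < N) (hs : 0 < s) :
    reTr (A ^ (2 * p - 2) * V) ≤ s ^ 2 * N ^ (2 * p - 2) *
      ((1 / p) * (reTr (V ^ p) / s ^ (2 * p)) +
        (1 - 1 / p) * (reTr (A ^ (2 * p)) / N ^ (2 * p))) := by
  obtain ⟨c, hc, h⟩ := exists_reTr_pow_mul_pow_eq hA hV
  have h1 := h (2 * p - 2) 1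
  have h2 := h 0 p
  have h3 := h (2 * p) 0
  simp only [pow_one, pow_zero, one_mul, mul_one] at h1 h2 h3
  rw [h1, h2, h3]
  simp only [Finset.sum_div, Finset.mul_sum, ← Finset.sum_add_distrib]
  refine Finset.sum_le_sum fun j _ => Finset.sum_le_sum fun k _ => ?_
  set x := hA.eigenvalues j
  set y := hV.eigenvalues k
  have hy : 0 ≤ y := hV0 k
  have hp0 : (0 : ℝ) < p := by exact_mod_cast hp
  have key := Real.geom_mean_le_arith_mean2_weighted (w₁ := 1 / p) (w₂ := 1 - 1 / p)
    (p₁ := (y / s ^ 2) ^ p) (p₂ := (x ^ 2 / N ^ 2) ^ p) (by positivity)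
    (by rw [sub_nonneg, div_le_one hp0]; exact_mod_cast hp) (by positivity) (by positivity)
    (by ring)
  have e1 : ((y / s ^ 2) ^ p) ^ (1 / p : ℝ) = y / s ^ 2 := by
    rw [← Real.rpow_natCast, ← Real.rpow_mul (by positivity), mul_one_div_cancel hp0.ne',
      Real.rpow_one]
  have e2 : ((x ^ 2 / N ^ 2) ^ p) ^ (1 - 1 / p : ℝ) = x ^ (2 * p - 2) / N ^ (2 * p - 2) := by
    rw [← Real.rpow_natCast, ← Real.rpow_mul (by positivity)]
    have : (p : ℝ) * (1 - 1 / p) = ((p - 1 : ℕ) : ℝ) := by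
      rw [Nat.cast_sub hp]; field_simp; simp
    rw [this, Real.rpow_natCast, div_pow, ← pow_mul, ← pow_mul, Nat.mul_sub, mul_one]
  rw [e1, e2] at key
  have hcjk := hc j k
  calc c j k * (x ^ (2 * p - 2) * y)
      = s ^ 2 * N ^ (2 * p - 2) * c j k *
        (y / s ^ 2 * (x ^ (2 * p - 2) / N ^ (2 * p - 2))) := by field_simp
    _ ≤ s ^ 2 * N ^ (2 * p - 2) * c j k * (1 / p * (y / s ^ 2) ^ p +
        (1 - 1 / p) * (x ^ 2 / N ^ 2) ^ p) := by gcongr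
    _ = _ := by
      rw [div_pow, div_pow, ← pow_mul, ← pow_mul]
      ring

/-- A Frobenius norm is bounded by a trace of an even power. -/
lemma norm_pow_le_reTr (hA : A.IsHermitian) {p : ℕ} (hp : 1 ≤ p) :
    ‖A‖ ^ (2 * p) ≤ (Fintype.card ι : ℝ) ^ (p - 1) * reTr (A ^ (2 * p)) := by
  have h1 : ‖A‖ ^ 2 = ∑ i, hA.eigenvalues i ^ 2 := by
    have h2 : reTr (A ^ 2) = reTr (A * A.conjTranspose) := by rw [sq, hA.eq]
    rw [← reTr_pow_eq_sum hA, Matrix.frobenius_norm_def, ← Real.sqrt_eq_rpow, Real.sq_sqrt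
      (by positivity), h2, reTr, Matrix.trace, Complex.re_sum]
    refine Finset.sum_congr rfl fun i _ => ?_
    rw [Matrix.diag_apply, Matrix.mul_apply, Complex.re_sum]
    refine Finset.sum_congr rfl fun j _ => ?_
    rw [Matrix.conjTranspose_apply, Complex.star_def, Complex.mul_conj, Complex.ofReal_re,
      Complex.normSq_eq_norm_sq]
    simp
  obtain ⟨m, rfl⟩ : ∃ m, p = m + 1 := ⟨p - 1, by omega⟩
  rw [pow_mul, h1, reTr_pow_eq_sum hA]
  have h2 := pow_sum_le_card_mul_sum_pow (s := Finset.univ)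
    (f := fun i => hA.eigenvalues i ^ 2) (fun i _ => by positivity) m
  simpa only [← pow_mul, Finset.card_univ, Nat.add_sub_cancel] using h2

end Spectral

/-! ### Differentiation of expected traces -/

section Curves

variable {Ω : Type*} [MeasurableSpace Ω] {ι : Type*} [Fintype ι] [DecidableEq ι]

/-- A differentiable curve `F` of random matrices with derivative `F'`, both dominated by
`g ^ k` uniformly in time. -/
structure IsDomCurve (g : Ω → ℝ) (k : ℕ) (F F' : ℝ → Ω → Matrix ι ι ℂ) : Prop where
  measurable : ∀ t i j, Measurable fun x => F t x i j
  measurable_deriv : ∀ t i j, Measurable fun x => F' t x i j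
  hasDerivAt : ∀ t x, HasDerivAt (fun t => F t x) (F' t x) t
  bound : ∃ C, 0 ≤ C ∧ ∀ t x, ‖F t x‖ ≤ C * g x ^ k ∧ ‖F' t x‖ ≤ C * g x ^ k

namespace IsDomCurve

variable {g : Ω → ℝ} {k l K : ℕ} {F F' G G' : ℝ → Ω → Matrix ι ι ℂ}

lemma isDom (h : IsDomCurve g k F F') (t : ℝ) : IsDom g k (F t) := by
  obtain ⟨C, hC, hb⟩ := h.bound
  exact ⟨h.measurable t, C, hC, fun x => (hb t x).1⟩

lemma isDom_deriv (h : IsDomCurve g k F F') (t : ℝ) : IsDom g k (F' t) := by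
  obtain ⟨C, hC, hb⟩ := h.bound
  exact ⟨h.measurable_deriv t, C, hC, fun x => (hb t x).2⟩

lemma mul (h : IsDomCurve g k F F') (h' : IsDomCurve g l G G') :
    IsDomCurve g (k + l) (fun t x => F t x * G t x)
      (fun t x => F' t x * G t x + F t x * G' t x) := by
  refine ⟨fun t => ((h.isDom t).mul (h'.isDom t)).1,
    fun t => (((h.isDom_deriv t).mul (h'.isDom t)).add ((h.isDom t).mul (h'.isDom_deriv t))).1,
    fun t x => (h.hasDerivAt t x).mul (h'.hasDerivAt t x), ?_⟩
  obtain ⟨C, hC, hb⟩ := h.bound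
  obtain ⟨C', hC', hb'⟩ := h'.bound
  have key : ∀ x (A B : Matrix ι ι ℂ), ‖A‖ ≤ C * g x ^ k → ‖B‖ ≤ C' * g x ^ l →
      ‖A * B‖ ≤ C * C' * g x ^ (k + l) := by
    intro x A B hA hB
    calc ‖A * B‖ ≤ ‖A‖ * ‖B‖ := Matrix.frobenius_norm_mul _ _
      _ ≤ (C * g x ^ k) * (C' * g x ^ l) :=
        mul_le_mul hA hB (norm_nonneg _) ((norm_nonneg _).trans hA)
      _ = _ := by ring
  refine ⟨2 * (C * C'), by positivity, fun t x => ⟨?_, ?_⟩⟩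
  · have := key x _ _ (hb t x).1 (hb' t x).1
    have := (norm_nonneg _).trans this
    linarith
  · refine (norm_add_le _ _).trans ?_
    linarith [key x _ _ (hb t x).1 (hb' t x).2, key x _ _ (hb t x).2 (hb' t x).1]

lemma congr (h : IsDomCurve g k F F') (e : ∀ t x, F t x = G t x) (e' : ∀ t x, F' t x = G' t x) :
    IsDomCurve g k G G' := by
  rwa [← show F = G from funext fun t => funext (e t),
    ← show F' = G' from funext fun t => funext (e' t)]

lemma const (hg : ∀ x, 1 ≤ g x) (A : Matrix ι ι ℂ) :
    IsDomCurve g k (fun _ _ => A) (fun _ _ => 0) :=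
  ⟨fun _ _ _ => measurable_const, fun _ _ _ => measurable_const, fun _ _ => hasDerivAt_const _ _,
    ‖A‖, norm_nonneg _, fun _ x =>
      ⟨le_mul_of_one_le_right (norm_nonneg _) (one_le_pow₀ (hg x)), by
        rw [norm_zero]
        exact mul_nonneg (norm_nonneg _) (pow_nonneg (zero_le_one.trans (hg x)) _)⟩⟩

lemma pow (hg : ∀ x, 1 ≤ g x) (h : IsDomCurve g 1 F F') (m : ℕ) :
    IsDomCurve g m (fun t x => F t x ^ m)
      (fun t x => ∑ a ∈ Finset.range m, F t x ^ a * F' t x * F t x ^ (m - 1 - a)) := by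
  induction m with
  | zero => simpa using const hg 1
  | succ m ih =>
    refine (ih.mul h).congr (fun t x => (pow_succ _ _).symm) fun t x => ?_
    rw [Finset.sum_range_succ, Finset.sum_mul]
    congr 1
    · refine Finset.sum_congr rfl fun a ha => ?_
      have := Finset.mem_range.mp ha
      rw [mul_assoc, ← pow_succ]
      congr 2
      omega
    · simp

/-- The curve `A + sin t • U + cos t • V`. -/
lemma trig {A U V : Ω → Matrix ι ι ℂ} (hA : IsDom g k A) (hU : IsDom g k U)
    (hV : IsDom g k V) :
    IsDomCurve g k (fun t x => A x + Real.sin t • U x + Real.cos t • V x)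
      (fun t x => Real.cos t • U x - Real.sin t • V x) := by
  refine ⟨fun t => ((hA.add (hU.const_smul _)).add (hV.const_smul _)).1,
    fun t => ((hU.const_smul _).sub (hV.const_smul _)).1, fun t x => ?_, ?_⟩
  · have h1 := ((Real.hasDerivAt_sin t).smul_const (U x)).const_add (A x)
    have h2 := h1.add ((Real.hasDerivAt_cos t).smul_const (V x))
    refine h2.congr_deriv ?_
    rw [neg_smul, sub_eq_add_neg]
  · obtain ⟨-, C, hC, hb⟩ := hA
    obtain ⟨-, C', hC', hb'⟩ := hU
    obtain ⟨-, C'', hC'', hb''⟩ := hV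
    have hsm : ∀ (c : ℝ) (M : Matrix ι ι ℂ), |c| ≤ 1 → ‖c • M‖ ≤ ‖M‖ := by
      intro c M hc
      rw [norm_smul]
      exact mul_le_of_le_one_left (norm_nonneg _) hc
    refine ⟨C + C' + C'', by positivity, fun t x => ⟨?_, ?_⟩⟩
    · calc _ ≤ ‖A x‖ + ‖Real.sin t • U x‖ + ‖Real.cos t • V x‖ := norm_add₃_le
        _ ≤ ‖A x‖ + ‖U x‖ + ‖V x‖ := by
          gcongr
          · exact hsm _ _ (Real.abs_sin_le_one t)
          · exact hsm _ _ (Real.abs_cos_le_one t)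
        _ ≤ _ := by linarith [hb x, hb' x, hb'' x]
    · have h0 : 0 ≤ C * g x ^ k := (norm_nonneg _).trans (hb x)
      calc _ ≤ ‖Real.cos t • U x‖ + ‖Real.sin t • V x‖ := norm_sub_le _ _
        _ ≤ ‖U x‖ + ‖V x‖ := by
          gcongr
          · exact hsm _ _ (Real.abs_cos_le_one t)
          · exact hsm _ _ (Real.abs_sin_le_one t)
        _ ≤ _ := by linarith [hb' x, hb'' x]

lemma hasDerivAt_integral {μ : Measure Ω} (hg : ∀ x, 1 ≤ g x)
    (hK : Integrable (fun x => g x ^ K) μ) (h : IsDomCurve g k F F') (hk : k ≤ K) (t : ℝ) :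
    HasDerivAt (fun t => ∫ x, reTr (F t x) ∂μ) (∫ x, reTr (F' t x) ∂μ) t := by
  obtain ⟨C, hC, hb⟩ := h.bound
  have hgk : ∀ x, g x ^ k ≤ g x ^ K := fun x => pow_le_pow_right₀ (hg x) hk
  refine (hasDerivAt_integral_of_dominated_loc_of_deriv_le
    (F := fun t x => reTr (F t x)) (F' := fun t x => reTr (F' t x))
    (bound := fun x => Fintype.card ι * (C * g x ^ K)) Filter.univ_mem
    (Filter.Eventually.of_forall fun t => (h.isDom t).measurable_reTr.aestronglyMeasurable)
    ((h.isDom t).integrable hg hK hk) (h.isDom_deriv t).measurable_reTr.aestronglyMeasurable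
    (Filter.Eventually.of_forall fun x t _ => ?_) ((hK.const_mul C).const_mul _)
    (Filter.Eventually.of_forall fun x t _ => ?_)).2
  · rw [Real.norm_eq_abs]
    refine (abs_reTr_le _).trans ?_
    gcongr
    exact (hb t x).2.trans (mul_le_mul_of_nonneg_left (hgk x) hC)
  · set L : Matrix ι ι ℂ →L[ℝ] ℝ := LinearMap.toContinuousLinearMap
      { toFun := reTr, map_add' := reTr_add, map_smul' := fun c A => reTr_smul c A } with hL
    exact L.hasFDerivAt.comp_hasDerivAt t (h.hasDerivAt t x)

/-- The derivative of `E Tr F ^ m`, by cyclicity of the trace. -/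
lemma hasDerivAt_integral_pow {μ : Measure Ω} (hg : ∀ x, 1 ≤ g x)
    (hK : Integrable (fun x => g x ^ K) μ) (h : IsDomCurve g 1 F F') {m : ℕ} (hm : m ≤ K) (t : ℝ) :
    HasDerivAt (fun t => ∫ x, reTr (F t x ^ m) ∂μ)
      (m * ∫ x, reTr (F' t x * F t x ^ (m - 1)) ∂μ) t := by
  convert (h.pow hg m).hasDerivAt_integral hg hK hm t using 1
  rw [← integral_const_mul]
  congr 1
  funext x
  rw [reTr_sum]
  have : ∀ a ∈ Finset.range m, reTr (F t x ^ a * F' t x * F t x ^ (m - 1 - a)) =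
      reTr (F' t x * F t x ^ (m - 1)) := by
    intro a ha
    have := Finset.mem_range.mp ha
    rw [mul_assoc, reTr_mul_comm, mul_assoc, ← pow_add]
    congr 3
    omega
  rw [Finset.sum_congr rfl this]
  simp

end IsDomCurve

end Curves

/-! ### Gaussian integration by parts -/

section GaussianIBP

variable {Ω Ω' : Type*} [MeasurableSpace Ω] [MeasurableSpace Ω'] {ι : Type*} [Fintype ι]
  [DecidableEq ι]

/-- A centered factor that is independent of the remaining ones makes the expectation vanish. -/
lemma integral_reTr_mul_eq_zero {μ : Measure Ω} {ν : Measure Ω'} [SFinite μ] [SFinite ν]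
    {W : Ω' → Matrix ι ι ℂ} (hW : ∀ i j, Integrable (fun x => W x i j) ν)
    (hW0 : ∀ i j, ∫ x, W x i j ∂ν = 0) (M : Ω → Matrix ι ι ℂ) :
    ∫ x, reTr (W x.2 * M x.1) ∂(μ.prod ν) = 0 := by
  by_cases hi : Integrable (fun x : Ω × Ω' => reTr (W x.2 * M x.1)) (μ.prod ν)
  · rw [integral_prod _ hi]
    have h0 : ∀ x, ∫ y, reTr (W y * M x) ∂ν = 0 := by
      intro x
      have e : ∀ y, reTr (W y * M x) = (∑ i, ∑ j, W y i j * M x j i).re := by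
        intro y
        simp [reTr, Matrix.trace, Matrix.mul_apply]
      simp only [e]
      have hint : Integrable (fun y => ∑ i, ∑ j, W y i j * M x j i) ν :=
        integrable_finsetSum _ fun i _ => integrable_finsetSum _ fun j _ => (hW i j).mul_const _
      have hre : ∫ y, (∑ i, ∑ j, W y i j * M x j i).re ∂ν =
          (∫ y, ∑ i, ∑ j, W y i j * M x j i ∂ν).re := integral_re hint
      rw [hre, integral_finsetSum _ fun i _ => integrable_finsetSum _ fun j _ =>
        (hW i j).mul_const _]
      have : ∀ i, ∫ y, ∑ j, W y i j * M x j i ∂ν = 0 := by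
        intro i
        rw [integral_finsetSum _ fun j _ => (hW i j).mul_const _]
        refine Finset.sum_eq_zero fun j _ => ?_
        rw [integral_mul_const, hW0, zero_mul]
      simp [this]
    simp [h0]
  · exact integral_undef hi

/-- Integration by parts for a centered Gaussian random matrix `H = Λ ∘ ξ`, by differentiating the
invariance of the law of two independent copies under rotations. -/
lemma integral_gaussian_mul_pow {E : Type*} [NormedAddCommGroup E] [NormedSpace ℝ E]
    [MeasurableSpace E] [BorelSpace E] [SecondCountableTopology E] [CompleteSpace E]
    {μ : Measure Ω} {ν : Measure Ω'} [IsProbabilityMeasure μ] [IsProbabilityMeasure ν]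
    {ξ : Ω' → E} (hξ : HasGaussianLaw ξ ν) (hξ0 : ∫ x, ξ x ∂ν = 0) (hξm : Measurable ξ)
    (Λ : E →ₗ[ℝ] Matrix ι ι ℂ) (hΛ : ∀ i j, Measurable fun e => Λ e i j)
    {A : Ω → Matrix ι ι ℂ} {g : Ω × (Ω' × Ω') → ℝ} (hg : ∀ x, 1 ≤ g x) {m : ℕ}
    (hK : Integrable (fun x => g x ^ (m + 1)) (μ.prod (ν.prod ν)))
    (hA : ∀ i j, Measurable fun x => A x i j) (hAg : IsDom g 1 (fun x => A x.1))
    (hH1 : IsDom g 1 (fun x => Λ (ξ x.2.1))) (hH2 : IsDom g 1 (fun x => Λ (ξ x.2.2))) (c : ℝ) :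
    ∫ x, reTr (Λ (ξ x.2.1) * (A x.1 + c • Λ (ξ x.2.1)) ^ m) ∂(μ.prod (ν.prod ν)) =
      c * ∑ a ∈ Finset.range m, ∫ x, reTr (Λ (ξ x.2.2) * (A x.1 + c • Λ (ξ x.2.1)) ^ a *
        Λ (ξ x.2.2) * (A x.1 + c • Λ (ξ x.2.1)) ^ (m - 1 - a)) ∂(μ.prod (ν.prod ν)) := by
  set P := μ.prod (ν.prod ν) with hP
  set h : ℝ → Ω × (E × E) → ℝ := fun t y => reTr ((Real.sin t • (-Λ y.2.1) + Real.cos t • Λ y.2.2) *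
    (A y.1 + Real.sin t • (c • Λ y.2.2) + Real.cos t • (c • Λ y.2.1)) ^ m) with hh
  have hmeas : ∀ t, Measurable (h t) := by
    intro t
    have d0 : ∀ i j, Measurable fun y : Ω × (E × E) => A y.1 i j :=
      fun i j => (hA i j).comp measurable_fst
    have d1 : ∀ i j, Measurable fun y : Ω × (E × E) => Λ y.2.1 i j :=
      fun i j => (hΛ i j).comp (measurable_fst.comp measurable_snd)
    have d2 : ∀ i j, Measurable fun y : Ω × (E × E) => Λ y.2.2 i j :=
      fun i j => (hΛ i j).comp (measurable_snd.comp measurable_snd)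
    refine measurable_reTr_of_entries (measurable_mul_entries (fun i j => ?_)
      (measurable_pow_entries (fun i j => ?_) m))
    · exact ((d1 i j).neg.const_smul (Real.sin t)).add ((d2 i j).const_smul (Real.cos t))
    · exact ((d0 i j).add (((d2 i j).const_smul c).const_smul (Real.sin t))).add
        (((d1 i j).const_smul c).const_smul (Real.cos t))
  -- invariance under rotations
  have hinv : ∀ t, ∫ x, h t (x.1, (ξ x.2.1, ξ x.2.2)) ∂P = ∫ x, h 0 (x.1, (ξ x.2.1, ξ x.2.2)) ∂P := by
    intro t
    have hγ := hξ.isGaussian_map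
    have hγ0 : (ν.map ξ)[id] = 0 := by
      rw [integral_map hξm.aemeasurable (by fun_prop)]
      simpa using hξ0
    have hmp : MeasurePreserving (fun x : Ω × (Ω' × Ω') => (x.1, (ξ x.2.1, ξ x.2.2))) P
        (μ.prod ((ν.map ξ).prod (ν.map ξ))) :=
      (MeasurePreserving.id μ).prod
        ((⟨hξm, rfl⟩ : MeasurePreserving ξ ν (ν.map ξ)).prod ⟨hξm, rfl⟩)
    have hrot : MeasurePreserving (Prod.map (id : Ω → Ω)
        (ContinuousLinearMap.rotation (E := E) t))
        (μ.prod ((ν.map ξ).prod (ν.map ξ))) (μ.prod ((ν.map ξ).prod (ν.map ξ))) :=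
      (MeasurePreserving.id μ).prod ⟨by fun_prop, IsGaussian.map_rotation_eq_self hγ0 t⟩
    have e1 := fun s => integral_map (μ := P) hmp.measurable.aemeasurable
      (hmeas s).aestronglyMeasurable
    have e2 := integral_map (μ := μ.prod ((ν.map ξ).prod (ν.map ξ))) hrot.measurable.aemeasurable
      (hmeas 0).aestronglyMeasurable
    rw [hmp.map_eq] at e1
    rw [hrot.map_eq] at e2
    rw [← e1, ← e1, e2]
    congr 1
    funext y
    simp only [hh, Prod.map, ContinuousLinearMap.rotation_apply, id, Real.sin_zero, Real.cos_zero,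
      zero_smul, one_smul, zero_add, add_zero, map_add, map_smul, smul_add]
    congr 3
    · rw [smul_neg, neg_smul]
    · rw [smul_comm c, smul_comm c]
      abel
  -- differentiation at `t = 0`
  have hB := (IsDomCurve.trig (IsDom.const hg (0 : Matrix ι ι ℂ)) (hH1.const_smul (-1)) hH2)
  have hY := (IsDomCurve.trig hAg (hH2.const_smul c) (hH1.const_smul c)).pow hg m
  have hd := (hB.mul hY).hasDerivAt_integral hg hK (by omega) 0
  have hconst : (fun t => ∫ x, reTr ((0 + Real.sin t • ((-1 : ℝ) • Λ (ξ x.2.1)) +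
      Real.cos t • Λ (ξ x.2.2)) * (A x.1 + Real.sin t • (c • Λ (ξ x.2.2)) +
      Real.cos t • (c • Λ (ξ x.2.1))) ^ m) ∂P) = fun _ => ∫ x, h 0 (x.1, (ξ x.2.1, ξ x.2.2)) ∂P := by
    funext t
    rw [← hinv t]
    simp only [hh, zero_add, neg_smul, one_smul]
  rw [hconst] at hd
  have h0 := hd.unique (hasDerivAt_const _ _)
  simp only [Real.sin_zero, Real.cos_zero, zero_smul, one_smul, zero_add, add_zero, sub_zero,
    neg_smul, neg_mul] at h0
  have hX : IsDom g 1 (fun x : Ω × (Ω' × Ω') => A x.1 + c • Λ (ξ x.2.1)) :=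
    hAg.add (hH1.const_smul c)
  have hw : ∀ a ∈ Finset.range m, IsDom g (m + 1) (fun x : Ω × (Ω' × Ω') =>
      Λ (ξ x.2.2) * (A x.1 + c • Λ (ξ x.2.1)) ^ a *
        Λ (ξ x.2.2) * (A x.1 + c • Λ (ξ x.2.1)) ^ (m - 1 - a)) := by
    intro a ha
    have := Finset.mem_range.mp ha
    exact (((hH2.mul (hX.pow hg a)).mul hH2).mul (hX.pow hg (m - 1 - a))).mono hg (by omega)
  have i1 : Integrable (fun x => reTr (Λ (ξ x.2.1) * (A x.1 + c • Λ (ξ x.2.1)) ^ m)) P :=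
    (hH1.mul (hX.pow hg m)).integrable hg hK (by omega)
  have i2 := fun a ha => (hw a ha).integrable hg hK le_rfl
  have e : ∀ x : Ω × (Ω' × Ω'), reTr (-(Λ (ξ x.2.1) * (A x.1 + c • Λ (ξ x.2.1)) ^ m) +
      Λ (ξ x.2.2) * ∑ a ∈ Finset.range m, (A x.1 + c • Λ (ξ x.2.1)) ^ a * c • Λ (ξ x.2.2) *
        (A x.1 + c • Λ (ξ x.2.1)) ^ (m - 1 - a)) =
      c * (∑ a ∈ Finset.range m, reTr (Λ (ξ x.2.2) * (A x.1 + c • Λ (ξ x.2.1)) ^ a *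
        Λ (ξ x.2.2) * (A x.1 + c • Λ (ξ x.2.1)) ^ (m - 1 - a))) -
      reTr (Λ (ξ x.2.1) * (A x.1 + c • Λ (ξ x.2.1)) ^ m) := by
    intro x
    rw [neg_add_eq_sub, reTr_sub, ← reTr_sum, ← reTr_smul]
    congr 2
    rw [Finset.mul_sum, Finset.smul_sum]
    refine Finset.sum_congr rfl fun a _ => ?_
    simp only [mul_smul_comm, smul_mul_assoc, mul_assoc]
  simp only [e] at h0
  rw [integral_sub ((integrable_finsetSum _ i2).const_mul c) i1, integral_const_mul,
    integral_finsetSum _ i2] at h0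
  linarith

end GaussianIBP

/-! ### Independent copies of a summand -/

section Copies

variable {Ω Ω' : Type*} [MeasurableSpace Ω] [MeasurableSpace Ω']

lemma _root_.MeasureTheory.MeasurePreserving.integral_comp_of_measurable {μ : Measure Ω}
    {ν : Measure Ω'} {f : Ω → Ω'} (hf : MeasurePreserving f μ ν) {h : Ω' → ℝ} (hh : Measurable h) :
    ∫ x, h (f x) ∂μ = ∫ y, h y ∂ν := by
  rw [← hf.map_eq, integral_map hf.measurable.aemeasurable hh.aestronglyMeasurable]

/-- Two different coordinates of a product of copies of `μ` are independent with law `μ`. -/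
lemma measurePreserving_eval_pair {κ : Type*} [Fintype κ] {μ : Measure Ω} [IsProbabilityMeasure μ]
    {j k : κ} (hjk : j ≠ k) :
    MeasurePreserving (fun η : κ → Ω => (η j, η k)) (Measure.pi fun _ => μ) (μ.prod μ) := by
  refine ⟨by fun_prop, ?_⟩
  have hi : iIndepFun (fun (i : κ) (η : κ → Ω) => η i) (Measure.pi fun _ => μ) :=
    iIndepFun_pi (X := fun _ => id) fun _ => aemeasurable_id
  have h := (indepFun_iff_map_prod_eq_prod_map_map (measurable_pi_apply j).aemeasurable
    (measurable_pi_apply k).aemeasurable).mp (hi.indepFun hjk)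
  rw [h, (measurePreserving_eval (fun _ => μ) j).map_eq,
    (measurePreserving_eval (fun _ => μ) k).map_eq]

/-- If `w` and `v` are independent, then `v` may be replaced by an independent copy of itself. -/
lemma integral_independent_copy {μ : Measure Ω} {ν : Measure Ω'} [IsProbabilityMeasure μ]
    [IsProbabilityMeasure ν] {T E : Type*} [MeasurableSpace T] [MeasurableSpace E] {w : Ω → T}
    {v : Ω → E} (hw : Measurable w) (hv : Measurable v) (hwv : IndepFun w v μ) {κ : Type*}
    [Fintype κ] {j k : κ} (hjk : j ≠ k) {h : (T × Ω') × (E × E) → ℝ} (hh : Measurable h) :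
    ∫ x, h ((w x.1.1, x.1.2), (v (x.2 j), v (x.2 k)))
        ∂((μ.prod ν).prod (Measure.pi fun _ : κ => μ)) =
      ∫ x, h ((w x.1.1, x.1.2), (v x.1.1, v x.2)) ∂((μ.prod ν).prod μ) := by
  have := Measure.isProbabilityMeasure_map (μ := μ) hw.aemeasurable
  have := Measure.isProbabilityMeasure_map (μ := μ) hv.aemeasurable
  have pw : MeasurePreserving w μ (μ.map w) := ⟨hw, rfl⟩
  have pv : MeasurePreserving v μ (μ.map v) := ⟨hv, rfl⟩
  have hmap : μ.map (fun x => (w x, v x)) = (μ.map w).prod (μ.map v) :=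
    (indepFun_iff_map_prod_eq_prod_map_map hw.aemeasurable hv.aemeasurable).mp hwv
  have pwv : MeasurePreserving (fun x => (w x, v x)) μ ((μ.map w).prod (μ.map v)) :=
    ⟨hw.prodMk hv, hmap⟩
  have p1 : MeasurePreserving
      (fun x : (Ω × Ω') × (κ → Ω) => ((w x.1.1, x.1.2), (v (x.2 j), v (x.2 k))))
      ((μ.prod ν).prod (Measure.pi fun _ : κ => μ))
      (((μ.map w).prod ν).prod ((μ.map v).prod (μ.map v))) :=
    (pw.prod (MeasurePreserving.id ν)).prod ((pv.prod pv).comp (measurePreserving_eval_pair hjk))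
  -- the same law arises from `(w, v)` on the first factor and `v` on the last one
  have p2 : MeasurePreserving (fun x : Ω × Ω' => ((w x.1, x.2), v x.1)) (μ.prod ν)
      (((μ.map w).prod ν).prod (μ.map v)) := by
    have q1 : MeasurePreserving (fun x : Ω × Ω' => ((w x.1, v x.1), x.2)) (μ.prod ν)
        (((μ.map w).prod (μ.map v)).prod ν) := pwv.prod (MeasurePreserving.id ν)
    have q2 : MeasurePreserving (fun y : (T × E) × Ω' => (y.1.1, (y.1.2, y.2)))
        (((μ.map w).prod (μ.map v)).prod ν) ((μ.map w).prod ((μ.map v).prod ν)) :=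
      measurePreserving_prodAssoc _ _ _
    have q3 : MeasurePreserving (fun y : T × (E × Ω') => (y.1, (y.2.2, y.2.1)))
        ((μ.map w).prod ((μ.map v).prod ν)) ((μ.map w).prod (ν.prod (μ.map v))) :=
      (MeasurePreserving.id _).prod Measure.measurePreserving_swap
    have q4 : MeasurePreserving (fun y : T × (Ω' × E) => ((y.1, y.2.1), y.2.2))
        ((μ.map w).prod (ν.prod (μ.map v))) (((μ.map w).prod ν).prod (μ.map v)) :=
      MeasurePreserving.symm MeasurableEquiv.prodAssoc (measurePreserving_prodAssoc _ _ _)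
    exact q4.comp (q3.comp (q2.comp q1))
  have p3 : MeasurePreserving (fun x : (Ω × Ω') × Ω => ((w x.1.1, x.1.2), (v x.1.1, v x.2)))
      ((μ.prod ν).prod μ) (((μ.map w).prod ν).prod ((μ.map v).prod (μ.map v))) :=
    (measurePreserving_prodAssoc _ _ _).comp (p2.prod pv)
  exact (p1.integral_comp_of_measurable hh).trans (p3.integral_comp_of_measurable hh).symm

/-- A centered factor evaluated at one coordinate, against a factor that does not depend on
this coordinate. -/
lemma integral_reTr_eval_mul_eq_zero {ι : Type*} [Fintype ι] [DecidableEq ι] {μ : Measure Ω}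
    [IsProbabilityMeasure μ] {W : Ω → Matrix ι ι ℂ} (hW : ∀ i j, Integrable (fun x => W x i j) μ)
    (hW0 : ∀ i j, ∫ x, W x i j ∂μ = 0) (M : (Fin 2 → Ω) → Matrix ι ι ℂ) :
    ∫ η, reTr (W (η 0) * M fun j => η j.succ) ∂(Measure.pi fun _ : Fin 3 => μ) = 0 := by
  have h := (measurePreserving_piFinSuccAbove (fun _ : Fin 3 => μ) 0).integral_comp'
    (fun y => reTr (W y.1 * M y.2))
  have h2 := (Measure.measurePreserving_swap (μ := Measure.pi fun _ : Fin 2 => μ)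
    (ν := μ)).integral_comp' (f := MeasurableEquiv.prodComm) (fun y => reTr (W y.1 * M y.2))
  have h3 := integral_reTr_mul_eq_zero (μ := Measure.pi fun _ : Fin 2 => μ) hW hW0 M
  exact h.trans (h2.symm.trans h3)

lemma IsDom.comp {ι : Type*} [Fintype ι] [DecidableEq ι] {g : Ω → ℝ} {g' : Ω' → ℝ} {k : ℕ}
    {f : Ω → Matrix ι ι ℂ} (hf : IsDom g k f) (hg : ∀ x, 1 ≤ g x) {e : Ω' → Ω} (he : Measurable e)
    (h : ∀ x, g (e x) ≤ g' x) : IsDom g' k (fun x => f (e x)) := by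
  obtain ⟨hm, C, hC, hb⟩ := hf
  refine ⟨fun i j => (hm i j).comp he, C, hC, fun x => (hb _).trans ?_⟩
  have := zero_le_one.trans (hg (e x))
  gcongr
  exact h x

/-- If the first coordinate is a finite discrete variable, then the random matrix may be studied
for each of its values. -/
lemma IsDom.of_forall_fst {ι : Type*} [Fintype ι] [DecidableEq ι] {n : ℕ} {g : Fin n × Ω → ℝ}
    {k : ℕ} (hg : ∀ x, 1 ≤ g x) {F : Fin n → Fin n × Ω → Matrix ι ι ℂ} (h : ∀ i, IsDom g k (F i)) :
    IsDom g k (fun x => F x.1 x) := by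
  choose hm C hC hb using h
  refine ⟨fun a b => ?_, ∑ i, C i, Finset.sum_nonneg fun i _ => hC i, fun x => (hb x.1 x).trans ?_⟩
  · refine measurable_from_prod_countable_right fun i => ?_
    exact (hm i a b).comp measurable_prodMk_left
  · have := zero_le_one.trans (hg x)
    gcongr
    exact Finset.single_le_sum (fun i _ => hC i) (Finset.mem_univ x.1)

end Copies

/-! ### Integration by parts for a sum of independent matrices -/

section Summands

variable {Ω Ω' : Type*} [MeasurableSpace Ω] [MeasurableSpace Ω'] {d n : ℕ}

/-- A scalar random variable that is at least one and dominates a finite family of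
random matrices. -/
noncomputable def dominator {α : Type*} [Fintype α] (W : α → Ω → Mat d) (x : Ω) : ℝ :=
  1 + ∑ k, ∑ i, ∑ j, ‖W k x i j‖

section Dominator

variable {α : Type*} [Fintype α] {W : α → Ω → Mat d}

lemma one_le_dominator (x : Ω) : 1 ≤ dominator W x :=
  le_add_of_nonneg_right (by positivity)

lemma norm_le_dominator (k : α) (x : Ω) : ‖W k x‖ ≤ dominator W x := by
  refine (norm_le_sum_norm_entry _).trans ?_
  have := Finset.single_le_sum (f := fun k => ∑ i, ∑ j, ‖W k x i j‖)
    (fun _ _ => by positivity) (Finset.mem_univ k)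
  rw [dominator]
  linarith

lemma isDom_dominator (hW : ∀ k i j, Measurable fun x => W k x i j) (k : α) :
    IsDom (dominator W) 1 (W k) :=
  ⟨hW k, 1, zero_le_one, fun x => by simpa using norm_le_dominator k x⟩

lemma memLp_dominator {μ : Measure Ω} [IsFiniteMeasure μ] {q : ℝ≥0∞}
    (hW : ∀ k i j, MemLp (fun x => W k x i j) q μ) : MemLp (dominator W) q μ := by
  have h : MemLp (fun x => ∑ k, ∑ i, ∑ j, ‖W k x i j‖) q μ := by
    refine memLp_finsetSum _ fun k _ => ?_
    refine memLp_finsetSum _ fun i _ => ?_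
    refine memLp_finsetSum _ fun j _ => ?_
    exact (hW k i j).norm
  exact (memLp_const (1 : ℝ)).add h

end Dominator

/-- The matrix with a given family of entries. -/
def ofEntries : (Fin d × Fin d → ℂ) →ₗ[ℝ] Mat d where
  toFun e := Matrix.of fun i j => e (i, j)
  map_add' _ _ := rfl
  map_smul' _ _ := rfl

/-- The matrix `Z₀ + u ∑ Z_i + c H`. -/
noncomputable def interp (Z₀ : Mat d) (Z : Fin n → Ω → Mat d) (H : Ω' → Mat d) (u c : ℝ)
    (x : Ω × Ω') : Mat d :=
  Z₀ + u • ∑ i, Z i x.1 + c • H x.2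

/-- The matrix `Z₀ + u ∑_{j ≠ i} Z_j + c H`. -/
noncomputable def interpErase (Z₀ : Mat d) (Z : Fin n → Ω → Mat d) (H : Ω' → Mat d) (u c : ℝ)
    (i : Fin n) (x : Ω × Ω') : Mat d :=
  Z₀ + u • ∑ j ∈ Finset.univ.erase i, Z j x.1 + c • H x.2

lemma interpErase_add (Z₀ : Mat d) (Z : Fin n → Ω → Mat d) (H : Ω' → Mat d) (u c : ℝ)
    (i : Fin n) (x : Ω × Ω') :
    interpErase Z₀ Z H u c i x + u • Z i x.1 = interp Z₀ Z H u c x := by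
  rw [interpErase, interp, ← Finset.sum_erase_add _ _ (Finset.mem_univ i), smul_add]
  abel

variable {μ : Measure Ω} {ν : Measure Ω'} [IsProbabilityMeasure μ] [IsProbabilityMeasure ν]
  {Z₀ : Mat d} {Z : Fin n → Ω → Mat d} {H : Ω' → Mat d} {u c : ℝ}

lemma IsSummands.integral_entry (hZ : IsSummands μ Z) (i : Fin n)
    (a b : Fin d) : ∫ x, Z i x a b ∂μ = 0 :=
  congrFun (congrFun (hZ.centered i) a) b

lemma IsSummands.integrable_entry (hZ : IsSummands μ Z) (i : Fin n)
    (a b : Fin d) : Integrable (fun x => Z i x a b) μ :=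
  (hZ.memLp i a b).integrable one_le_two

lemma isHermitian_interpErase (hZ₀ : Z₀.IsHermitian) (hZ : IsSummands μ Z)
    (hH : ∀ x, (H x).IsHermitian) (i : Fin n) (x : Ω × Ω') :
    (interpErase Z₀ Z H u c i x).IsHermitian := by
  simp only [Matrix.IsHermitian, interpErase, Matrix.conjTranspose_add,
    Matrix.conjTranspose_smul, star_trivial, Matrix.conjTranspose_sum, hZ₀.eq, (hH _).eq,
    (hZ.isHermitian _ _).eq]

/-- In the joint law of `interpErase` and two different copies of `Z i`, the first of these copies
may be taken to be `Z i` itself. -/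
lemma integral_interpErase_copy (hZ : IsSummands μ Z) (i : Fin n)
    {Ψ : Mat d → Mat d → Mat d → ℝ}
    (hΨ : Measurable fun y : ((Fin d × Fin d → ℂ) × Ω') × ((Fin d × Fin d → ℂ) ×
      (Fin d × Fin d → ℂ)) => Ψ (Z₀ + u • ofEntries y.1.1 + c • H y.1.2) (ofEntries y.2.1)
        (ofEntries y.2.2)) {j k : Fin 3} (hjk : j ≠ k) :
    ∫ x, Ψ (interpErase Z₀ Z H u c i x.1) (Z i (x.2 j)) (Z i (x.2 k))
        ∂((μ.prod ν).prod (Measure.pi fun _ : Fin 3 => μ)) =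
      ∫ x, Ψ (interpErase Z₀ Z H u c i x.1) (Z i x.1.1) (Z i x.2) ∂((μ.prod ν).prod μ) := by
  set v : Fin n → Ω → (Fin d × Fin d → ℂ) := fun i ω a => Z i ω a.1 a.2 with hv
  have hvm : ∀ i, Measurable (v i) := fun i => measurable_pi_lambda _ fun a => hZ.measurable i _ _
  have hind : IndepFun (∑ j ∈ Finset.univ.erase i, v j) (v i) μ :=
    hZ.indep.indepFun_finsetSum_of_notMem hvm (Finset.notMem_erase i _)
  have hwm : Measurable (∑ j ∈ Finset.univ.erase i, v j) := by
    rw [Finset.sum_fn]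
    exact Finset.measurable_sum _ fun j _ => hvm j
  have e1 : ∀ ω, ofEntries ((∑ j ∈ Finset.univ.erase i, v j) ω) =
      ∑ j ∈ Finset.univ.erase i, Z j ω := by
    intro ω
    rw [Finset.sum_apply, map_sum]
    rfl
  have := integral_independent_copy (ν := ν) hwm (hvm i) hind hjk hΨ
  simp only [e1] at this
  exact this

lemma measurable_interp_entries (hH : ∀ i j, Measurable fun x => H x i j) (i j : Fin d) :
    Measurable fun y : ((Fin d × Fin d → ℂ) × Ω') × ((Fin d × Fin d → ℂ) ×
      (Fin d × Fin d → ℂ)) => (Z₀ + u • ofEntries y.1.1 + c • H y.1.2) i j := by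
  have h1 : Measurable fun y : ((Fin d × Fin d → ℂ) × Ω') × ((Fin d × Fin d → ℂ) ×
      (Fin d × Fin d → ℂ)) => y.1.1 (i, j) :=
    (measurable_pi_apply (i, j)).comp (measurable_fst.comp measurable_fst)
  have h2 : Measurable fun y : ((Fin d × Fin d → ℂ) × Ω') × ((Fin d × Fin d → ℂ) ×
      (Fin d × Fin d → ℂ)) => H y.1.2 i j := (hH i j).comp (measurable_snd.comp measurable_fst)
  exact (((h1.const_smul u).const_add (Z₀ i j))).add (h2.const_smul c)

/-- The space on which a summand is exchangeable with independent copies of itself carries the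
counting measure for the index of the summand. -/
noncomputable abbrev exchangeMeasure (n : ℕ) (μ : Measure Ω) (ν : Measure Ω') :
    Measure (Fin n × ((Ω × Ω') × (Fin 3 → Ω))) :=
  Measure.count.prod ((μ.prod ν).prod (Measure.pi fun _ : Fin 3 => μ))

lemma integral_exchangeMeasure {f : Fin n × ((Ω × Ω') × (Fin 3 → Ω)) → ℝ}
    (hf : Integrable f (exchangeMeasure n μ ν)) :
    ∫ x, f x ∂(exchangeMeasure n μ ν) =
      ∑ i, ∫ y, f (i, y) ∂((μ.prod ν).prod (Measure.pi fun _ : Fin 3 => μ)) := by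
  rw [integral_prod _ hf, integral_count]

variable {p : ℕ}

/-- A dominating function on the exchange space. -/
noncomputable def exchangeDom (Z : Fin n → Ω → Mat d) (H : Ω' → Mat d)
    (x : Fin n × ((Ω × Ω') × (Fin 3 → Ω))) : ℝ :=
  dominator Z x.2.1.1 + dominator (fun _ : Unit => H) x.2.1.2 + ∑ j, dominator Z (x.2.2 j)

lemma isExchangeableTriple (hZ₀ : Z₀.IsHermitian) (hZ : IsSummands μ Z)
    (hZp : ∀ i a b, MemLp (fun x => Z i x a b) (2 * p : ℕ) μ) (hHh : ∀ x, (H x).IsHermitian)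
    (hH : ∀ i j, Measurable fun x => H x i j)
    (hHp : ∀ a b, MemLp (fun x => H x a b) (2 * p : ℕ) ν) :
    IsExchangeableTriple (exchangeMeasure n μ ν) (exchangeDom Z H) p
      (fun x => interpErase Z₀ Z H u c x.1 x.2.1) (fun j x => Z x.1 (x.2.2 j)) := by
  have hg1 : ∀ x, 1 ≤ dominator Z x := one_le_dominator
  have hg2 : ∀ x, 1 ≤ dominator (fun _ : Unit => H) x := one_le_dominator
  have hs : ∀ η : Fin 3 → Ω, 0 ≤ ∑ j, dominator Z (η j) := fun η =>
    Finset.sum_nonneg fun j _ => zero_le_one.trans (hg1 _)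
  have hone : ∀ x, 1 ≤ exchangeDom Z H x := fun x => by
    have := hg1 x.2.1.1
    have := hg2 x.2.1.2
    have := hs x.2.2
    rw [exchangeDom]
    linarith
  have hZe : ∀ j, Measurable fun x : Fin n × ((Ω × Ω') × (Fin 3 → Ω)) => x.2.2 j :=
    fun j => (measurable_pi_apply j).comp (measurable_snd.comp measurable_snd)
  refine ⟨hone, ?_, ?_, ?_, fun x => isHermitian_interpErase hZ₀ hZ hHh _ _,
    fun j x => hZ.isHermitian _ _, ?_⟩
  · have m1 : MemLp (dominator Z) (2 * p : ℕ) μ := memLp_dominator hZp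
    have m2 : MemLp (dominator fun _ : Unit => H) (2 * p : ℕ) ν :=
      memLp_dominator fun _ => hHp
    have m3 : ∀ j : Fin 3, MemLp (fun η : Fin 3 → Ω => dominator Z (η j)) (2 * p : ℕ)
        (Measure.pi fun _ => μ) := fun j =>
      m1.comp_measurePreserving (measurePreserving_eval (fun _ => μ) j)
    have m4 : MemLp (fun x : (Ω × Ω') × (Fin 3 → Ω) => dominator Z x.1.1 +
        dominator (fun _ : Unit => H) x.1.2 + ∑ j, dominator Z (x.2 j)) (2 * p : ℕ)
        ((μ.prod ν).prod (Measure.pi fun _ : Fin 3 => μ)) :=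
      (((m1.comp_fst ν).comp_fst _).add ((m2.comp_snd μ).comp_fst _)).add
        ((memLp_finsetSum _ fun j _ => m3 j).comp_snd _)
    have m5 := (m4.comp_snd (Measure.count : Measure (Fin n))).integrable_norm_pow'
    refine m5.congr (Filter.Eventually.of_forall fun x => ?_)
    have := hone x
    change ‖exchangeDom Z H x‖ ^ (2 * p) = _
    rw [Real.norm_of_nonneg (by linarith)]
  · have hw : ∀ j, IsDom (exchangeDom Z H) 1
        (fun x : Fin n × ((Ω × Ω') × (Fin 3 → Ω)) => Z j x.2.1.1) := fun j =>
      (isDom_dominator hZ.measurable j).comp hg1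
        (e := fun x : Fin n × ((Ω × Ω') × (Fin 3 → Ω)) => x.2.1.1) (by fun_prop) fun x => by
          have := hg2 x.2.1.2
          have := hs x.2.2
          rw [exchangeDom]
          linarith
    have hw2 : IsDom (exchangeDom Z H) 1
        (fun x : Fin n × ((Ω × Ω') × (Fin 3 → Ω)) => H x.2.1.2) :=
      (isDom_dominator (W := fun _ : Unit => H) (fun _ => hH) ()).comp hg2
        (e := fun x : Fin n × ((Ω × Ω') × (Fin 3 → Ω)) => x.2.1.2) (by fun_prop) fun x => by
          have := hg1 x.2.1.1
          have := hs x.2.2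
          rw [exchangeDom]
          linarith
    -- the index is a discrete variable, so that a statement for each of its values is enough
    have hi : ∀ i, IsDom (exchangeDom Z H) 1 (fun x : Fin n × ((Ω × Ω') × (Fin 3 → Ω)) =>
        interpErase Z₀ Z H u c i x.2.1) := fun i =>
      ((IsDom.const hone Z₀).add ((IsDom.sum hone _ fun j _ => hw j).const_smul u)).add
        (hw2.const_smul c)
    exact IsDom.of_forall_fst hone hi
  · intro j
    refine IsDom.of_forall_fst (F := fun i x => Z i (x.2.2 j)) hone fun i => ?_
    refine (isDom_dominator hZ.measurable i).comp hg1
        (e := fun x : Fin n × ((Ω × Ω') × (Fin 3 → Ω)) => x.2.2 j) (hZe j) fun x => ?_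
    have := hg1 x.2.1.1
    have := hg2 x.2.1.2
    have := Finset.single_le_sum (f := fun j => dominator Z (x.2.2 j))
      (fun j _ => zero_le_one.trans (hg1 _)) (Finset.mem_univ j)
    rw [exchangeDom]
    linarith
  · intro σ
    refine ⟨MeasurableEquiv.prodCongr (MeasurableEquiv.refl _) (MeasurableEquiv.prodCongr
      (MeasurableEquiv.refl _) (MeasurableEquiv.piCongrLeft (fun _ => Ω) σ.symm)), ?_,
      fun x => rfl, fun j x => ?_⟩
    · exact (MeasurePreserving.id _).prod ((MeasurePreserving.id _).prod
        (measurePreserving_piCongrLeft (fun _ : Fin 3 => μ) σ.symm))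
    · change Z x.1 (MeasurableEquiv.piCongrLeft (fun _ => Ω) σ.symm x.2.2 j) = _
      have := Equiv.piCongrLeft_apply_apply (fun _ : Fin 3 => Ω) σ.symm x.2.2 (σ j)
      rw [Equiv.symm_apply_apply] at this
      rw [MeasurableEquiv.coe_piCongrLeft, this]

/-- Integration by parts for the sum of independent matrices: the error in the Gaussian formula is
of third order in the summands. -/
lemma abs_sum_integral_sub_le (hZ₀ : Z₀.IsHermitian) (hZ : IsSummands μ Z)
    (hZp : ∀ i a b, MemLp (fun x => Z i x a b) (2 * p : ℕ) μ) (hHh : ∀ x, (H x).IsHermitian)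
    (hH : ∀ i j, Measurable fun x => H x i j)
    (hHp : ∀ a b, MemLp (fun x => H x a b) (2 * p : ℕ) ν) (hp : 1 ≤ p) {B N r : ℝ}
    (hB : 0 ≤ B) (hN : 0 < N) (hr : 0 < r) (hu : |u| ≤ 1) (hNr : 16 * p * r ≤ N)
    (h1 : ∑ i, ∫ x, reTr (interp Z₀ Z H u c x.1 ^ (2 * p - 2) * Z i x.2 ^ 2)
      ∂((μ.prod ν).prod μ) ≤ B * N ^ (2 * p - 2))
    (h2 : ∑ i, ∫ x, reTr (Z i x ^ (2 * p)) ∂μ ≤ B * r ^ (2 * p - 2)) :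
    |∑ i, ∫ x, reTr (Z i x.1.1 * interp Z₀ Z H u c x.1 ^ (2 * p - 1)) ∂((μ.prod ν).prod μ) -
      u * ∑ a ∈ Finset.range (2 * p - 1), ∑ i, ∫ x, reTr (Z i x.2 * interp Z₀ Z H u c x.1 ^ a *
        Z i x.2 * interp Z₀ Z H u c x.1 ^ (2 * p - 2 - a)) ∂((μ.prod ν).prod μ)| ≤
      64 * p ^ 2 * B * r * (N ^ (2 * p - 2) / N) := by
  have h := isExchangeableTriple (μ := μ) (ν := ν) (Z₀ := Z₀) (u := u) (c := c)
    hZ₀ hZ hZp hHh hH hHp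
  have hS := fun i j => measurable_interp_entries (Z₀ := Z₀) (u := u) (c := c) hH i j
  have hA : ∀ i j, Measurable fun y : ((Fin d × Fin d → ℂ) × Ω') × ((Fin d × Fin d → ℂ) ×
      (Fin d × Fin d → ℂ)) => ofEntries y.2.1 i j := fun i j =>
    (measurable_pi_apply (i, j)).comp (measurable_fst.comp measurable_snd)
  have hA' : ∀ i j, Measurable fun y : ((Fin d × Fin d → ℂ) × Ω') × ((Fin d × Fin d → ℂ) ×
      (Fin d × Fin d → ℂ)) => ofEntries y.2.2 i j := fun i j =>
    (measurable_pi_apply (i, j)).comp (measurable_snd.comp measurable_snd)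
  have hX : ∀ i j, Measurable fun y : ((Fin d × Fin d → ℂ) × Ω') × ((Fin d × Fin d → ℂ) ×
      (Fin d × Fin d → ℂ)) =>
      ((Z₀ + u • ofEntries y.1.1 + c • H y.1.2) + u • ofEntries y.2.1) i j := fun i j =>
    (hS i j).add ((hA i j).const_smul u)
  have hd := fun j => h.isDom j
  have hc := fun j => h.isDom_copy u j
  have hint : ∀ {k : ℕ} {f : Fin n × ((Ω × Ω') × (Fin 3 → Ω)) → Mat d},
      IsDom (exchangeDom Z H) k f → k ≤ 2 * p →
      Integrable (fun x => reTr (f x)) (exchangeMeasure n μ ν) := fun hf hk =>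
    hf.integrable h.one_le h.integrable hk
  have key := h.abs_integral_sub_le u hp hB hN hr hu hNr ?_ ?_ ?_ ?_
  · -- the two terms of the statement, in terms of copies
    rw [integral_exchangeMeasure (hint ((hd 0).mul ((hc 0).pow h.one_le _)) (by omega))] at key
    have k1 : ∀ i, ∫ y, reTr (Z i (y.2 0) * (interpErase Z₀ Z H u c i y.1 + u • Z i (y.2 0)) ^
        (2 * p - 1)) ∂((μ.prod ν).prod (Measure.pi fun _ : Fin 3 => μ)) =
        ∫ x, reTr (Z i x.1.1 * interp Z₀ Z H u c x.1 ^ (2 * p - 1)) ∂((μ.prod ν).prod μ) := by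
      intro i
      have := integral_interpErase_copy (μ := μ) (ν := ν) (Z₀ := Z₀) (u := u) (c := c) hZ i
        (Ψ := fun s a _ => reTr (a * (s + u • a) ^ (2 * p - 1)))
        (measurable_reTr_of_entries (measurable_mul_entries hA (measurable_pow_entries hX _)))
        (show (0 : Fin 3) ≠ 1 by decide)
      simpa only [interpErase_add] using this
    have k2 : ∀ a ∈ Finset.range (2 * p - 1), ∫ x, reTr (Z x.1 (x.2.2 0) *
        (interpErase Z₀ Z H u c x.1 x.2.1 + u • Z x.1 (x.2.2 2)) ^ a * Z x.1 (x.2.2 0) *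
        (interpErase Z₀ Z H u c x.1 x.2.1 + u • Z x.1 (x.2.2 2)) ^ (2 * p - 2 - a))
        ∂(exchangeMeasure n μ ν) = ∑ i, ∫ x, reTr (Z i x.2 * interp Z₀ Z H u c x.1 ^ a *
        Z i x.2 * interp Z₀ Z H u c x.1 ^ (2 * p - 2 - a)) ∂((μ.prod ν).prod μ) := by
      intro a ha
      have ha' := Finset.mem_range.mp ha
      rw [integral_exchangeMeasure (hint ((((hd 0).mul ((hc 2).pow h.one_le _)).mul (hd 0)).mul
        ((hc 2).pow h.one_le _)) (by omega))]
      refine Finset.sum_congr rfl fun i _ => ?_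
      have := integral_interpErase_copy (μ := μ) (ν := ν) (Z₀ := Z₀) (u := u) (c := c) hZ i
        (Ψ := fun s a' b => reTr (b * (s + u • a') ^ a * b * (s + u • a') ^ (2 * p - 2 - a)))
        (measurable_reTr_of_entries (measurable_mul_entries (measurable_mul_entries
          (measurable_mul_entries hA' (measurable_pow_entries hX _)) hA')
          (measurable_pow_entries hX _)))
        (show (2 : Fin 3) ≠ 0 by decide)
      simpa only [interpErase_add] using this
    rw [Finset.sum_congr rfl k2, Finset.sum_congr rfl fun i _ => k1 i] at key
    exact key
  · refine le_of_eq_of_le ?_ h1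
    rw [integral_exchangeMeasure (hint (((hc 0).pow h.one_le _).mul
      (((hd 1).mul (hd 1)).congr fun x => (sq _).symm)) (by omega))]
    refine Finset.sum_congr rfl fun i _ => ?_
    have := integral_interpErase_copy (μ := μ) (ν := ν) (Z₀ := Z₀) (u := u) (c := c) hZ i
      (Ψ := fun s a b => reTr ((s + u • a) ^ (2 * p - 2) * b ^ 2))
      (measurable_reTr_of_entries (measurable_mul_entries (measurable_pow_entries hX _)
        (measurable_pow_entries hA' _)))
      (show (0 : Fin 3) ≠ 1 by decide)
    simpa only [interpErase_add] using this
  · refine le_of_eq_of_le ?_ h2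
    rw [integral_exchangeMeasure (hint ((hd 0).pow h.one_le _) le_rfl)]
    refine Finset.sum_congr rfl fun i _ => ?_
    have := (measurePreserving_eval (fun _ : Fin 3 => μ) 0).comp
      (measurePreserving_snd (μ := μ.prod ν) (ν := Measure.pi fun _ : Fin 3 => μ))
    exact this.integral_comp_of_measurable
      (measurable_reTr_of_entries (measurable_pow_entries (hZ.measurable i) (2 * p)))
  · rw [integral_exchangeMeasure (hint ((hd 0).mul ((hc 1).pow h.one_le _)) (by omega))]
    refine Finset.sum_eq_zero fun i _ => ?_
    have := integral_interpErase_copy (μ := μ) (ν := ν) (Z₀ := Z₀) (u := u) (c := c) hZ i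
      (Ψ := fun s a b => reTr (b * (s + u • a) ^ (2 * p - 1)))
      (measurable_reTr_of_entries (measurable_mul_entries hA' (measurable_pow_entries hX _)))
      (show (1 : Fin 3) ≠ 0 by decide)
    refine this.trans ?_
    exact integral_reTr_mul_eq_zero (μ := μ.prod ν) (hZ.integrable_entry i) (hZ.integral_entry i)
      fun x => (interpErase Z₀ Z H u c i x + u • Z i x.1) ^ (2 * p - 1)
  · intro a b hab
    have hi := hint ((((hd 0).mul ((hc 2).pow h.one_le a)).mul (hd 1)).mul
        ((hc 2).pow h.one_le b)) (by omega)
    rw [integral_prod _ hi, integral_count]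
    refine Finset.sum_eq_zero fun i _ => ?_
    by_cases hj : Integrable (fun y => reTr (Z i (y.2 0) * (interpErase Z₀ Z H u c i y.1 +
        u • Z i (y.2 2)) ^ a * Z i (y.2 1) * (interpErase Z₀ Z H u c i y.1 +
        u • Z i (y.2 2)) ^ b)) ((μ.prod ν).prod (Measure.pi fun _ : Fin 3 => μ))
    · rw [integral_prod _ hj]
      refine integral_eq_zero_of_ae (Filter.Eventually.of_forall fun x => ?_)
      have := integral_reTr_eval_mul_eq_zero (hZ.integrable_entry i) (hZ.integral_entry i)
        fun η => (interpErase Z₀ Z H u c i x + u • Z i (η 1)) ^ a * (Z i (η 0) *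
          (interpErase Z₀ Z H u c i x + u • Z i (η 1)) ^ b)
      simpa only [mul_assoc, Fin.succ_zero_eq_one, Fin.succ_one_eq_two, Pi.zero_apply] using this
    · exact integral_undef hj

end Summands

/-! ### The Gaussian model -/

section GaussianModel

variable {Ω Ω' : Type*} [MeasurableSpace Ω] [MeasurableSpace Ω'] {d n : ℕ} {μ : Measure Ω}
  {ν : Measure Ω'} [IsProbabilityMeasure μ] [IsProbabilityMeasure ν] {Z₀ : Mat d}
  {Z : Fin n → Ω → Mat d} {G : Ω' → Mat d}

lemma IsSummands.expect_model (hZ : IsSummands μ Z) : expect μ (model Z₀ Z) = Z₀ := by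
  ext a b
  simp only [expect, model, Matrix.of_apply, Matrix.add_apply, Matrix.sum_apply]
  rw [integral_add (integrable_const _) (integrable_finsetSum _ fun i _ =>
    hZ.integrable_entry i a b), integral_finsetSum _ fun i _ => hZ.integrable_entry i a b]
  simp [hZ.integral_entry]

lemma IsSummands.integrable_mul_entry (hZ : IsSummands μ Z) (i j : Fin n) (a b a' b' : Fin d) :
    Integrable (fun x => Z i x a b * Z j x a' b') μ :=
  (hZ.memLp i a b).integrable_mul (hZ.memLp j a' b')

/-- Different summands are uncorrelated. -/
lemma IsSummands.integral_mul_entry_of_ne (hZ : IsSummands μ Z) {i j : Fin n} (hij : i ≠ j)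
    (a b a' b' : Fin d) : ∫ x, Z i x a b * Z j x a' b' ∂μ = 0 := by
  have h := (hZ.indep.indepFun hij).comp (measurable_pi_apply (a, b))
    (measurable_pi_apply (a', b'))
  have e := h.integral_fun_mul_eq_mul_integral (hZ.measurable i a b).aestronglyMeasurable
    (hZ.measurable j a' b').aestronglyMeasurable
  refine e.trans ?_
  have := hZ.integral_entry i a b
  change (∫ x, Z i x a b ∂μ) * _ = 0
  rw [this, zero_mul]

lemma IsSummands.integral_sum_mul_sum_entry (hZ : IsSummands μ Z) (a b a' b' : Fin d) :
    ∫ x, (∑ i, Z i x a b) * ∑ i, Z i x a' b' ∂μ = ∑ i, ∫ x, Z i x a b * Z i x a' b' ∂μ := by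
  simp only [Finset.sum_mul_sum]
  rw [integral_finsetSum _ fun i _ => integrable_finsetSum _ fun j _ =>
    hZ.integrable_mul_entry i j _ _ _ _]
  refine Finset.sum_congr rfl fun i _ => ?_
  rw [integral_finsetSum _ fun j _ => hZ.integrable_mul_entry i j _ _ _ _,
    Finset.sum_eq_single i (fun j _ hj => hZ.integral_mul_entry_of_ne hj.symm _ _ _ _) (by simp)]

lemma IsSummands.matVar_model (hZ : IsSummands μ Z) (a b : Fin d) :
    matVar μ (model Z₀ Z) a b = ∑ i, ∫ x, (Z i x ^ 2) a b ∂μ := by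
  simp only [matVar, hZ.expect_model]
  simp only [expect, model, Matrix.of_apply, add_sub_cancel_left, sq, Matrix.mul_apply,
    Matrix.sum_apply]
  have hi : ∀ c, Integrable (fun x => (∑ i, Z i x a c) * ∑ i, Z i x c b) μ := by
    intro c
    simp only [Finset.sum_mul_sum]
    exact integrable_finsetSum _ fun i _ => integrable_finsetSum _ fun j _ =>
      hZ.integrable_mul_entry i j _ _ _ _
  rw [integral_finsetSum _ fun c _ => hi c]
  simp only [hZ.integral_sum_mul_sum_entry]
  rw [Finset.sum_comm]
  refine Finset.sum_congr rfl fun i _ => ?_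
  rw [integral_finsetSum _ fun c _ => hZ.integrable_mul_entry i i _ _ _ _]

/-- The matrix whose entries have the given real and imaginary parts, as a real linear map. -/
noncomputable def ofRealEntries : ((Fin d × Fin d) ⊕ (Fin d × Fin d) → ℝ) →ₗ[ℝ] Mat d where
  toFun e := Matrix.of fun i j => (e (.inl (i, j)) : ℂ) + e (.inr (i, j)) * Complex.I
  map_add' e f := by
    ext i j
    simp only [Pi.add_apply, Matrix.of_apply, Matrix.add_apply, Complex.ofReal_add]
    ring
  map_smul' c e := by
    ext i j
    simp only [Pi.smul_apply, smul_eq_mul, Complex.ofReal_mul, Matrix.of_apply, RingHom.id_apply,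
      Matrix.smul_apply, Complex.real_smul]
    ring

lemma measurable_ofRealEntries (i j : Fin d) : Measurable fun e => ofRealEntries (d := d) e i j := by
  have : ∀ s, Measurable fun e : (Fin d × Fin d) ⊕ (Fin d × Fin d) → ℝ => (e s : ℂ) := fun s =>
    Complex.measurable_ofReal.comp (measurable_pi_apply s)
  exact (this _).add ((this _).mul_const _)

/-- The real and imaginary parts of the entries of a matrix. -/
def realEntries (M : Mat d) : (Fin d × Fin d) ⊕ (Fin d × Fin d) → ℝ :=
  Sum.elim (fun a => (M a.1 a.2).re) (fun a => (M a.1 a.2).im)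

lemma ofRealEntries_realEntries (M : Mat d) : ofRealEntries (realEntries M) = M := by
  ext i j
  simp [ofRealEntries, realEntries]

namespace IsGaussianModel

lemma hasGaussianLaw_sub (hG : IsGaussianModel μ (model Z₀ Z) ν G) (A : Mat d) :
    HasGaussianLaw (fun x => realEntries (G x - A)) ν := by
  have h : HasGaussianLaw (fun x => realEntries (G x)) ν := hG.gaussian
  have hg := h.isGaussian_map
  have e : (fun x => realEntries (G x - A)) = (fun y => y - realEntries A) ∘
      fun x => realEntries (G x) := by
    funext x s
    cases s <;> simp [realEntries]
  refine ⟨?_⟩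
  rw [e, ← AEMeasurable.map_map_of_aemeasurable (by fun_prop) h.aemeasurable]
  infer_instance

lemma memLp_sub (hG : IsGaussianModel μ (model Z₀ Z) ν G) (A : Mat d) {q : ℝ≥0∞} (hq : q ≠ ∞)
    (a b : Fin d) : MemLp (fun x => (G x - A) a b) q ν := by
  have h := (hG.hasGaussianLaw_sub A).memLp hq
  have h1 : MemLp (fun x => ((G x - A) a b).re) q ν := memLp_pi_iff.mp h (.inl (a, b))
  have h2 : MemLp (fun x => ((G x - A) a b).im) q ν := memLp_pi_iff.mp h (.inr (a, b))
  have := h1.ofReal (K := ℂ) |>.add ((h2.ofReal (K := ℂ)).mul_const Complex.I)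
  refine this.ae_eq (Filter.Eventually.of_forall fun x => ?_)
  exact Complex.re_add_im _

lemma measurable_sub (hG : IsGaussianModel μ (model Z₀ Z) ν G) (A : Mat d) (a b : Fin d) :
    Measurable fun x => (G x - A) a b :=
  (hG.measurable a b).sub_const _

lemma integral_sub_entry (hZ : IsSummands μ Z) (hG : IsGaussianModel μ (model Z₀ Z) ν G)
    (a b : Fin d) : ∫ x, (G x - Z₀) a b ∂ν = 0 := by
  have hi : Integrable (fun x => G x a b) ν := by
    simpa using (hG.memLp_sub 0 (q := 1) (by simp) a b).integrable le_rfl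
  have := congrFun (congrFun hG.mean_eq a) b
  rw [hZ.expect_model] at this
  simp only [Matrix.sub_apply]
  rw [integral_sub hi (integrable_const _)]
  simpa [sub_eq_zero, expect] using this

/-- The mixed second moments of the entries of the centered Gaussian model. -/
lemma integral_mul_entry (hZ : IsSummands μ Z) (hG : IsGaussianModel μ (model Z₀ Z) ν G)
    (a b a' b' : Fin d) : ∫ x, (G x - Z₀) a b * (G x - Z₀) a' b' ∂ν =
      ∑ i, ∫ x, Z i x a b * Z i x a' b' ∂μ := by
  have h := congrFun (congrFun hG.cov_eq (a, b)) (b', a')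
  simp only [cov, hG.mean_eq, hZ.expect_model, Matrix.of_apply] at h
  have hZ₀ : Z₀.IsHermitian := by
    rw [← hZ.expect_model (Z₀ := Z₀), ← hG.mean_eq]
    ext i j
    simp only [Matrix.conjTranspose_apply, expect, Matrix.of_apply]
    rw [Complex.star_def, ← integral_conj]
    congr 1
    funext x
    exact congrFun (congrFun (hG.isHermitian x) i) j
  have e1 : ∀ x, star ((G x - Z₀) b' a') = (G x - Z₀) a' b' := fun x =>
    congrFun (congrFun ((hG.isHermitian x).sub hZ₀) a') b'
  have e2 : ∀ x, star ((model Z₀ Z x - Z₀) b' a') = ∑ i, Z i x a' b' := by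
    intro x
    simp only [model, add_sub_cancel_left, Matrix.sum_apply, star_sum]
    exact Finset.sum_congr rfl fun i _ => congrFun (congrFun (hZ.isHermitian i x) a') b'
  simp only [e1, e2] at h
  rw [h, ← hZ.integral_sum_mul_sum_entry]
  simp only [model, add_sub_cancel_left, Matrix.sum_apply]

end IsGaussianModel

lemma reTr_mul_mul_mul_eq (W P Q : Mat d) : reTr (W * P * W * Q) =
    (∑ i, ∑ l, ∑ k, ∑ j, W i j * W k l * (P j k * Q l i)).re := by
  rw [reTr, Matrix.trace]
  congr 1
  refine Finset.sum_congr rfl fun i _ => ?_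
  simp only [Matrix.diag_apply, Matrix.mul_apply, Finset.sum_mul]
  refine Finset.sum_congr rfl fun l _ => Finset.sum_congr rfl fun k _ =>
    Finset.sum_congr rfl fun j _ => ?_
  ring

lemma integral_reTr_mul_mul_mul {μ : Measure Ω} {W : Ω → Mat d}
    (hW : ∀ a b a' b', Integrable (fun x => W x a b * W x a' b') μ) (P Q : Mat d) :
    ∫ x, reTr (W x * P * W x * Q) ∂μ =
      (∑ i, ∑ l, ∑ k, ∑ j, (∫ x, W x i j * W x k l ∂μ) * (P j k * Q l i)).re := by
  simp only [reTr_mul_mul_mul_eq]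
  have h4 : ∀ i l k, Integrable (fun x => ∑ j, W x i j * W x k l * (P j k * Q l i)) μ :=
    fun i l k => integrable_finsetSum _ fun j _ => (hW i j k l).mul_const _
  have h3 : ∀ i l, Integrable (fun x => ∑ k, ∑ j, W x i j * W x k l * (P j k * Q l i)) μ :=
    fun i l => integrable_finsetSum _ fun k _ => h4 i l k
  have h2 : ∀ i, Integrable (fun x => ∑ l, ∑ k, ∑ j, W x i j * W x k l * (P j k * Q l i)) μ :=
    fun i => integrable_finsetSum _ fun l _ => h3 i l
  have h1 : Integrable (fun x => ∑ i, ∑ l, ∑ k, ∑ j, W x i j * W x k l * (P j k * Q l i)) μ :=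
    integrable_finsetSum _ fun i _ => h2 i
  have hre := integral_re h1
  refine hre.trans ?_
  change Complex.re _ = _
  congr 1
  rw [integral_finsetSum _ fun i _ => h2 i]
  refine Finset.sum_congr rfl fun i _ => ?_
  rw [integral_finsetSum _ fun l _ => h3 i l]
  refine Finset.sum_congr rfl fun l _ => ?_
  rw [integral_finsetSum _ fun k _ => h4 i l k]
  refine Finset.sum_congr rfl fun k _ => ?_
  rw [integral_finsetSum _ fun j _ => (hW i j k l).mul_const _]
  exact Finset.sum_congr rfl fun j _ => integral_mul_const _ _

/-- The Gaussian model and the sum of the independent copies have the same second order terms. -/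
lemma IsGaussianModel.integral_second_order (hZ : IsSummands μ Z)
    (hG : IsGaussianModel μ (model Z₀ Z) ν G) (P Q : Mat d) :
    ∫ x, reTr ((G x - Z₀) * P * (G x - Z₀) * Q) ∂ν =
      ∑ i, ∫ x, reTr (Z i x * P * Z i x * Q) ∂μ := by
  rw [integral_reTr_mul_mul_mul (fun a b a' b' => (hG.memLp_sub Z₀ (q := 2) (by simp) a
    b).integrable_mul (hG.memLp_sub Z₀ (q := 2) (by simp) a' b'))]
  rw [Finset.sum_congr rfl fun i _ => integral_reTr_mul_mul_mul
    (hZ.integrable_mul_entry i i) P Q, ← Complex.re_sum]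
  simp only [hG.integral_mul_entry hZ, Finset.sum_mul]
  congr 1
  symm
  rw [Finset.sum_comm]
  refine Finset.sum_congr rfl fun i _ => ?_
  rw [Finset.sum_comm]
  refine Finset.sum_congr rfl fun l _ => ?_
  rw [Finset.sum_comm]
  refine Finset.sum_congr rfl fun k _ => ?_
  rw [Finset.sum_comm]

end GaussianModel

/-! ### The derivative along the interpolation -/

section Interpolation

variable {Ω Ω' : Type*} [MeasurableSpace Ω] [MeasurableSpace Ω'] {d n : ℕ}

/-- A scalar function that dominates all matrices in the interpolation. -/
noncomputable def interpDom (Z : Fin n → Ω → Mat d) (H : Ω' → Mat d) (x : Ω × Ω') : ℝ :=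
  dominator Z x.1 + dominator (fun _ : Unit => H) x.2

lemma one_le_interpDom (Z : Fin n → Ω → Mat d) (H : Ω' → Mat d) (x : Ω × Ω') :
    1 ≤ interpDom Z H x := by
  have h1 : 1 ≤ dominator Z x.1 := one_le_dominator _
  have h2 : 1 ≤ dominator (fun _ : Unit => H) x.2 := one_le_dominator _
  rw [interpDom]
  linarith

lemma isDom_interpDom_fst {Z : Fin n → Ω → Mat d} {H : Ω' → Mat d}
    (hZ : ∀ i a b, Measurable fun x => Z i x a b) (i : Fin n) :
    IsDom (interpDom Z H) 1 (fun x : Ω × Ω' => Z i x.1) :=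
  (isDom_dominator hZ i).comp one_le_dominator measurable_fst fun x => by
    have h2 : 1 ≤ dominator (fun _ : Unit => H) x.2 := one_le_dominator _
    rw [interpDom]
    linarith

lemma isDom_interpDom_snd {Z : Fin n → Ω → Mat d} {H : Ω' → Mat d}
    (hH : ∀ a b, Measurable fun x => H x a b) :
    IsDom (interpDom Z H) 1 (fun x : Ω × Ω' => H x.2) :=
  (isDom_dominator (W := fun _ : Unit => H) (fun _ => hH) ()).comp one_le_dominator
    measurable_snd fun x => by
    have h2 : 1 ≤ dominator Z x.1 := one_le_dominator _
    rw [interpDom]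
    linarith

lemma isDom_interp {Z₀ : Mat d} {Z : Fin n → Ω → Mat d} {H : Ω' → Mat d}
    (hZ : ∀ i a b, Measurable fun x => Z i x a b) (hH : ∀ a b, Measurable fun x => H x a b)
    (u c : ℝ) : IsDom (interpDom Z H) 1 (interp Z₀ Z H u c) :=
  ((IsDom.const (one_le_interpDom Z H) Z₀).add ((IsDom.sum (one_le_interpDom Z H) _
    fun j _ => isDom_interpDom_fst hZ j).const_smul u)).add ((isDom_interpDom_snd hH).const_smul c)

variable {μ : Measure Ω} {ν : Measure Ω'} [IsProbabilityMeasure μ] [IsProbabilityMeasure ν]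
  {Z₀ : Mat d} {Z : Fin n → Ω → Mat d} {H G : Ω' → Mat d} {u c : ℝ} {p : ℕ}

lemma memLp_interpDom (hZp : ∀ i a b, MemLp (fun x => Z i x a b) (2 * p : ℕ) μ)
    (hHp : ∀ a b, MemLp (fun x => H x a b) (2 * p : ℕ) ν) :
    MemLp (interpDom Z H) (2 * p : ℕ) (μ.prod ν) := by
  have m1 : MemLp (dominator Z) (2 * p : ℕ) μ := memLp_dominator hZp
  have m2 : MemLp (dominator fun _ : Unit => H) (2 * p : ℕ) ν := memLp_dominator fun _ => hHp
  exact (m1.comp_fst ν).add (m2.comp_snd μ)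

lemma integrable_pow_of_memLp {g : Ω → ℝ} (hg : ∀ x, 1 ≤ g x) {m : ℕ} (h : MemLp g m μ) :
    Integrable (fun x => g x ^ m) μ :=
  h.integrable_norm_pow'.congr (Filter.Eventually.of_forall fun x => by
    have := hg x
    change ‖g x‖ ^ m = _
    rw [Real.norm_of_nonneg (by linarith)])

/-- Fubini's theorem for words with two letters from an independent matrix. -/
lemma integrable_word_prod {g : Ω → ℝ} (hg : ∀ x, 1 ≤ g x) (hgp : MemLp g (2 * p : ℕ) μ)
    {X : Ω → Mat d} (hX : IsDom g 1 X) {W : Ω' → Mat d} (hW : ∀ a b, Measurable fun x => W x a b)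
    (hWp : ∀ a b, MemLp (fun x => W x a b) (2 * p : ℕ) ν) {a b : ℕ} (hab : a + b + 2 = 2 * p) :
    Integrable (fun x : Ω × Ω' => reTr (W x.2 * X x.1 ^ a * W x.2 * X x.1 ^ b)) (μ.prod ν) := by
  have m2 : MemLp (dominator fun _ : Unit => W) (2 * p : ℕ) ν := memLp_dominator fun _ => hWp
  have h1 : ∀ x, 1 ≤ dominator (fun _ : Unit => W) x := one_le_dominator
  have hg' : ∀ x : Ω × Ω', 1 ≤ g x.1 + dominator (fun _ : Unit => W) x.2 := fun x => by
    linarith [hg x.1, h1 x.2]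
  have dX : IsDom (fun x : Ω × Ω' => g x.1 + dominator (fun _ : Unit => W) x.2) 1
      (fun x => X x.1) := hX.comp hg measurable_fst fun x => by linarith [h1 x.2]
  have dW : IsDom (fun x : Ω × Ω' => g x.1 + dominator (fun _ : Unit => W) x.2) 1
      (fun x => W x.2) := (isDom_dominator (W := fun _ : Unit => W) (fun _ => hW) ()).comp h1
        measurable_snd fun x => by linarith [hg x.1]
  exact (((dW.mul (dX.pow hg' a)).mul dW).mul (dX.pow hg' b)).integrable hg'
    (integrable_pow_of_memLp hg' ((hgp.comp_fst ν).add (m2.comp_snd μ))) (by omega)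

lemma integral_reTr_const_mul {W : Ω → Mat d} (hW : ∀ a b, Integrable (fun x => W x a b) μ)
    (M : Mat d) : ∫ x, reTr (M * W x) ∂μ = reTr (M * expect μ W) := by
  have e : ∀ A : Mat d, reTr (M * A) = (∑ i, ∑ j, M i j * A j i).re := by
    intro A
    simp [reTr, Matrix.trace, Matrix.mul_apply]
  simp only [e]
  have hj : ∀ i j, Integrable (fun x => M i j * W x j i) μ := fun i j =>
    (hW j i).const_mul (M i j)
  have hint : Integrable (fun y => ∑ i, ∑ j, M i j * W y j i) μ :=
    integrable_finsetSum _ fun i _ => integrable_finsetSum _ fun j _ => hj i j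
  have hre : ∫ y, (∑ i, ∑ j, M i j * W y j i).re ∂μ =
      (∫ y, ∑ i, ∑ j, M i j * W y j i ∂μ).re := integral_re hint
  rw [hre, integral_finsetSum _ fun i _ => integrable_finsetSum _ fun j _ => hj i j]
  congr 1
  refine Finset.sum_congr rfl fun i _ => ?_
  rw [integral_finsetSum _ fun j _ => hj i j]
  exact Finset.sum_congr rfl fun j _ => integral_const_mul _ _

lemma IsSummands.integrable_sq_entry (hZ : IsSummands μ Z) (i : Fin n) (a b : Fin d) :
    Integrable (fun x => (Z i x ^ 2) a b) μ := by
  simp only [sq, Matrix.mul_apply]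
  exact integrable_finsetSum _ fun c _ => hZ.integrable_mul_entry i i _ _ _ _

lemma IsSummands.matVar_model_eq_sum (hZ : IsSummands μ Z) :
    matVar μ (model Z₀ Z) = ∑ i, expect μ (fun x => Z i x ^ 2) := by
  ext a b
  rw [hZ.matVar_model, Matrix.sum_apply]
  rfl

lemma IsSummands.sum_integral_reTr_mul_sq (hZ : IsSummands μ Z) (M : Mat d) :
    ∑ i, ∫ x, reTr (M * Z i x ^ 2) ∂μ = reTr (M * matVar μ (model Z₀ Z)) := by
  rw [hZ.matVar_model_eq_sum, Finset.mul_sum, reTr_sum]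
  exact Finset.sum_congr rfl fun i _ => integral_reTr_const_mul (hZ.integrable_sq_entry i) M

lemma IsSummands.isHermitian_matVar (hZ : IsSummands μ Z) :
    (matVar μ (model Z₀ Z)).IsHermitian := by
  ext a b
  simp only [hZ.matVar_model, Matrix.conjTranspose_apply, star_sum]
  refine Finset.sum_congr rfl fun i _ => ?_
  rw [Complex.star_def, ← integral_conj]
  congr 1
  funext x
  exact congrFun (congrFun ((hZ.isHermitian i x).pow 2) a) b

open scoped ComplexOrder in
lemma IsSummands.eigenvalues_matVar_nonneg (hZ : IsSummands μ Z) (k : Fin d) :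
    0 ≤ (hZ.isHermitian_matVar (Z₀ := Z₀)).eigenvalues k := by
  set hV := hZ.isHermitian_matVar (Z₀ := Z₀)
  set v := (hV.eigenvectorBasis k).ofLp
  have e : ∀ A : Mat d, reTr (Matrix.vecMulVec v (star v) * A) =
      RCLike.re (star v ⬝ᵥ A.mulVec v) := by
    intro A
    rw [reTr_mul_comm, Matrix.mul_vecMulVec, reTr, Matrix.trace_vecMulVec, dotProduct_comm]
    rfl
  rw [hV.eigenvalues_eq, ← e, ← hZ.sum_integral_reTr_mul_sq]
  refine Finset.sum_nonneg fun i _ => integral_nonneg fun x => ?_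
  have h := Matrix.posSemidef_conjTranspose_mul_self (Z i x)
  rw [(hZ.isHermitian i x).eq, ← sq] at h
  change 0 ≤ reTr _
  rw [e]
  exact h.re_dotProduct_nonneg v

/-- The Gaussian integration by parts formula for the interpolation. -/
lemma IsGaussianModel.integral_mul_interp_pow_eq (hZ : IsSummands μ Z)
    (hZp : ∀ i a b, MemLp (fun x => Z i x a b) (2 * p : ℕ) μ)
    (hG : IsGaussianModel μ (model Z₀ Z) ν G) (hp : 1 ≤ p) (hHG : ∀ x, H x = G x - Z₀) :
    ∫ x, reTr (H x.2 * interp Z₀ Z H u c x ^ (2 * p - 1)) ∂(μ.prod ν) =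
      c * ∑ a ∈ Finset.range (2 * p - 1), ∫ x, reTr (H x.2 * interp Z₀ Z H u c x.1 ^ a * H x.2 *
        interp Z₀ Z H u c x.1 ^ (2 * p - 1 - 1 - a)) ∂((μ.prod ν).prod ν) := by
  have hHm : ∀ a b, Measurable fun x => H x a b := by
    simpa only [hHG] using hG.measurable_sub Z₀
  have hHp : ∀ {q : ℝ≥0∞}, q ≠ ∞ → ∀ a b, MemLp (fun x => H x a b) q ν := fun hq a b => by
    simpa only [hHG] using hG.memLp_sub Z₀ hq a b
  have hH0 : ∀ a b, ∫ x, H x a b ∂ν = 0 := fun a b => by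
    simpa only [hHG] using hG.integral_sub_entry hZ a b
  have hHl : HasGaussianLaw (fun x => realEntries (H x)) ν := by
    simpa only [hHG] using hG.hasGaussianLaw_sub Z₀
  have hX := isDom_interp (Z₀ := Z₀) hZ.measurable hHm u c
  have hgp := memLp_interpDom hZp (hHp (ENNReal.natCast_ne_top _))
  have hg := one_le_interpDom Z H
  have h1 : ∀ x, 1 ≤ dominator (fun _ : Unit => H) x := one_le_dominator
  set g : Ω × (Ω' × Ω') → ℝ := fun x =>
    interpDom Z H (x.1, x.2.1) + dominator (fun _ : Unit => H) x.2.2 with hgdef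
  have hg' : ∀ x, 1 ≤ g x := fun x => by
    have := hg (x.1, x.2.1)
    have := h1 x.2.2
    simp only [hgdef]
    linarith
  have m0 : Measurable (Prod.fst : Ω × (Ω' × Ω') → Ω) := measurable_fst
  have m1 : Measurable fun x : Ω × (Ω' × Ω') => (x.1, x.2.1) := by fun_prop
  have m2 : Measurable fun x : Ω × (Ω' × Ω') => x.2.2 := by fun_prop
  have m3 : MeasurePreserving (fun x : Ω × (Ω' × Ω') => (x.1, x.2.1)) (μ.prod (ν.prod ν))
      (μ.prod ν) := (MeasurePreserving.id μ).prod measurePreserving_fst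
  have hm : MemLp g (2 * p - 1 + 1 : ℕ) (μ.prod (ν.prod ν)) := by
    rw [show 2 * p - 1 + 1 = 2 * p by omega]
    have m4 : MemLp (dominator fun _ : Unit => H) (2 * p : ℕ) ν :=
      memLp_dominator fun _ => hHp (ENNReal.natCast_ne_top _)
    exact (hgp.comp_measurePreserving m3).add ((m4.comp_snd ν).comp_snd μ)
  have hA : IsDom (dominator Z) 1 (fun x => Z₀ + u • ∑ i, Z i x) :=
    (IsDom.const one_le_dominator Z₀).add
      ((IsDom.sum one_le_dominator _ fun j _ => isDom_dominator hZ.measurable j).const_smul u)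
  have dA : IsDom g 1 (fun x : Ω × (Ω' × Ω') => Z₀ + u • ∑ i, Z i x.1) :=
    hA.comp one_le_dominator m0 fun x => by
      have h2 : 1 ≤ dominator (fun _ : Unit => H) x.2.1 := one_le_dominator _
      have := h1 x.2.2
      simp only [hgdef, interpDom]
      linarith
  have hid : ∀ x, ofRealEntries (realEntries (H x)) = H x := fun x => ofRealEntries_realEntries _
  have d1 : IsDom g 1 (fun x : Ω × (Ω' × Ω') => ofRealEntries (realEntries (H x.2.1))) := by
    simp only [hid]
    exact (isDom_interpDom_snd (Z := Z) hHm).comp hg m1 fun x => by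
      have := h1 x.2.2
      simp only [hgdef]
      linarith
  have d2 : IsDom g 1 (fun x : Ω × (Ω' × Ω') => ofRealEntries (realEntries (H x.2.2))) := by
    simp only [hid]
    exact (isDom_dominator (W := fun _ : Unit => H) (fun _ => hHm) ()).comp h1 m2 fun x => by
      have := hg (x.1, x.2.1)
      simp only [hgdef]
      linarith
  have hξ0 : ∫ x, realEntries (H x) ∂ν = 0 := by
    have hi : ∀ s, Integrable (fun x => realEntries (H x) s) ν := fun s =>
      (memLp_pi_iff.mp (hHl.memLp (p := 1) (by simp)) s).integrable le_rfl
    have hH1 : ∀ a b, Integrable (fun x => H x a b) ν := fun a b =>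
      (hHp (q := 1) (by simp) a b).integrable le_rfl
    funext s
    rw [eval_integral hi]
    cases s with
    | inl s =>
      refine (integral_re (hH1 s.1 s.2)).trans ?_
      rw [hH0]
      simp
    | inr s =>
      refine (integral_im (hH1 s.1 s.2)).trans ?_
      rw [hH0]
      simp
  have hξm : Measurable fun x => realEntries (H x) := by
    refine measurable_pi_lambda _ fun s => ?_
    cases s with
    | inl s => exact Complex.measurable_re.comp (hHm s.1 s.2)
    | inr s => exact Complex.measurable_im.comp (hHm s.1 s.2)
  have key := integral_gaussian_mul_pow (μ := μ) hHl hξ0 hξm ofRealEntries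
    measurable_ofRealEntries (A := fun x => Z₀ + u • ∑ i, Z i x) hg'
    (integrable_pow_of_memLp hg' hm) hA.1 dA d1 d2 c
  simp only [hid] at key
  have e1 := m3.integral_comp_of_measurable
    ((isDom_interpDom_snd (Z := Z) hHm).mul (hX.pow hg (2 * p - 1))).measurable_reTr
  have e2 := fun a => (measurePreserving_prodAssoc μ ν ν).integral_comp'
    fun x => reTr (H x.2.2 * interp Z₀ Z H u c (x.1, x.2.1) ^ a * H x.2.2 *
      interp Z₀ Z H u c (x.1, x.2.1) ^ (2 * p - 1 - 1 - a))
  rw [← e1]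
  refine key.trans ?_
  congr 1
  exact Finset.sum_congr rfl fun a _ => (e2 a).symm

/-- Integration by parts for the Gaussian part of the interpolation, with the second order term
expressed by the summands. -/
lemma IsGaussianModel.integral_mul_interp_pow (hZ : IsSummands μ Z)
    (hZp : ∀ i a b, MemLp (fun x => Z i x a b) (2 * p : ℕ) μ)
    (hG : IsGaussianModel μ (model Z₀ Z) ν G) (hp : 1 ≤ p) (hHG : ∀ x, H x = G x - Z₀) :
    ∫ x, reTr (H x.2 * interp Z₀ Z H u c x ^ (2 * p - 1)) ∂(μ.prod ν) =
      c * ∑ a ∈ Finset.range (2 * p - 1), ∑ i, ∫ x, reTr (Z i x.2 * interp Z₀ Z H u c x.1 ^ a *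
        Z i x.2 * interp Z₀ Z H u c x.1 ^ (2 * p - 2 - a)) ∂((μ.prod ν).prod μ) := by
  have hHm : ∀ a b, Measurable fun x => H x a b := by
    simpa only [hHG] using hG.measurable_sub Z₀
  have hHp : ∀ a b, MemLp (fun x => H x a b) (2 * p : ℕ) ν := fun a b => by
    simpa only [hHG] using hG.memLp_sub Z₀ (ENNReal.natCast_ne_top _) a b
  have hX := isDom_interp (Z₀ := Z₀) hZ.measurable hHm u c
  have hgp := memLp_interpDom hZp hHp
  have hg := one_le_interpDom Z H
  rw [hG.integral_mul_interp_pow_eq hZ hZp hp hHG]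
  congr 1
  refine Finset.sum_congr rfl fun a ha => ?_
  have ha' := Finset.mem_range.mp ha
  rw [show 2 * p - 1 - 1 - a = 2 * p - 2 - a by omega]
  have i1 := integrable_word_prod (ν := ν) hg hgp hX hHm hHp (a := a) (b := 2 * p - 2 - a)
    (by omega)
  have i2 := fun i => integrable_word_prod (ν := μ) hg hgp hX (hZ.measurable i) (hZp i) (a := a)
    (b := 2 * p - 2 - a) (by omega)
  rw [integral_prod _ i1, Finset.sum_congr rfl fun i _ => integral_prod _ (i2 i),
    ← integral_finsetSum _ fun i _ => (i2 i).integral_prod_left]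
  refine integral_congr_ae (Filter.Eventually.of_forall fun x => ?_)
  have := hG.integral_second_order hZ (interp Z₀ Z H u c x ^ a)
    (interp Z₀ Z H u c x ^ (2 * p - 2 - a))
  simp only [← hHG] at this
  exact this

/-- The variance term in the integration by parts formula. -/
lemma sum_integral_pow_mul_sq_le (hZ₀ : Z₀.IsHermitian) (hZ : IsSummands μ Z)
    (hZp : ∀ i a b, MemLp (fun x => Z i x a b) (2 * p : ℕ) μ) (hHh : ∀ x, (H x).IsHermitian)
    (hH : ∀ i j, Measurable fun x => H x i j)
    (hHp : ∀ a b, MemLp (fun x => H x a b) (2 * p : ℕ) ν) (hp : 1 ≤ p) {N s : ℝ} (hN : 0 < N)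
    (hs : 0 < s) (hXN : ∫ x, reTr (interp Z₀ Z H u c x ^ (2 * p)) ∂(μ.prod ν) ≤ d * N ^ (2 * p))
    (hVs : reTr (matVar μ (model Z₀ Z) ^ p) ≤ d * s ^ (2 * p)) :
    ∑ i, ∫ x, reTr (interp Z₀ Z H u c x.1 ^ (2 * p - 2) * Z i x.2 ^ 2) ∂((μ.prod ν).prod μ) ≤
      d * s ^ 2 * N ^ (2 * p - 2) := by
  set V := matVar μ (model Z₀ Z) with hV
  have hVh : V.IsHermitian := hZ.isHermitian_matVar
  have hX := isDom_interp (Z₀ := Z₀) hZ.measurable hH u c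
  have hgp := memLp_interpDom hZp hHp
  have hg := one_le_interpDom Z H
  have hK := integrable_pow_of_memLp hg hgp
  have hXh : ∀ x, (interp Z₀ Z H u c x).IsHermitian := fun x => by
    simp only [Matrix.IsHermitian, interp, Matrix.conjTranspose_add,
      Matrix.conjTranspose_smul, star_trivial, Matrix.conjTranspose_sum, hZ₀.eq, (hHh _).eq,
      (hZ.isHermitian _ _).eq]
  have i2 : ∀ i, Integrable (fun x : (Ω × Ω') × Ω =>
      reTr (interp Z₀ Z H u c x.1 ^ (2 * p - 2) * Z i x.2 ^ 2)) ((μ.prod ν).prod μ) := fun i =>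
    (integrable_word_prod (ν := μ) hg hgp hX (hZ.measurable i) (hZp i) (a := 0)
      (b := 2 * p - 2) (by omega)).congr (Filter.Eventually.of_forall fun x => by
        change reTr _ = reTr _
        rw [reTr_mul_comm, pow_zero, mul_one, sq])
  have e : ∑ i, ∫ x, reTr (interp Z₀ Z H u c x.1 ^ (2 * p - 2) * Z i x.2 ^ 2)
      ∂((μ.prod ν).prod μ) = ∫ x, reTr (interp Z₀ Z H u c x ^ (2 * p - 2) * V) ∂(μ.prod ν) := by
    rw [Finset.sum_congr rfl fun i _ => integral_prod _ (i2 i),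
      ← integral_finsetSum _ fun i _ => (i2 i).integral_prod_left]
    refine integral_congr_ae (Filter.Eventually.of_forall fun x => ?_)
    exact hZ.sum_integral_reTr_mul_sq (Z₀ := Z₀) (interp Z₀ Z H u c x ^ (2 * p - 2))
  have i3 : Integrable (fun x => reTr (interp Z₀ Z H u c x ^ (2 * p - 2) * V)) (μ.prod ν) :=
    ((hX.pow hg (2 * p - 2)).mul (IsDom.const (k := 0) hg V)).integrable hg hK (by omega)
  have i4 : Integrable (fun x => reTr (interp Z₀ Z H u c x ^ (2 * p))) (μ.prod ν) :=
    (hX.pow hg (2 * p)).integrable hg hK le_rfl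
  rw [e]
  have hp' : (0 : ℝ) < p := by exact_mod_cast hp
  have hp1 : (1 : ℝ) / p ≤ 1 := by
    rw [div_le_one hp']
    exact_mod_cast hp
  calc ∫ x, reTr (interp Z₀ Z H u c x ^ (2 * p - 2) * V) ∂(μ.prod ν)
      ≤ ∫ x, s ^ 2 * N ^ (2 * p - 2) * (1 / p * (reTr (V ^ p) / s ^ (2 * p)) + (1 - 1 / p) *
          (reTr (interp Z₀ Z H u c x ^ (2 * p)) / N ^ (2 * p))) ∂(μ.prod ν) :=
        integral_mono i3 (((integrable_const _).add ((i4.div_const _).const_mul _)).const_mul _)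
          fun x => reTr_pow_mul_le (hXh x) hVh (fun k => hZ.eigenvalues_matVar_nonneg k) hp hN hs
    _ = s ^ 2 * N ^ (2 * p - 2) * (1 / p * (reTr (V ^ p) / s ^ (2 * p)) + (1 - 1 / p) *
          ((∫ x, reTr (interp Z₀ Z H u c x ^ (2 * p)) ∂(μ.prod ν)) / N ^ (2 * p))) := by
        rw [integral_const_mul, integral_add (integrable_const _)
          ((i4.div_const _).const_mul _), integral_const, integral_const_mul, integral_div]
        simp
    _ ≤ s ^ 2 * N ^ (2 * p - 2) * (1 / p * d + (1 - 1 / p) * d) := by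
        have h1 : reTr (V ^ p) / s ^ (2 * p) ≤ d := by
          rw [div_le_iff₀ (by positivity)]
          exact hVs
        have h2 : (∫ x, reTr (interp Z₀ Z H u c x ^ (2 * p)) ∂(μ.prod ν)) / N ^ (2 * p) ≤ d := by
          rw [div_le_iff₀ (by positivity)]
          exact hXN
        have h3 : (0 : ℝ) ≤ 1 - 1 / p := by linarith
        gcongr
    _ = _ := by ring

/-- The derivative of `E Tr X(θ)^{2p}` along the interpolation, up to the factor `2p`. -/
lemma abs_integral_deriv_interp_le (hZ₀ : Z₀.IsHermitian) (hZ : IsSummands μ Z)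
    (hZp : ∀ i a b, MemLp (fun x => Z i x a b) (2 * p : ℕ) μ)
    (hG : IsGaussianModel μ (model Z₀ Z) ν G) (hHG : ∀ x, H x = G x - Z₀) (hp : 1 ≤ p)
    (hu : |u| ≤ 1) (hc : |c| ≤ 1)
    {N r s : ℝ} (hN : 0 < N) (hr : 0 < r) (hs : 0 < s) (hNr : 16 * p * r ≤ N)
    (hXN : ∫ x, reTr (interp Z₀ Z H u c x ^ (2 * p)) ∂(μ.prod ν) ≤ d * N ^ (2 * p))
    (hVs : reTr (matVar μ (model Z₀ Z) ^ p) ≤ d * s ^ (2 * p))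
    (hZr : ∑ i, ∫ x, reTr (Z i x ^ (2 * p)) ∂μ ≤ d * s ^ 2 * r ^ (2 * p - 2)) :
    |∫ x, reTr ((c • ∑ i, Z i x.1 - u • H x.2) *
      interp Z₀ Z H u c x ^ (2 * p - 1)) ∂(μ.prod ν)| ≤
      64 * p ^ 2 * (d * s ^ 2) * r * (N ^ (2 * p - 2) / N) := by
  have hHm : ∀ a b, Measurable fun x => H x a b := by
    simpa only [hHG] using hG.measurable_sub Z₀
  have hHp : ∀ a b, MemLp (fun x => H x a b) (2 * p : ℕ) ν := fun a b => by
    simpa only [hHG] using hG.memLp_sub Z₀ (ENNReal.natCast_ne_top _) a b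
  have hHh : ∀ x, (H x).IsHermitian := fun x => hHG x ▸ (hG.isHermitian x).sub hZ₀
  have hX := isDom_interp (Z₀ := Z₀) hZ.measurable hHm u c
  have hg := one_le_interpDom Z H
  have hK := integrable_pow_of_memLp hg (memLp_interpDom hZp hHp)
  have hV := sum_integral_pow_mul_sq_le hZ₀ hZ hZp hHh hHm hHp hp hN hs hXN hVs
  have main := abs_sum_integral_sub_le hZ₀ hZ hZp hHh hHm hHp hp (by positivity) hN hr hu hNr hV hZr
  have hibp := hG.integral_mul_interp_pow (u := u) (c := c) hZ hZp hp hHG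
  have i1 : ∀ i, Integrable (fun x : Ω × Ω' =>
      reTr (Z i x.1 * interp Z₀ Z H u c x ^ (2 * p - 1))) (μ.prod ν) := fun i =>
    ((isDom_interpDom_fst hZ.measurable i).mul (hX.pow hg _)).integrable hg hK (by omega)
  have i2 : Integrable (fun x : Ω × Ω' =>
      reTr (H x.2 * interp Z₀ Z H u c x ^ (2 * p - 1))) (μ.prod ν) :=
    ((isDom_interpDom_snd hHm).mul (hX.pow hg _)).integrable hg hK (by omega)
  have e1 : ∀ i, ∫ x : (Ω × Ω') × Ω, reTr (Z i x.1.1 * interp Z₀ Z H u c x.1 ^ (2 * p - 1))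
      ∂((μ.prod ν).prod μ) = ∫ x, reTr (Z i x.1 * interp Z₀ Z H u c x ^ (2 * p - 1)) ∂(μ.prod ν) :=
    fun i => by
      rw [integral_fun_fst (fun x : Ω × Ω' =>
        reTr (Z i x.1 * interp Z₀ Z H u c x ^ (2 * p - 1)))]
      simp
  have e2 : ∀ x : Ω × Ω', reTr ((c • ∑ i, Z i x.1 - u • H x.2) *
      interp Z₀ Z H u c x ^ (2 * p - 1)) =
      c * (∑ i, reTr (Z i x.1 * interp Z₀ Z H u c x ^ (2 * p - 1))) -
      u * reTr (H x.2 * interp Z₀ Z H u c x ^ (2 * p - 1)) := by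
    intro x
    rw [sub_mul, smul_mul_assoc, smul_mul_assoc, reTr_sub, reTr_smul, reTr_smul, Finset.sum_mul,
      reTr_sum]
  have e3 : ∫ x : Ω × Ω', reTr ((c • ∑ i, Z i x.1 - u • H x.2) *
      interp Z₀ Z H u c x ^ (2 * p - 1)) ∂(μ.prod ν) =
      c * (∑ i, ∫ x, reTr (Z i x.1 * interp Z₀ Z H u c x ^ (2 * p - 1)) ∂(μ.prod ν)) -
      u * ∫ x : Ω × Ω', reTr (H x.2 * interp Z₀ Z H u c x ^ (2 * p - 1)) ∂(μ.prod ν) := by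
    simp only [e2]
    rw [integral_sub ((integrable_finsetSum _ fun i _ => i1 i).const_mul c) (i2.const_mul u),
      integral_const_mul, integral_const_mul, integral_finsetSum _ fun i _ => i1 i]
  rw [Finset.sum_congr rfl fun i _ => e1 i] at main
  rw [e3, hibp, mul_left_comm u c, ← mul_sub, abs_mul]
  exact (mul_le_of_le_one_left (abs_nonneg _) hc).trans main

/-- The derivative of `E Tr X(θ)^{2p}` for `X(θ) = Z₀ + sin θ ∑ Z_i + cos θ (G - Z₀)`. -/
lemma hasDerivAt_integral_interp (hZ : IsSummands μ Z)
    (hZp : ∀ i a b, MemLp (fun x => Z i x a b) (2 * p : ℕ) μ)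
    (hG : IsGaussianModel μ (model Z₀ Z) ν G) (hHG : ∀ x, H x = G x - Z₀) (t : ℝ) :
    HasDerivAt (fun t => ∫ x, reTr (interp Z₀ Z H (Real.sin t) (Real.cos t) x ^ (2 * p))
        ∂(μ.prod ν))
      ((2 * p : ℕ) * ∫ x, reTr ((Real.cos t • ∑ i, Z i x.1 - Real.sin t • H x.2) *
        interp Z₀ Z H (Real.sin t) (Real.cos t) x ^ (2 * p - 1)) ∂(μ.prod ν)) t := by
  have hHm : ∀ a b, Measurable fun x => H x a b := by
    simpa only [hHG] using hG.measurable_sub Z₀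
  have hHp : ∀ a b, MemLp (fun x => H x a b) (2 * p : ℕ) ν := fun a b => by
    simpa only [hHG] using hG.memLp_sub Z₀ (ENNReal.natCast_ne_top _) a b
  have hg := one_le_interpDom Z H
  exact IsDomCurve.hasDerivAt_integral_pow hg
    (integrable_pow_of_memLp hg (memLp_interpDom hZp hHp))
    (IsDomCurve.trig (IsDom.const hg Z₀) (IsDom.sum hg _ fun j _ =>
      isDom_interpDom_fst hZ.measurable j) (isDom_interpDom_snd hHm)) le_rfl t

end Interpolation

/-! ### The differential inequality -/

/-- The cube of `N = (φ / D + K ^ (2p)) ^ (1 / (2p))` is Lipschitz when the derivative of `φ`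
is at most of the order `N ^ (2p - 3)`. -/
lemma abs_cube_sub_cube_le {φ φ' N : ℝ → ℝ} {D K L : ℝ} {p : ℕ} (hp : 1 ≤ p) (hD : 0 < D)
    (hK : 0 < K) (hφ : ∀ t, 0 ≤ φ t) (hd : ∀ t, HasDerivAt φ (φ' t) t)
    (hN : ∀ t, N t = (φ t / D + K ^ (2 * p)) ^ ((1 : ℝ) / (2 * p)))
    (hL : ∀ t, |φ' t| ≤ 2 * p * D * L * (N t ^ (2 * p - 2) / N t)) (t₀ t₁ : ℝ) :
    |N t₁ ^ 3 - N t₀ ^ 3| ≤ 3 * L * |t₁ - t₀| := by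
  set y : ℝ → ℝ := fun t => φ t / D + K ^ (2 * p) with hy
  have hp' : (0 : ℝ) < p := by exact_mod_cast hp
  have hy0 : ∀ t, 0 < y t := fun t => by
    have := div_nonneg (hφ t) hD.le
    have := pow_pos hK (2 * p)
    simp only [hy]
    linarith
  have hN0 : ∀ t, 0 < N t := fun t => by
    rw [hN]
    exact Real.rpow_pos_of_pos (hy0 t) _
  have hNy : ∀ t, N t ^ (2 * p) = y t := fun t => by
    rw [hN, ← Real.rpow_natCast, ← Real.rpow_mul (hy0 t).le]
    push_cast
    rw [one_div, inv_mul_cancel₀ (by positivity), Real.rpow_one]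
  have hN3 : ∀ t, N t ^ 3 = y t ^ ((3 : ℝ) / (2 * p)) := fun t => by
    rw [hN, ← Real.rpow_natCast, ← Real.rpow_mul (hy0 t).le]
    congr 1
    push_cast
    ring
  have hder : ∀ t, HasDerivAt (fun t => N t ^ 3)
      (φ' t / D * (3 / (2 * p)) * y t ^ ((3 : ℝ) / (2 * p) - 1)) t := fun t => by
    simp only [hN3]
    exact (((hd t).div_const D).add_const _).rpow_const (Or.inl (hy0 t).ne')
  have hbound : ∀ t, ‖φ' t / D * (3 / (2 * p)) * y t ^ ((3 : ℝ) / (2 * p) - 1)‖ ≤ 3 * L := by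
    intro t
    have e : y t ^ ((3 : ℝ) / (2 * p) - 1) = N t ^ 3 / N t ^ (2 * p) := by
      rw [Real.rpow_sub (hy0 t), Real.rpow_one, ← hN3, hNy]
    have e2 : N t ^ (2 * p) = N t ^ (2 * p - 2) * N t ^ 2 := by
      rw [← pow_add]
      congr 1
      omega
    have h0 := hN0 t
    rw [e, e2, norm_mul, norm_mul, Real.norm_eq_abs, Real.norm_of_nonneg (by positivity),
      Real.norm_of_nonneg (by positivity), abs_div, abs_of_pos hD]
    calc |φ' t| / D * (3 / (2 * p)) * (N t ^ 3 / (N t ^ (2 * p - 2) * N t ^ 2))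
        ≤ (2 * p * D * L * (N t ^ (2 * p - 2) / N t)) / D * (3 / (2 * p)) *
          (N t ^ 3 / (N t ^ (2 * p - 2) * N t ^ 2)) := by
          gcongr
          exact hL t
      _ = 3 * L := by field_simp
  have := Convex.norm_image_sub_le_of_norm_hasDerivWithin_le (s := Set.univ)
    (fun t _ => (hder t).hasDerivWithinAt) (fun t _ => hbound t) convex_univ
    (Set.mem_univ t₀) (Set.mem_univ t₁)
  simpa only [Real.norm_eq_abs] using this

lemma abs_sub_cube_le {a b : ℝ} (ha : 0 ≤ a) (hb : 0 ≤ b) : |a - b| ^ 3 ≤ |a ^ 3 - b ^ 3| := by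
  wlog h : b ≤ a generalizing a b
  · rw [abs_sub_comm, abs_sub_comm (a ^ 3)]
    exact this hb ha (le_of_not_ge h)
  rw [abs_of_nonneg (sub_nonneg.mpr h), abs_of_nonneg (sub_nonneg.mpr (by gcongr))]
  have := mul_nonneg (mul_nonneg ha hb) (sub_nonneg.mpr h)
  nlinarith

/-- Adding `K ^ (2p)` under the root changes it by at most `K`. -/
lemma rpow_add_pow_sub_mem {x K : ℝ} {p : ℕ} (hp : 1 ≤ p) (hx : 0 ≤ x) (hK : 0 ≤ K) :
    x ^ ((1 : ℝ) / (2 * p)) ≤ (x + K ^ (2 * p)) ^ ((1 : ℝ) / (2 * p)) ∧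
      (x + K ^ (2 * p)) ^ ((1 : ℝ) / (2 * p)) ≤ x ^ ((1 : ℝ) / (2 * p)) + K := by
  have hp' : (0 : ℝ) < p := by exact_mod_cast hp
  have hK2 : 0 ≤ K ^ (2 * p) := by positivity
  refine ⟨Real.rpow_le_rpow hx (by linarith) (by positivity), ?_⟩
  have h := Real.rpow_add_le_add_rpow hx hK2 (p := (1 : ℝ) / (2 * p)) (by positivity) (by
    rw [div_le_one (by positivity)]
    have : (1 : ℝ) ≤ p := by exact_mod_cast hp
    linarith)
  refine h.trans (le_of_eq ?_)
  congr 1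
  rw [← Real.rpow_natCast, ← Real.rpow_mul hK]
  push_cast
  rw [mul_one_div_cancel (by positivity), Real.rpow_one]

section MomentBound

variable {Ω Ω' : Type*} [MeasurableSpace Ω] [MeasurableSpace Ω'] {d n : ℕ} {μ : Measure Ω}
  {ν : Measure Ω'} [IsProbabilityMeasure μ] [IsProbabilityMeasure ν] {Z₀ : Mat d}
  {Z : Fin n → Ω → Mat d} {G : Ω' → Mat d} {p : ℕ}

lemma IsSummands.isHermitian_model (hZ : IsSummands μ Z) (hZ₀ : Z₀.IsHermitian) (x : Ω) :
    (model Z₀ Z x).IsHermitian := by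
  simp only [Matrix.IsHermitian, model, Matrix.conjTranspose_add, Matrix.conjTranspose_sum,
    hZ₀.eq, (hZ.isHermitian _ _).eq]

/-- Comparison of the moments, in terms of a bound `s` for the variance and a bound `r` for the
summands. -/
lemma abs_moment_sub_le (hd : 0 < d) (hZ₀ : Z₀.IsHermitian) (hZ : IsSummands μ Z)
    (hZp : ∀ i a b, MemLp (fun x => Z i x a b) (2 * p : ℕ) μ)
    (hG : IsGaussianModel μ (model Z₀ Z) ν G) (hp : 1 ≤ p) {r s : ℝ} (hr : 0 < r) (hs : 0 < s)
    (hVs : reTr (matVar μ (model Z₀ Z) ^ p) ≤ d * s ^ (2 * p))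
    (hZr : ∑ i, ∫ x, reTr (Z i x ^ (2 * p)) ∂μ ≤ d * s ^ 2 * r ^ (2 * p - 2)) :
    |((∫ x, reTr (model Z₀ Z x ^ (2 * p)) ∂μ) / d) ^ ((1 : ℝ) / (2 * p)) -
      ((∫ x, reTr (G x ^ (2 * p)) ∂ν) / d) ^ ((1 : ℝ) / (2 * p))| ≤
      8 * (p ^ 2 * s ^ 2 * r) ^ ((1 : ℝ) / 3) + 16 * p * r := by
  set H : Ω' → Mat d := fun x => G x - Z₀ with hH
  set φ : ℝ → ℝ := fun t =>
    ∫ x, reTr (interp Z₀ Z H (Real.sin t) (Real.cos t) x ^ (2 * p)) ∂(μ.prod ν) with hφ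
  have hp' : (0 : ℝ) < p := by exact_mod_cast hp
  have hd' : (0 : ℝ) < d := by exact_mod_cast hd
  have hHh : ∀ x, (H x).IsHermitian := fun x => (hG.isHermitian x).sub hZ₀
  have hφ0 : ∀ t, 0 ≤ φ t := fun t => integral_nonneg fun x => reTr_pow_two_mul_nonneg (by
    simp only [Matrix.IsHermitian, interp, Matrix.conjTranspose_add,
      Matrix.conjTranspose_smul, star_trivial, Matrix.conjTranspose_sum, hZ₀.eq, (hHh _).eq,
      (hZ.isHermitian _ _).eq]) p
  set K : ℝ := 16 * p * r with hK
  have hK0 : 0 < K := by positivity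
  set N : ℝ → ℝ := fun t => (φ t / d + K ^ (2 * p)) ^ ((1 : ℝ) / (2 * p)) with hN
  have hroot := fun t => rpow_add_pow_sub_mem hp (div_nonneg (hφ0 t) hd'.le) hK0.le
  have hNK : ∀ t, K ≤ N t := fun t => by
    have h : K = (K ^ (2 * p)) ^ ((1 : ℝ) / (2 * p)) := by
      rw [← Real.rpow_natCast, ← Real.rpow_mul hK0.le]
      push_cast
      rw [mul_one_div_cancel (by positivity), Real.rpow_one]
    rw [h]
    refine Real.rpow_le_rpow (by positivity) ?_ (by positivity)
    have := div_nonneg (hφ0 t) hd'.le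
    linarith
  have hNφ : ∀ t, φ t ≤ d * N t ^ (2 * p) := fun t => by
    have h0 : 0 ≤ φ t / d + K ^ (2 * p) := by
      have := div_nonneg (hφ0 t) hd'.le
      positivity
    have h : N t ^ (2 * p) = φ t / d + K ^ (2 * p) := by
      simp only [hN]
      rw [← Real.rpow_natCast, ← Real.rpow_mul h0]
      push_cast
      rw [one_div, inv_mul_cancel₀ (by positivity), Real.rpow_one]
    rw [h, mul_add, mul_div_cancel₀ _ hd'.ne']
    have : 0 ≤ d * K ^ (2 * p) := by positivity
    linarith
  have key := abs_cube_sub_cube_le (φ := φ) (N := N) (L := 64 * p ^ 2 * s ^ 2 * r) hp hd' hK0 hφ0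
    (fun t => hasDerivAt_integral_interp hZ hZp hG (fun _ => rfl) t) (fun _ => rfl) (fun t => by
      have h := abs_integral_deriv_interp_le (u := Real.sin t) (c := Real.cos t) (H := H) hZ₀ hZ
        hZp hG (fun _ => rfl) hp (Real.abs_sin_le_one t) (Real.abs_cos_le_one t)
        (hK0.trans_le (hNK t)) hr hs (hNK t) (hNφ t) hVs hZr
      rw [abs_mul, Nat.abs_cast]
      refine (mul_le_mul_of_nonneg_left h (by positivity)).trans (le_of_eq ?_)
      push_cast
      ring) 0 (Real.pi / 2)
  -- the end points of the interpolation
  have hφ1 : φ (Real.pi / 2) = ∫ x, reTr (model Z₀ Z x ^ (2 * p)) ∂μ := by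
    simp only [hφ, interp, Real.sin_pi_div_two, Real.cos_pi_div_two, one_smul, zero_smul, add_zero]
    rw [integral_fun_fst (fun x => reTr ((Z₀ + ∑ i, Z i x) ^ (2 * p)))]
    simp [model]
  have hφG : φ 0 = ∫ x, reTr (G x ^ (2 * p)) ∂ν := by
    simp only [hφ, interp, Real.sin_zero, Real.cos_zero, one_smul, zero_smul, add_zero, hH,
      add_sub_cancel]
    rw [integral_fun_snd (fun x => reTr (G x ^ (2 * p)))]
    simp
  rw [← hφ1, ← hφG]
  have hQ : 0 ≤ p ^ 2 * s ^ 2 * r := by positivity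
  have hcube : |N (Real.pi / 2) - N 0| ≤ 8 * (p ^ 2 * s ^ 2 * r) ^ ((1 : ℝ) / 3) := by
    refine le_of_pow_le_pow_left₀ three_ne_zero (by positivity) ?_
    refine (abs_sub_cube_le (hK0.le.trans (hNK _)) (hK0.le.trans (hNK _))).trans (key.trans ?_)
    have e : ((p ^ 2 * s ^ 2 * r) ^ ((1 : ℝ) / 3)) ^ 3 = p ^ 2 * s ^ 2 * r := by
      rw [← Real.rpow_natCast, ← Real.rpow_mul hQ]
      norm_num
    rw [mul_pow, e, sub_zero, abs_of_pos Real.pi_div_two_pos]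
    have := Real.pi_le_four
    nlinarith
  have h0 := hroot 0
  have h1 := hroot (Real.pi / 2)
  have hc := abs_le.mp hcube
  rw [abs_le]
  simp only [hN] at hc
  constructor <;> linarith [h0.1, h0.2, h1.1, h1.2, hc.1, hc.2]

end MomentBound

/-! ### The matrix parameters -/

section Parameters

variable {Ω Ω' : Type*} [MeasurableSpace Ω] [MeasurableSpace Ω'] {d n : ℕ} {μ : Measure Ω}
  {ν : Measure Ω'} [IsProbabilityMeasure μ] [IsProbabilityMeasure ν] {Z₀ : Mat d}
  {Z : Fin n → Ω → Mat d} {G : Ω' → Mat d} {p : ℕ} {q : ℝ≥0∞}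

lemma re_ntr (M : Mat d) : (ntr M).re = reTr M / d := by
  rw [ntr, Complex.div_natCast_re, reTr]

lemma re_ntr_absRpow {A : Mat d} (hA : A.IsHermitian) (s : ℝ) :
    (ntr (absRpow A s)).re = (∑ k, |hA.eigenvalues k| ^ s) / d := by
  rw [re_ntr, absRpow, reTr_cfc hA]

lemma abs_eigenvalue_le_specNorm {A : Mat d} (hA : A.IsHermitian) (k : Fin d) :
    |hA.eigenvalues k| ≤ specNorm A := by
  have h := (Matrix.toEuclideanCLM (𝕜 := ℂ) A).le_opNorm (hA.eigenvectorBasis k)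
  have e : Matrix.toEuclideanCLM (𝕜 := ℂ) A (hA.eigenvectorBasis k) =
      (hA.eigenvalues k : ℂ) • hA.eigenvectorBasis k := by
    have := hA.mulVec_eigenvectorBasis k
    ext i
    exact congrFun this i
  rw [e, norm_smul, hA.eigenvectorBasis.orthonormal.1 k, mul_one, mul_one,
    Complex.norm_real] at h
  exact h

/-- Interpolation between the powers `2` and `q`, at the scale `r`. -/
lemma pow_le_sq_add_rpow {x r t : ℝ} (hr : 0 < r) (hp : 1 ≤ p) (ht : (2 * p : ℕ) ≤ t) :
    x ^ (2 * p) ≤ r ^ (2 * p - 2) * (x ^ 2 + r ^ 2 / r ^ t * |x| ^ t) := by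
  have e : ∀ y : ℝ, y ^ (2 * p) = y ^ (2 * p - 2) * y ^ 2 := fun y => by
    rw [← pow_add]
    congr 1
    omega
  have hx : x ^ (2 * p) = |x| ^ (2 * p) := by rw [pow_mul, pow_mul, sq_abs]
  have hr2 : 0 ≤ r ^ (2 * p - 2) := by positivity
  rw [mul_add]
  rcases le_total |x| r with h | h
  · have h1 : x ^ (2 * p) ≤ r ^ (2 * p - 2) * x ^ 2 := by
      rw [hx, e, sq_abs]
      gcongr
    have h2 : 0 ≤ r ^ (2 * p - 2) * (r ^ 2 / r ^ t * |x| ^ t) := by positivity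
    linarith
  · have h1 : 1 ≤ |x| / r := (one_le_div hr).mpr h
    have h2 : (|x| / r) ^ (2 * p) ≤ |x| ^ t / r ^ t := by
      rw [← Real.div_rpow (abs_nonneg x) hr.le, ← Real.rpow_natCast]
      exact Real.rpow_le_rpow_of_exponent_le h1 ht
    have h3 : x ^ (2 * p) ≤ r ^ (2 * p - 2) * (r ^ 2 / r ^ t * |x| ^ t) := by
      calc x ^ (2 * p) = r ^ (2 * p) * (|x| / r) ^ (2 * p) := by
            rw [hx, div_pow, mul_div_cancel₀ _ (by positivity)]
        _ ≤ r ^ (2 * p) * (|x| ^ t / r ^ t) := by gcongr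
        _ = _ := by rw [e]; ring
    have h4 : 0 ≤ r ^ (2 * p - 2) * x ^ 2 := by positivity
    linarith

lemma toReal_exponent_ge {m : ℕ} (hq : (m : ℝ≥0∞) ≤ q) (hq' : q ≠ ∞) : (m : ℝ) ≤ q.toReal := by
  simpa using ENNReal.toReal_mono hq' hq

/-- The powers of the variance are controlled by `σ_q`. -/
lemma reTr_matVar_pow_le (hZ : IsSummands μ Z) {τ : ℝ} (hτ : 0 < τ)
    (hσ : sigmaQ μ (model Z₀ Z) q < ENNReal.ofReal τ) (hp : 1 ≤ p)
    (hq : ((2 * p : ℕ) : ℝ≥0∞) ≤ q) :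
    reTr (matVar μ (model Z₀ Z) ^ p) ≤ 2 * d * τ ^ (2 * p) := by
  set V := matVar μ (model Z₀ Z) with hV
  have hVh : V.IsHermitian := hZ.isHermitian_matVar
  have hV0 : ∀ k, 0 ≤ hVh.eigenvalues k := fun k => hZ.eigenvalues_matVar_nonneg k
  rw [reTr_pow_eq_sum hVh]
  by_cases hq' : q = ∞
  · rw [sigmaQ, if_pos hq'] at hσ
    have h1 : specNorm V ≤ τ ^ 2 := by
      have h := ENNReal.rpow_lt_rpow hσ (z := 2) (by norm_num)
      rw [← ENNReal.rpow_mul, one_div, inv_mul_cancel₀ two_ne_zero, ENNReal.rpow_one,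
        ENNReal.ofReal_rpow_of_nonneg hτ.le (by norm_num), Real.rpow_two] at h
      exact ((ENNReal.ofReal_lt_ofReal_iff (by positivity)).mp h).le
    have h2 : ∀ k, hVh.eigenvalues k ^ p ≤ τ ^ (2 * p) := fun k => by
      rw [pow_mul]
      exact pow_le_pow_left₀ (hV0 k)
        ((le_abs_self _).trans ((abs_eigenvalue_le_specNorm hVh k).trans h1)) p
    refine (Finset.sum_le_card_nsmul _ _ _ fun k _ => h2 k).trans ?_
    rw [Finset.card_univ, Fintype.card_fin, nsmul_eq_mul]
    have : 0 ≤ (d : ℝ) * τ ^ (2 * p) := by positivity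
    linarith
  · rw [sigmaQ, if_neg hq'] at hσ
    set t := q.toReal with ht
    have hpt : ((2 * p : ℕ) : ℝ) ≤ t := toReal_exponent_ge hq hq'
    have hpt' : (p : ℝ) ≤ t / 2 := by
      push_cast at hpt
      linarith
    have hp' : (1 : ℝ) ≤ p := by exact_mod_cast hp
    have ht0 : 0 < t := by linarith
    have h1 : (∑ k, |hVh.eigenvalues k| ^ (t / 2)) / d ≤ τ ^ t := by
      have h := ENNReal.rpow_lt_rpow hσ ht0
      rw [← ENNReal.rpow_mul, one_div, inv_mul_cancel₀ ht0.ne', ENNReal.rpow_one,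
        ENNReal.ofReal_rpow_of_nonneg hτ.le ht0.le, re_ntr_absRpow hVh] at h
      exact ((ENNReal.ofReal_lt_ofReal_iff (by positivity)).mp h).le
    have h2 : ∀ k, hVh.eigenvalues k ^ p ≤
        τ ^ (2 * p) * (1 + |hVh.eigenvalues k| ^ (t / 2) / τ ^ t) := fun k => by
      set l := hVh.eigenvalues k with hl
      have hl0 : 0 ≤ l := hV0 k
      have e : |l| ^ (t / 2) / τ ^ t = (l / τ ^ 2) ^ (t / 2) := by
        rw [abs_of_nonneg hl0, Real.div_rpow hl0 (by positivity), ← Real.rpow_two,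
          ← Real.rpow_mul hτ.le]
        congr 2
        ring
      have h3 : (l / τ ^ 2) ^ p ≤ 1 + (l / τ ^ 2) ^ (t / 2) := by
        have h0 : 0 ≤ l / τ ^ 2 := by positivity
        rcases le_total (l / τ ^ 2) 1 with h | h
        · have := pow_le_one₀ (n := p) h0 h
          have := Real.rpow_nonneg h0 (t / 2)
          linarith
        · rw [← Real.rpow_natCast]
          have := Real.rpow_le_rpow_of_exponent_le h hpt'
          linarith
      calc l ^ p = τ ^ (2 * p) * (l / τ ^ 2) ^ p := by
            rw [div_pow, ← pow_mul, mul_div_cancel₀ _ (by positivity)]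
        _ ≤ _ := by
            rw [e]
            gcongr
    rcases Nat.eq_zero_or_pos d with hd0 | hd0
    · subst hd0
      simp
    have hd' : (0 : ℝ) < d := by exact_mod_cast hd0
    rw [div_le_iff₀ hd'] at h1
    calc ∑ k, hVh.eigenvalues k ^ p
        ≤ ∑ k, τ ^ (2 * p) * (1 + |hVh.eigenvalues k| ^ (t / 2) / τ ^ t) :=
          Finset.sum_le_sum fun k _ => h2 k
      _ = τ ^ (2 * p) * (d + (∑ k, |hVh.eigenvalues k| ^ (t / 2)) / τ ^ t) := by
          rw [← Finset.mul_sum, Finset.sum_add_distrib, Finset.sum_div]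
          simp
      _ ≤ τ ^ (2 * p) * (d + (τ ^ t * d) / τ ^ t) := by gcongr
      _ = _ := by
          rw [mul_div_cancel_left₀ _ (by positivity)]
          ring

/-- The moments of the summands are controlled by `R_q`. -/
lemma sum_lintegral_pow_le (hZ : IsSummands μ Z) {r : ℝ} (hr : 0 < r)
    (hR : RQ μ Z q < ENNReal.ofReal r) (hp : 1 ≤ p) (hq : ((2 * p : ℕ) : ℝ≥0∞) ≤ q) :
    ∑ i, ∫⁻ x, ENNReal.ofReal (reTr (Z i x ^ (2 * p))) ∂μ ≤
      ENNReal.ofReal (r ^ (2 * p - 2) * (reTr (matVar μ (model Z₀ Z)) + d * r ^ 2)) := by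
  have hr2 : 0 ≤ r ^ (2 * p - 2) := by positivity
  have hnn : ∀ i x, 0 ≤ reTr (Z i x ^ 2) := fun i x => by
    simpa using reTr_pow_two_mul_nonneg (hZ.isHermitian i x) 1
  have hm2 : ∀ i, Measurable fun x => ENNReal.ofReal (reTr (Z i x ^ 2)) := fun i =>
    ENNReal.measurable_ofReal.comp
      (measurable_reTr_of_entries (measurable_pow_entries (hZ.measurable i) 2))
  have hi2 : ∀ i, Integrable (fun x => reTr (Z i x ^ 2)) μ := fun i => by
    have h := hZ.integrable_sq_entry i
    simp only [reTr, Matrix.trace, Complex.re_sum, Matrix.diag_apply]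
    exact integrable_finsetSum _ fun a _ => (h a a).re
  have hV : ∑ i, ∫⁻ x, ENNReal.ofReal (reTr (Z i x ^ 2)) ∂μ =
      ENNReal.ofReal (reTr (matVar μ (model Z₀ Z))) := by
    have h := hZ.sum_integral_reTr_mul_sq (Z₀ := Z₀) 1
    simp only [one_mul] at h
    rw [← h, ENNReal.ofReal_sum_of_nonneg fun i _ => integral_nonneg (hnn i)]
    exact Finset.sum_congr rfl fun i _ => (ofReal_integral_eq_lintegral_ofReal (hi2 i)
      (Filter.Eventually.of_forall (hnn i))).symm
  have hV0 : 0 ≤ reTr (matVar μ (model Z₀ Z)) := by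
    have h := hZ.sum_integral_reTr_mul_sq (Z₀ := Z₀) 1
    simp only [one_mul] at h
    rw [← h]
    exact Finset.sum_nonneg fun i _ => integral_nonneg (hnn i)
  -- the two kinds of exponents only differ in the error term `L`
  obtain ⟨L, hL, hLr⟩ : ∃ L : Fin n → Ω → ℝ≥0∞,
      (∀ i, ∀ᵐ x ∂μ, ENNReal.ofReal (reTr (Z i x ^ (2 * p))) ≤ ENNReal.ofReal (r ^ (2 * p - 2)) *
        (ENNReal.ofReal (reTr (Z i x ^ 2)) + L i x)) ∧
      ∑ i, ∫⁻ x, L i x ∂μ ≤ ENNReal.ofReal (d * r ^ 2) := by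
    by_cases hq' : q = ∞
    · rw [RQ, if_pos hq'] at hR
      refine ⟨fun _ _ => 0, fun i => ?_, by simp⟩
      filter_upwards [ae_lt_of_essSup_lt hR] with x hx
      have h1 : specNorm (Z i x) ≤ r := by
        have := (le_iSup (fun i => ENNReal.ofReal (specNorm (Z i x))) i).trans hx.le
        exact (ENNReal.ofReal_le_ofReal_iff hr.le).mp this
      rw [add_zero, ← ENNReal.ofReal_mul hr2]
      refine ENNReal.ofReal_le_ofReal ?_
      have hh := hZ.isHermitian i x
      rw [reTr_pow_eq_sum hh, reTr_pow_eq_sum hh, Finset.mul_sum]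
      refine Finset.sum_le_sum fun k _ => ?_
      have h2 := (abs_eigenvalue_le_specNorm hh k).trans h1
      rw [show 2 * p = (2 * p - 2) + 2 by omega, pow_add, Nat.add_sub_cancel]
      refine mul_le_mul_of_nonneg_right ?_ (sq_nonneg _)
      calc hh.eigenvalues k ^ (2 * p - 2) ≤ |hh.eigenvalues k ^ (2 * p - 2)| := le_abs_self _
        _ = |hh.eigenvalues k| ^ (2 * p - 2) := abs_pow _ _
        _ ≤ _ := by gcongr
    · rw [RQ, if_neg hq'] at hR
      set t := q.toReal with ht
      have hpt : ((2 * p : ℕ) : ℝ) ≤ t := toReal_exponent_ge hq hq'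
      have hp' : (1 : ℝ) ≤ p := by exact_mod_cast hp
      have ht0 : 0 < t := by
        push_cast at hpt
        linarith
      have h1 : ∑ i, ∫⁻ x, ENNReal.ofReal (ntr (absRpow (Z i x) t)).re ∂μ ≤
          ENNReal.ofReal (r ^ t) := by
        have h := ENNReal.rpow_lt_rpow hR ht0
        rw [← ENNReal.rpow_mul, one_div, inv_mul_cancel₀ ht0.ne', ENNReal.rpow_one,
          ENNReal.ofReal_rpow_of_nonneg hr.le ht0.le] at h
        exact h.le
      have hc : 0 ≤ d * (r ^ 2 / r ^ t) := by positivity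
      refine ⟨fun i x => ENNReal.ofReal (d * (r ^ 2 / r ^ t)) *
        ENNReal.ofReal (ntr (absRpow (Z i x) t)).re, fun i => Filter.Eventually.of_forall
          fun x => ?_, ?_⟩
      · rcases Nat.eq_zero_or_pos d with hd0 | hd0
        · subst hd0
          simp [reTr, Matrix.trace]
        have hd' : (d : ℝ) ≠ 0 := by exact_mod_cast hd0.ne'
        have hh := hZ.isHermitian i x
        beta_reduce
        rw [← ENNReal.ofReal_mul hc, re_ntr_absRpow hh, ← ENNReal.ofReal_add (hnn i x)
          (by positivity), ← ENNReal.ofReal_mul hr2]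
        refine ENNReal.ofReal_le_ofReal ?_
        have e : d * (r ^ 2 / r ^ t) * ((∑ k, |hh.eigenvalues k| ^ t) / d) =
            ∑ k, r ^ 2 / r ^ t * |hh.eigenvalues k| ^ t := by
          rw [← Finset.mul_sum]
          field_simp
        rw [e, reTr_pow_eq_sum hh, reTr_pow_eq_sum hh, ← Finset.sum_add_distrib, Finset.mul_sum]
        exact Finset.sum_le_sum fun k _ => pow_le_sq_add_rpow hr hp hpt
      · simp only [lintegral_const_mul' _ _ ENNReal.ofReal_ne_top]
        rw [← Finset.mul_sum]
        refine (mul_le_mul_right h1 _).trans (le_of_eq ?_)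
        rw [← ENNReal.ofReal_mul hc]
        congr 1
        have : r ^ t ≠ 0 := (Real.rpow_pos_of_pos hr t).ne'
        field_simp
  calc ∑ i, ∫⁻ x, ENNReal.ofReal (reTr (Z i x ^ (2 * p))) ∂μ
      ≤ ∑ i, ∫⁻ x, ENNReal.ofReal (r ^ (2 * p - 2)) *
        (ENNReal.ofReal (reTr (Z i x ^ 2)) + L i x) ∂μ :=
        Finset.sum_le_sum fun i _ => lintegral_mono_ae (hL i)
    _ = ENNReal.ofReal (r ^ (2 * p - 2)) * (∑ i, ∫⁻ x, ENNReal.ofReal (reTr (Z i x ^ 2)) ∂μ +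
        ∑ i, ∫⁻ x, L i x ∂μ) := by
        simp only [lintegral_const_mul' _ _ ENNReal.ofReal_ne_top, lintegral_add_left (hm2 _)]
        rw [← Finset.mul_sum, Finset.sum_add_distrib]
    _ ≤ ENNReal.ofReal (r ^ (2 * p - 2)) * (ENNReal.ofReal (reTr (matVar μ (model Z₀ Z))) +
        ENNReal.ofReal (d * r ^ 2)) := by
        rw [hV]
        gcongr
    _ = _ := by rw [← ENNReal.ofReal_add hV0 (by positivity), ← ENNReal.ofReal_mul hr2]

/-- The entries of a Hermitian random matrix have the moments of its trace. -/
lemma memLp_entry_of_lintegral {W : Ω → Mat d} (hW : ∀ a b, Measurable fun x => W x a b)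
    (hWh : ∀ x, (W x).IsHermitian) (hp : 1 ≤ p)
    (hfin : ∫⁻ x, ENNReal.ofReal (reTr (W x ^ (2 * p))) ∂μ ≠ ∞) (a b : Fin d) :
    MemLp (fun x => W x a b) (2 * p : ℕ) μ := by
  have hm : Measurable fun x => reTr (W x ^ (2 * p)) :=
    measurable_reTr_of_entries (measurable_pow_entries hW _)
  have hi : Integrable (fun x => reTr (W x ^ (2 * p))) μ :=
    (lintegral_ofReal_ne_top_iff_integrable hm.aestronglyMeasurable
      (Filter.Eventually.of_forall fun x => reTr_pow_two_mul_nonneg (hWh x) p)).mp hfin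
  rw [← integrable_norm_rpow_iff (hW a b).aestronglyMeasurable
    (by exact_mod_cast (by omega : 2 * p ≠ 0)) (ENNReal.natCast_ne_top _)]
  refine (hi.const_mul ((Fintype.card (Fin d) : ℝ) ^ (p - 1))).mono'
    ((hW a b).norm.pow_const _).aestronglyMeasurable (Filter.Eventually.of_forall fun x => ?_)
  rw [ENNReal.toReal_natCast, Real.rpow_natCast, Real.norm_of_nonneg (by positivity)]
  exact (pow_le_pow_left₀ (norm_nonneg _) (norm_entry_le_norm _ a b) _).trans
    (norm_pow_le_reTr (hWh x) hp)

lemma memLp_summands (hZ : IsSummands μ Z) {r : ℝ} (hr : 0 < r)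
    (hR : RQ μ Z q < ENNReal.ofReal r) (hp : 1 ≤ p) (hq : ((2 * p : ℕ) : ℝ≥0∞) ≤ q) (i : Fin n)
    (a b : Fin d) : MemLp (fun x => Z i x a b) (2 * p : ℕ) μ := by
  refine memLp_entry_of_lintegral (hZ.measurable i) (hZ.isHermitian i) hp (ne_top_of_le_ne_top
    ENNReal.ofReal_ne_top ((Finset.single_le_sum (f := fun i => ∫⁻ x, ENNReal.ofReal
      (reTr (Z i x ^ (2 * p))) ∂μ) (fun _ _ => zero_le) (Finset.mem_univ i)).trans
      (sum_lintegral_pow_le (Z₀ := 0) hZ hr hR hp hq))) a b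

/-- Integrable moments are real numbers. -/
lemma evenMoment_eq_ofReal {W : Ω → Mat d} (hWh : ∀ x, (W x).IsHermitian)
    (hi : Integrable (fun x => reTr (W x ^ (2 * p))) μ) :
    evenMoment μ W p =
      ENNReal.ofReal (((∫ x, reTr (W x ^ (2 * p)) ∂μ) / d) ^ ((1 : ℝ) / (2 * p))) := by
  have hnn : ∀ x, 0 ≤ reTr (W x ^ (2 * p)) := fun x => reTr_pow_two_mul_nonneg (hWh x) p
  simp only [evenMoment, re_ntr]
  rw [← ofReal_integral_eq_lintegral_ofReal (hi.div_const _)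
    (Filter.Eventually.of_forall fun x => div_nonneg (hnn x) (Nat.cast_nonneg _)), integral_div,
    ENNReal.ofReal_rpow_of_nonneg (div_nonneg (integral_nonneg hnn) (Nat.cast_nonneg _))
      (by positivity)]

lemma integrable_reTr_pow_of_memLp {W : Ω → Mat d} (hW : ∀ a b, Measurable fun x => W x a b)
    (hWp : ∀ a b, MemLp (fun x => W x a b) (2 * p : ℕ) μ) :
    Integrable (fun x => reTr (W x ^ (2 * p))) μ := by
  have h1 : ∀ x, 1 ≤ dominator (fun _ : Unit => W) x := one_le_dominator
  exact ((isDom_dominator (W := fun _ : Unit => W) (fun _ => hW) ()).pow h1 (2 * p)).integrable h1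
    (integrable_pow_of_memLp h1 (memLp_dominator fun _ => hWp)) le_rfl

lemma sigmaQ_ne_top (X : Ω → Mat d) : sigmaQ μ X q ≠ ∞ := by
  rw [sigmaQ]
  split_ifs
  · exact ENNReal.rpow_ne_top_of_nonneg (by norm_num) ENNReal.ofReal_ne_top
  · exact ENNReal.rpow_ne_top_of_nonneg (by positivity) ENNReal.ofReal_ne_top

/-- The elementary inequality behind the choice of the variance bound. -/
lemma rpow_third_le {P τ r : ℝ} (hP : 1 ≤ P) (hτ : 0 ≤ τ) (hr : 0 ≤ r) :
    8 * (P ^ 2 * (2 * τ ^ 2 + r ^ 2) * r) ^ ((1 : ℝ) / 3) + 16 * P * r ≤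
      24 * (r ^ ((1 : ℝ) / 3) * τ ^ ((2 : ℝ) / 3) * P ^ ((2 : ℝ) / 3) + r * P) := by
  have hP0 : 0 ≤ P := zero_le_one.trans hP
  have e3 : ∀ {x : ℝ}, 0 ≤ x → (x ^ 3) ^ ((1 : ℝ) / 3) = x := fun {x} hx => by
    rw [← Real.rpow_natCast, ← Real.rpow_mul hx]
    norm_num
  have e2 : ∀ {x : ℝ}, 0 ≤ x → (x ^ 2) ^ ((1 : ℝ) / 3) = x ^ ((2 : ℝ) / 3) := fun {x} hx => by
    rw [← Real.rpow_natCast, ← Real.rpow_mul hx]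
    norm_num
  have h1 : (P ^ 2 * (2 * τ ^ 2 + r ^ 2) * r) ^ ((1 : ℝ) / 3) ≤
      (2 ^ 3 * (r * τ ^ 2 * P ^ 2) + (r * P) ^ 3) ^ ((1 : ℝ) / 3) := by
    refine Real.rpow_le_rpow (by positivity) ?_ (by norm_num)
    have h : P ^ 2 ≤ P ^ 3 := pow_le_pow_right₀ hP (by norm_num)
    have h' : r ^ 3 * P ^ 2 ≤ r ^ 3 * P ^ 3 := by gcongr
    have : 0 ≤ r * τ ^ 2 * P ^ 2 := by positivity
    nlinarith
  have h2 := Real.rpow_add_le_add_rpow (a := 2 ^ 3 * (r * τ ^ 2 * P ^ 2)) (b := (r * P) ^ 3)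
    (by positivity) (by positivity) (p := (1 : ℝ) / 3) (by norm_num) (by norm_num)
  have e : (2 ^ 3 * (r * τ ^ 2 * P ^ 2)) ^ ((1 : ℝ) / 3) =
      2 * (r ^ ((1 : ℝ) / 3) * τ ^ ((2 : ℝ) / 3) * P ^ ((2 : ℝ) / 3)) := by
    rw [Real.mul_rpow (by positivity) (by positivity), Real.mul_rpow (by positivity)
      (by positivity), Real.mul_rpow hr (by positivity), e3 zero_le_two, e2 hτ, e2 hP0]
  rw [e, e3 (by positivity)] at h2
  have : 0 ≤ r ^ ((1 : ℝ) / 3) * τ ^ ((2 : ℝ) / 3) * P ^ ((2 : ℝ) / 3) := by positivity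
  linarith

/-- Comparison of the moments for numbers `r > R_q` and `τ > σ_q`. -/
lemma abs_moment_sub_le_of_lt (hd : 0 < d) (hZ₀ : Z₀.IsHermitian) (hZ : IsSummands μ Z)
    (hG : IsGaussianModel μ (model Z₀ Z) ν G) (hp : 1 ≤ p) (hq : ((2 * p : ℕ) : ℝ≥0∞) ≤ q)
    {r τ : ℝ} (hr : 0 < r) (hτ : 0 < τ) (hR : RQ μ Z q < ENNReal.ofReal r)
    (hσ : sigmaQ μ (model Z₀ Z) q < ENNReal.ofReal τ) :
    |((∫ x, reTr (model Z₀ Z x ^ (2 * p)) ∂μ) / d) ^ ((1 : ℝ) / (2 * p)) -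
      ((∫ x, reTr (G x ^ (2 * p)) ∂ν) / d) ^ ((1 : ℝ) / (2 * p))| ≤
      24 * (r ^ ((1 : ℝ) / 3) * τ ^ ((2 : ℝ) / 3) * (p : ℝ) ^ ((2 : ℝ) / 3) + r * p) := by
  have hsum := sum_lintegral_pow_le (Z₀ := Z₀) hZ hr hR hp hq
  have hZp := memLp_summands hZ hr hR hp hq
  have hV1 : reTr (matVar μ (model Z₀ Z)) ≤ 2 * d * τ ^ 2 := by
    have h2 : ((2 * 1 : ℕ) : ℝ≥0∞) ≤ q := le_trans (by exact_mod_cast (by omega)) hq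
    simpa using reTr_matVar_pow_le hZ hτ hσ le_rfl h2
  set s := Real.sqrt (2 * τ ^ 2 + r ^ 2) with hs
  have hs2 : s ^ 2 = 2 * τ ^ 2 + r ^ 2 := Real.sq_sqrt (by positivity)
  have hs0 : 0 < s := Real.sqrt_pos.mpr (by positivity)
  have hVs : reTr (matVar μ (model Z₀ Z) ^ p) ≤ d * s ^ (2 * p) := by
    refine (reTr_matVar_pow_le hZ hτ hσ hp hq).trans ?_
    have h1 : 2 * τ ^ (2 * p) ≤ s ^ (2 * p) := by
      rw [pow_mul, pow_mul, hs2]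
      calc 2 * (τ ^ 2) ^ p ≤ 2 ^ p * (τ ^ 2) ^ p := by
            gcongr
            exact le_self_pow₀ one_le_two (by omega)
        _ = (2 * τ ^ 2) ^ p := (mul_pow _ _ _).symm
        _ ≤ _ := by
            gcongr
            linarith [sq_nonneg r]
    have : (0 : ℝ) ≤ d := Nat.cast_nonneg d
    nlinarith
  have hnn : ∀ i x, 0 ≤ reTr (Z i x ^ (2 * p)) := fun i x =>
    reTr_pow_two_mul_nonneg (hZ.isHermitian i x) p
  have hZr : ∑ i, ∫ x, reTr (Z i x ^ (2 * p)) ∂μ ≤ d * s ^ 2 * r ^ (2 * p - 2) := by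
    have h1 : ENNReal.ofReal (∑ i, ∫ x, reTr (Z i x ^ (2 * p)) ∂μ) ≤
        ENNReal.ofReal (d * s ^ 2 * r ^ (2 * p - 2)) := by
      rw [ENNReal.ofReal_sum_of_nonneg fun i _ => integral_nonneg (hnn i)]
      rw [Finset.sum_congr rfl fun i _ => ofReal_integral_eq_lintegral_ofReal
        (integrable_reTr_pow_of_memLp (hZ.measurable i) (hZp i))
        (Filter.Eventually.of_forall (hnn i))]
      refine hsum.trans (ENNReal.ofReal_le_ofReal ?_)
      rw [hs2]
      have : 0 ≤ r ^ (2 * p - 2) := by positivity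
      nlinarith
    exact (ENNReal.ofReal_le_ofReal_iff (by positivity)).mp h1
  refine (abs_moment_sub_le hd hZ₀ hZ hZp hG hp hr hs0 hVs hZr).trans ?_
  rw [hs2]
  exact rpow_third_le (by exact_mod_cast hp) hτ.le hr.le

end Parameters

/-! ### The comparison of the moments -/

section Conclusion

variable {Ω Ω' : Type*} [MeasurableSpace Ω] [MeasurableSpace Ω'] {d n : ℕ} {μ : Measure Ω}
  {ν : Measure Ω'} [IsProbabilityMeasure μ] [IsProbabilityMeasure ν] {Z₀ : Mat d}
  {Z : Fin n → Ω → Mat d} {G : Ω' → Mat d} {p : ℕ} {q : ℝ≥0∞}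

/-- Comparison of the moments when `R_q` is finite. -/
lemma abs_moment_sub_le_toReal (hd : 0 < d) (hZ₀ : Z₀.IsHermitian) (hZ : IsSummands μ Z)
    (hG : IsGaussianModel μ (model Z₀ Z) ν G) (hp : 1 ≤ p) (hq : ((2 * p : ℕ) : ℝ≥0∞) ≤ q)
    (hR : RQ μ Z q ≠ ∞) :
    |((∫ x, reTr (model Z₀ Z x ^ (2 * p)) ∂μ) / d) ^ ((1 : ℝ) / (2 * p)) -
      ((∫ x, reTr (G x ^ (2 * p)) ∂ν) / d) ^ ((1 : ℝ) / (2 * p))| ≤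
      24 * ((RQ μ Z q).toReal ^ ((1 : ℝ) / 3) * (sigmaQ μ (model Z₀ Z) q).toReal ^ ((2 : ℝ) / 3) *
        (p : ℝ) ^ ((2 : ℝ) / 3) + (RQ μ Z q).toReal * p) := by
  set R := (RQ μ Z q).toReal with hRdef
  set σ := (sigmaQ μ (model Z₀ Z) q).toReal with hσdef
  have hcont : Continuous fun ε : ℝ => 24 * ((R + ε) ^ ((1 : ℝ) / 3) * (σ + ε) ^ ((2 : ℝ) / 3) *
      (p : ℝ) ^ ((2 : ℝ) / 3) + (R + ε) * p) := by
    have h1 : Continuous fun ε : ℝ => (R + ε) ^ ((1 : ℝ) / 3) :=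
      (continuous_const.add continuous_id).rpow_const fun _ => Or.inr (by norm_num)
    have h2 : Continuous fun ε : ℝ => (σ + ε) ^ ((2 : ℝ) / 3) :=
      (continuous_const.add continuous_id).rpow_const fun _ => Or.inr (by norm_num)
    fun_prop
  have hlim := (hcont.tendsto 0).mono_left (nhdsWithin_le_nhds (s := Set.Ioi 0))
  simp only [add_zero] at hlim
  refine ge_of_tendsto hlim ?_
  filter_upwards [self_mem_nhdsWithin] with ε hε
  have hε' : 0 < ε := hε
  have hlt : ∀ {a : ℝ≥0∞}, a ≠ ∞ → a < ENNReal.ofReal (a.toReal + ε) := fun {a} ha =>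
    (ENNReal.lt_ofReal_iff_toReal_lt ha).mpr (by linarith)
  exact abs_moment_sub_le_of_lt hd hZ₀ hZ hG hp hq (add_pos_of_nonneg_of_pos
    ENNReal.toReal_nonneg hε') (add_pos_of_nonneg_of_pos ENNReal.toReal_nonneg hε')
    (hlt hR) (hlt (sigmaQ_ne_top _))

end Conclusion

end MomentUniversality

open MomentUniversality

theorem mainTheorem3 :
    ∃ C : ℝ≥0, ∀ (d n p : ℕ) (q : ℝ≥0∞), 2 ≤ d → 1 ≤ p → ((2 * p : ℕ) : ℝ≥0∞) ≤ q →
      ∀ (Ω : Type*) [MeasurableSpace Ω] (μ : Measure Ω) [IsProbabilityMeasure μ]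
        (Ω' : Type*) [MeasurableSpace Ω'] (ν : Measure Ω') [IsProbabilityMeasure ν]
        (Z₀ : Mat d) (Z : Fin n → Ω → Mat d) (G : Ω' → Mat d),
        Z₀.IsHermitian → IsSummands μ Z → IsGaussianModel μ (model Z₀ Z) ν G →
        evenMoment μ (model Z₀ Z) p ≤ evenMoment ν G p +
            C * (RQ μ Z q ^ ((1 : ℝ) / 3) * sigmaQ μ (model Z₀ Z) q ^ ((2 : ℝ) / 3) *
              (p : ℝ≥0∞) ^ ((2 : ℝ) / 3) + RQ μ Z q * p) ∧
          evenMoment ν G p ≤ evenMoment μ (model Z₀ Z) p +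
            C * (RQ μ Z q ^ ((1 : ℝ) / 3) * sigmaQ μ (model Z₀ Z) q ^ ((2 : ℝ) / 3) *
              (p : ℝ≥0∞) ^ ((2 : ℝ) / 3) + RQ μ Z q * p) := by
  refine ⟨24, fun d n p q hd hp hq Ω _ μ _ Ω' _ ν _ Z₀ Z G hZ₀ hZ hG => ?_⟩
  by_cases hR : RQ μ Z q = ∞
  · have hp' : (p : ℝ≥0∞) ≠ 0 := by exact_mod_cast (by omega : p ≠ 0)
    have htop : ((24 : ℝ≥0) : ℝ≥0∞) * (RQ μ Z q ^ ((1 : ℝ) / 3) *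
        sigmaQ μ (model Z₀ Z) q ^ ((2 : ℝ) / 3) * (p : ℝ≥0∞) ^ ((2 : ℝ) / 3) + RQ μ Z q * p) = ∞ := by
      rw [hR, ENNReal.top_mul hp', add_top, ENNReal.mul_top (by norm_num)]
    rw [htop, add_top, add_top]
    exact ⟨le_top, le_top⟩
  have main := abs_moment_sub_le_toReal (by omega) hZ₀ hZ hG hp hq hR
  have hZp := memLp_summands hZ (r := (RQ μ Z q).toReal + 1)
    (add_pos_of_nonneg_of_pos ENNReal.toReal_nonneg one_pos)
    ((ENNReal.lt_ofReal_iff_toReal_lt hR).mpr (by linarith)) hp hq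
  have hXm : ∀ a b, Measurable fun x => model Z₀ Z x a b := fun a b => by
    simp only [model, Matrix.add_apply, Matrix.sum_apply]
    exact (Finset.measurable_fun_sum _ fun i _ => hZ.measurable i a b).const_add _
  have hXp : ∀ a b, MemLp (fun x => model Z₀ Z x a b) (2 * p : ℕ) μ := fun a b => by
    simp only [model, Matrix.add_apply, Matrix.sum_apply]
    exact (memLp_const (Z₀ a b)).add (memLp_finsetSum _ fun i _ => hZp i a b)
  have hGp : ∀ a b, MemLp (fun x => G x a b) (2 * p : ℕ) ν := fun a b => by
    simpa only [sub_zero] using hG.memLp_sub 0 (ENNReal.natCast_ne_top (2 * p)) a b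
  have hE : ((24 : ℝ≥0) : ℝ≥0∞) * (RQ μ Z q ^ ((1 : ℝ) / 3) *
      sigmaQ μ (model Z₀ Z) q ^ ((2 : ℝ) / 3) * (p : ℝ≥0∞) ^ ((2 : ℝ) / 3) + RQ μ Z q * p) =
      ENNReal.ofReal (24 * ((RQ μ Z q).toReal ^ ((1 : ℝ) / 3) *
        (sigmaQ μ (model Z₀ Z) q).toReal ^ ((2 : ℝ) / 3) *
        (p : ℝ) ^ ((2 : ℝ) / 3) + (RQ μ Z q).toReal * p)) := by
    have hR' := ENNReal.ofReal_toReal hR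
    have hσ' := ENNReal.ofReal_toReal (sigmaQ_ne_top (μ := μ) (q := q) (model Z₀ Z))
    rw [ENNReal.ofReal_mul (by norm_num), ENNReal.ofReal_add (by positivity) (by positivity),
      ENNReal.ofReal_mul (by positivity), ENNReal.ofReal_mul (by positivity),
      ENNReal.ofReal_mul ENNReal.toReal_nonneg,
      ← ENNReal.ofReal_rpow_of_nonneg ENNReal.toReal_nonneg (by norm_num),
      ← ENNReal.ofReal_rpow_of_nonneg ENNReal.toReal_nonneg (by norm_num),
      ← ENNReal.ofReal_rpow_of_nonneg (Nat.cast_nonneg _) (by norm_num), hR', hσ',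
      ENNReal.ofReal_natCast]
    norm_num
  rw [hE, evenMoment_eq_ofReal (hZ.isHermitian_model hZ₀) (integrable_reTr_pow_of_memLp hXm hXp),
    evenMoment_eq_ofReal hG.isHermitian (integrable_reTr_pow_of_memLp hG.measurable hGp)]
  have hab := abs_le.mp main
  have hB := (abs_nonneg _).trans main
  have hroot : ∀ x : ℝ, 0 ≤ x → 0 ≤ (x / d) ^ ((1 : ℝ) / (2 * p)) := fun x hx =>
    Real.rpow_nonneg (div_nonneg hx (Nat.cast_nonneg _)) _
  have h1 := hroot _ (integral_nonneg (μ := μ) fun x =>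
    reTr_pow_two_mul_nonneg (hZ.isHermitian_model hZ₀ x) p)
  have h2 := hroot _ (integral_nonneg (μ := ν) fun x =>
    reTr_pow_two_mul_nonneg (hG.isHermitian x) p)
  constructor
  · rw [← ENNReal.ofReal_add h2 hB]
    exact ENNReal.ofReal_le_ofReal (by linarith [hab.2])
  · rw [← ENNReal.ofReal_add h1 hB]
    exact ENNReal.ofReal_le_ofReal (by linarith [hab.1])
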